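/- **Conventions.** Let $\mathbb K=\mathbb R$ or $\mathbb C$ and let $N$ be a real or complex manifold of dimension $n$; all structures are $C^\infty$ in the real case and holomorphic in the complex case. A foliation is an involutive (smooth) distribution of constant codimension, a prime $'$ denotes the annihilator, $G^*\lambda=\lambda\circ G=\lambda(G\cdot,\dots,G\cdot)$ for a form $\lambda$ and a $(1,1)$-tensor $G$, and $\operatorname{Ker}\beta=\{v: i_v\beta=0\}$. Closed $1$-forms below may be defined on arbitrary open subsets. A *Veronese curve* in $\Lambda^rV^*$, $\dim V=n$, $r\ge1$, is a curve $\gamma(t)=\gamma_1(t)\wedge\dots\wedge\gamma_r(t)$, $\gamma_j(t)=\sum_{i=1}^{n_j}t^{i-1}e_{ij}$, where $n_j\ge 1$ and $\{e_{ij}\}$ is a basis of $V^*$. An *algebraic Veronese web* of codimension $r$ on $V$ is the family $u(t)=\operatorname{Ker}\gamma(t)$, $t\in\mathbb K$, of such a curve $\gamma$. Up to order, $n_1,\dots,n_r$ depend only on $u$; they are its *characteristic numbers*, their maximum is its *height*, and $u(\infty)=\operatorname{Ker}\lim_{t\to\infty}t^{r-n}\gamma(t)$. A *Veronese web* of codimension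 $r\ge1$ on $N$ is a family $w=\{w(t)\mid t\in\mathbb K\}$ of foliations of codimension $r$ such that around each point there is a curve $\gamma(t)$ of smooth $r$-forms (a *representative*) with $w(t)=\operatorname{Ker}\gamma(t)$ for all $t$ and with $\gamma(t)(q)$ a Veronese curve in $\Lambda^rT_q^*N$ for each $q$; $w(\infty)$ is defined pointwise. A $(1,1)$-tensor field is *flat* if around each point its coefficients are constant in suitable coordinates. A curve $f(t)((J+tI)^{-1})^*\beta$ means the curve polynomial in $t$ that is given at each point by this formula whenever $J+tI$ is invertible (part of the assertions is that it exists). **Theorem 2.1.** (1) Let $w$ be a Veronese web on $N$ of codimension $r$, let $1\le k\le r$, and let $a_1,\dots,a_{n-k},a\in\mathbb K$ be pairwise distinct. For each $p\in N$ there are an open set $A\ni p$ and a flat and diagonalizable $(1,1)$-tensor field $J$ on $A$, with characteristic polynomial $\bigl(\prod_{j=1}^{n-k}(t-a_j)\bigr)(t-a)^k$, such that: (I) every element of $\operatorname{Ker}(J^*-a_jI)$ vanishes on $w(-a_j)$, $j=1,\dots,n-k$, and every element of $\operatorname{Ker}(J^*-aI)$ vanishes on $w(-a)$; (II) for each $q\in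 A$, $(w(\infty)(q)',J^*(q))$ spans $T_q^*N$, that is, $w(\infty)(q)$ contains no nonzero $J$-invariant subspace. Moreover, if $\beta$ is an $r$-form (on an open subset of $A$) with $\operatorname{Ker}\beta=w(\infty)$, then $\gamma(t)=\bigl(\prod_{j=1}^{n-k}(t+a_j)\bigr)(t+a)^k((J+tI)^{-1})^*\beta$ represents $w$; and $d(\lambda\circ J)|_{w(\infty)}=0$ for each closed $1$-form $\lambda$ with $\operatorname{Ker}\lambda\supset w(\infty)$. (2) Let $w$ and $p$ be as in (1), let $n_1$ be the height of the algebraic Veronese web $w(p)$, let $k_j$ be the number of characteristic numbers of $w(p)$ that are $\ge j$, and let $\tilde a_1,\dots,\tilde a_{n_1}\in\mathbb K$ be pairwise distinct. There is a flat and diagonalizable $(1,1)$-tensor field $\tilde J$ on an open neighbourhood $\tilde A$ of $p$, with characteristic polynomial $\prod_{j=1}^{n_1}(t-\tilde a_j)^{k_j}$, such that every element of $\operatorname{Ker}(\tilde J^*-\tilde a_jI)$ vanishes on $w(-\tilde a_j)$ for $j=1,\dots,n_1$; $(w(\infty)',\tilde J^*)$ spans $T^*\tilde A$; $\tilde\gamma(t)=\prod_{j=1}^{n_1}(t+\tilde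 a_j)^{k_j}((\tilde J+tI)^{-1})^*\beta$ represents $w$ whenever $\operatorname{Ker}\beta=w(\infty)$; $\gamma=\tilde\gamma$ on $A\cap\tilde A$ for $\gamma$, $A$, $J$ as in (1) and the same $\beta$; and $d(\lambda\circ\tilde J)|_{w(\infty)}=0$ for each closed $1$-form $\lambda$ with $\operatorname{Ker}\lambda\supset w(\infty)$. (3) Let $\mathcal F$ be a foliation on $N$ of codimension $r\ge1$, and let $\bar J$ be a $(1,1)$-tensor field on $N$ with characteristic polynomial $\bar\varphi$ (whose coefficients are functions on $N$). Suppose that: (I) $(\mathcal F',\bar J^*)$ spans $T^*N$, that is, $\mathcal F$ contains no nonzero $\bar J$-invariant subspace at any point; (II) $(N_{\bar J})|_{\mathcal F}=0$, where $N_{\bar J}$ is the Nijenhuis torsion of $\bar J$, and $d(\mu\circ\bar J)|_{\mathcal F}=0$ for each closed $1$-form $\mu$ with $\operatorname{Ker}\mu\supset\mathcal F$. Then there is a Veronese web $\bar w$ of codimension $r$, depending only on $\mathcal F$ and $\bar J$, with $\bar w(\infty)=\mathcal F$, such that for each $r$-form $\bar\beta$ (on $N$ or on an open subset) with $\operatorname{Ker}\bar\beta=\mathcal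 F$ the curve $\bar\gamma(t)=(-1)^n\bar\varphi(-t)((\bar J+tI)^{-1})^*\bar\beta$ represents $\bar w$. Also, for any foliation $\mathcal F$ of codimension $r$ and any $(1,1)$-tensor field $\bar J$: where $\mathcal F=\operatorname{Ker}(\lambda_1\wedge\dots\wedge\lambda_r)$ with closed $1$-forms $\lambda_j$, the condition on $d(\mu\circ\bar J)$ in (II) holds if and only if $\lambda_1\wedge\dots\wedge\lambda_r\wedge d(\lambda_j\circ\bar J)=0$ for $j=1,\dots,r$. -/

import Mathlib

open Filter Topology Module
open scoped Manifold ContDiff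

namespace VeroneseWeb

/-! ## Algebraic Veronese webs on a vector space -/

section Algebra

variable {𝕜 V : Type*} [RCLike 𝕜] [AddCommGroup V] [Module 𝕜 V] {r : ℕ}

/-- The wedge product `l 0 ∧ ... ∧ l (r-1)` of `1`-forms: `v ↦ det (l j (v i))`. -/
noncomputable def wedge (l : Fin r → Dual 𝕜 V) : V [⋀^Fin r]→ₗ[𝕜] 𝕜 :=
  Matrix.detRowAlternating.compLinearMap (LinearMap.pi l)

/-- The kernel of an `r`-form: the vectors whose interior product with the form is zero. -/
def formKer (β : V [⋀^Fin r]→ₗ[𝕜] 𝕜) : Submodule 𝕜 V where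
  carrier := {v | ∀ (x : Fin r → V) (i : Fin r), β (Function.update x i v) = 0}
  add_mem' := by
    intro a b ha hb x i
    rw [AlternatingMap.map_update_add, ha, hb, add_zero]
  zero_mem' := by
    intro x i
    exact β.map_update_zero x i
  smul_mem' := by
    intro c a ha x i
    rw [AlternatingMap.map_update_smul, ha, smul_zero]

/-- `γ` splits as `γ₁(t) ∧ ... ∧ γᵣ(t)`, `γⱼ(t) = ∑ᵢ tⁱ⁻¹ eᵢⱼ`, along a basis `eᵢⱼ` of `V*` with
blocks of sizes `m j ≥ 1` (in the code `i` starts at `0`). -/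
def IsSplitting (γ : 𝕜 → V [⋀^Fin r]→ₗ[𝕜] 𝕜) (m : Fin r → ℕ) : Prop :=
  (∀ j, 1 ≤ m j) ∧ ∃ b : Basis (Σ j : Fin r, Fin (m j)) 𝕜 (Dual 𝕜 V),
    ∀ t, γ t = wedge (fun j => ∑ i : Fin (m j), t ^ (i : ℕ) • b ⟨j, i⟩)

/-- Veronese curves in `Λʳ V*`. -/
def IsVeroneseCurve (γ : 𝕜 → V [⋀^Fin r]→ₗ[𝕜] 𝕜) : Prop :=
  ∃ m : Fin r → ℕ, IsSplitting γ m

variable (r) in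
/-- The subspace `u(∞)` of an algebraic Veronese web `u` of codimension `r`: the kernel of
`γ(∞) = lim_{t → ∞} γ(t) / t ^ (n - r)`, where `γ` is a Veronese curve representing `u` (all
representatives are proportional, so they give the same subspace). -/
noncomputable def atInfinity (u : 𝕜 → Submodule 𝕜 V) : Submodule 𝕜 V :=
  sInf {S | ∃ γ : 𝕜 → V [⋀^Fin r]→ₗ[𝕜] 𝕜, IsVeroneseCurve γ ∧ (∀ t, formKer (γ t) = u t) ∧
    ∃ δ : V [⋀^Fin r]→ₗ[𝕜] 𝕜,
      (∀ x, Tendsto (fun t : 𝕜 => γ t x / t ^ (finrank 𝕜 V - r)) (Bornology.cobounded 𝕜)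
        (𝓝 (δ x))) ∧ S = formKer δ}

/-- `m` lists (in some order) the characteristic numbers of the algebraic Veronese web `u`. -/
def IsCharacteristicNumbers (u : 𝕜 → Submodule 𝕜 V) (m : Fin r → ℕ) : Prop :=
  ∃ γ : 𝕜 → V [⋀^Fin r]→ₗ[𝕜] 𝕜, IsSplitting γ m ∧ ∀ t, formKer (γ t) = u t

/-- The height: the largest characteristic number. -/
def height (m : Fin r → ℕ) : ℕ := Finset.univ.sup m

/-- `k_j`: the number of characteristic numbers that are at least `j`. -/
def countGE (m : Fin r → ℕ) (j : ℕ) : ℕ := (Finset.univ.filter fun l => j ≤ m l).card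

/-- `(W, J)` spans the space: `W + J W + J² W + ... = V`. -/
def Spans (W : Submodule 𝕜 V) (J : End 𝕜 V) : Prop := ⨆ i : ℕ, W.map (J ^ i) = ⊤

/-- `γ(t) = f(t) ((J + t I)⁻¹)^* β`, as a curve polynomial in `t` (which determines its values at
the finitely many `t` for which `J + t I` is singular). -/
def IsResolventCurve (f : 𝕜 → 𝕜) (J : End 𝕜 V) (β : V [⋀^Fin r]→ₗ[𝕜] 𝕜)
    (γ : 𝕜 → V [⋀^Fin r]→ₗ[𝕜] 𝕜) : Prop :=
  (∃ (d : ℕ) (c : ℕ → V [⋀^Fin r]→ₗ[𝕜] 𝕜), ∀ t, γ t = ∑ i ∈ Finset.range d, t ^ i • c i) ∧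
  ∀ t : 𝕜, IsUnit (J + t • (1 : End 𝕜 V)) →
    γ t = f t • β.compLinearMap (Ring.inverse (J + t • (1 : End 𝕜 V)))

end Algebra

/-! ## Tensor fields on a manifold

`N` is a manifold modelled on the finite-dimensional `𝕜`-vector space `E`, with `𝕜 = ℝ` or `ℂ`.
Smooth means `C^∞` over `𝕜`, that is to say holomorphic when `𝕜 = ℂ`. Fields are total functions;
only their values on a prescribed open set matter. -/

section Manifold

variable {𝕜 E N : Type*} [RCLike 𝕜] [NormedAddCommGroup E] [NormedSpace 𝕜 E]
  [TopologicalSpace N] [ChartedSpace E N]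

instance instFiniteDimensionalTangentSpace [FiniteDimensional 𝕜 E] (q : N) :
    FiniteDimensional 𝕜 (TangentSpace 𝓘(𝕜, E) q) :=
  inferInstanceAs (FiniteDimensional 𝕜 E)

variable (𝕜 E N) in
/-- (Not necessarily smooth) vector fields. -/
abbrev VField := ∀ q : N, TangentSpace 𝓘(𝕜, E) q

variable (𝕜 E N) in
/-- (Not necessarily smooth) `1`-forms. -/
abbrev OneForm := ∀ q : N, Dual 𝕜 (TangentSpace 𝓘(𝕜, E) q)

variable (𝕜 E N) in
/-- (Not necessarily smooth) `r`-forms. -/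
abbrev RForm (r : ℕ) := ∀ q : N, (TangentSpace 𝓘(𝕜, E) q) [⋀^Fin r]→ₗ[𝕜] 𝕜

variable (𝕜 E N) in
/-- (Not necessarily smooth) `(1,1)`-tensor fields. -/
abbrev Tensor11 := ∀ q : N, End 𝕜 (TangentSpace 𝓘(𝕜, E) q)

variable (𝕜 E N) in
/-- (Not necessarily smooth) distributions, that is families of subspaces of the tangent spaces. -/
abbrev Distribution := ∀ q : N, Submodule 𝕜 (TangentSpace 𝓘(𝕜, E) q)

/-- The `1`-form `λ ∘ J = J^* λ`. -/
noncomputable abbrev compTensor (l : OneForm 𝕜 E N) (J : Tensor11 𝕜 E N) : OneForm 𝕜 E N :=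
  fun q => l q ∘ₗ J q

section Smooth

variable [IsManifold 𝓘(𝕜, E) ∞ N]

/-- `X` is a smooth vector field on `U`. -/
def SmoothVField (U : Set N) (X : VField 𝕜 E N) : Prop :=
  ContMDiffOn 𝓘(𝕜, E) 𝓘(𝕜, E).tangent ∞ (fun q => (⟨q, X q⟩ : TangentBundle 𝓘(𝕜, E) N)) U

/-- `α` is a smooth `1`-form on `A`: its values on smooth local vector fields are smooth. -/
def SmoothOneForm (A : Set N) (α : OneForm 𝕜 E N) : Prop :=
  ∀ U ⊆ A, IsOpen U → ∀ X : VField 𝕜 E N, SmoothVField U X →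
    ContMDiffOn 𝓘(𝕜, E) 𝓘(𝕜, 𝕜) ∞ (fun q => α q (X q)) U

/-- `β` is a smooth `r`-form on `A`: its values on smooth local vector fields are smooth. -/
def SmoothRForm {r : ℕ} (A : Set N) (β : RForm 𝕜 E N r) : Prop :=
  ∀ U ⊆ A, IsOpen U → ∀ X : Fin r → VField 𝕜 E N, (∀ i, SmoothVField U (X i)) →
    ContMDiffOn 𝓘(𝕜, E) 𝓘(𝕜, 𝕜) ∞ (fun q => β q (fun i => X i q)) U

/-- `J` is a smooth `(1,1)`-tensor field on `A`: it maps smooth local vector fields to smooth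
vector fields. -/
def SmoothTensor11 (A : Set N) (J : Tensor11 𝕜 E N) : Prop :=
  ∀ U ⊆ A, IsOpen U → ∀ X : VField 𝕜 E N, SmoothVField U X →
    SmoothVField U (fun q => J q (X q))

/-- A foliation of codimension `r`, that is to say an involutive smooth distribution of constant
codimension `r`. -/
structure IsFoliation (r : ℕ) (D : Distribution 𝕜 E N) : Prop where
  codim : ∀ q, finrank 𝕜 (TangentSpace 𝓘(𝕜, E) q ⧸ D q) = r
  smooth : ∀ p : N, ∃ U : Set N, IsOpen U ∧ p ∈ U ∧
    ∃ (d : ℕ) (X : Fin d → VField 𝕜 E N), (∀ i, SmoothVField U (X i)) ∧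
      ∀ q ∈ U, LinearIndependent 𝕜 (fun i => X i q) ∧
        Submodule.span 𝕜 (Set.range fun i => X i q) = D q
  involutive : ∀ U : Set N, IsOpen U → ∀ X Y : VField 𝕜 E N,
    SmoothVField U X → SmoothVField U Y → (∀ q ∈ U, X q ∈ D q) → (∀ q ∈ U, Y q ∈ D q) →
      ∀ q ∈ U, VectorField.mlieBracket 𝓘(𝕜, E) X Y q ∈ D q

/-- The value at `q` of `dα(X, Y) = X(α(Y)) - Y(α(X)) - α([X, Y])`. -/
noncomputable def dOneForm (α : OneForm 𝕜 E N) (X Y : VField 𝕜 E N) (q : N) : 𝕜 :=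
  mvfderiv 𝓘(𝕜, E) (fun x => α x (Y x)) q (X q) - mvfderiv 𝓘(𝕜, E) (fun x => α x (X x)) q (Y q)
    - α q (VectorField.mlieBracket 𝓘(𝕜, E) X Y q)

/-- `(dα)|_D = 0` on `A`: at each point of `A` the `2`-form `dα` vanishes on pairs of vectors
of `D` (each vector being the value of some smooth local vector field). -/
def DVanishesOn (A : Set N) (D : Distribution 𝕜 E N) (α : OneForm 𝕜 E N) : Prop :=
  ∀ U ⊆ A, IsOpen U → ∀ X Y : VField 𝕜 E N, SmoothVField U X → SmoothVField U Y →
    ∀ q ∈ U, X q ∈ D q → Y q ∈ D q → dOneForm α X Y q = 0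

/-- `α` is a smooth closed `1`-form on `A`. -/
def IsClosedOneForm (A : Set N) (α : OneForm 𝕜 E N) : Prop :=
  SmoothOneForm A α ∧ DVanishesOn A (fun _ => ⊤) α

/-- On `A`: `d(λ ∘ J)|_D = 0` for each closed `1`-form `λ`, defined on some open subset of `A`,
such that `Ker λ ⊃ D`. -/
def ClosedCondition (A : Set N) (D : Distribution 𝕜 E N) (J : Tensor11 𝕜 E N) : Prop :=
  ∀ B ⊆ A, IsOpen B → ∀ l : OneForm 𝕜 E N, IsClosedOneForm B l →
    (∀ q ∈ B, D q ≤ LinearMap.ker (l q)) → DVanishesOn B D (compTensor l J)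

/-- The value at `q` of the Nijenhuis torsion
`N_J(X, Y) = [J X, J Y] + J² [X, Y] - J [J X, Y] - J [X, J Y]`. -/
noncomputable def nijenhuis (J : Tensor11 𝕜 E N) (X Y : VField 𝕜 E N) (q : N) :
    TangentSpace 𝓘(𝕜, E) q :=
  VectorField.mlieBracket 𝓘(𝕜, E) (fun x => J x (X x)) (fun x => J x (Y x)) q
    + J q (J q (VectorField.mlieBracket 𝓘(𝕜, E) X Y q))
    - J q (VectorField.mlieBracket 𝓘(𝕜, E) (fun x => J x (X x)) Y q)
    - J q (VectorField.mlieBracket 𝓘(𝕜, E) X (fun x => J x (Y x)) q)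

/-- `(N_J)|_D = 0`. -/
def NijenhuisVanishesOn (D : Distribution 𝕜 E N) (J : Tensor11 𝕜 E N) : Prop :=
  ∀ U : Set N, IsOpen U → ∀ X Y : VField 𝕜 E N, SmoothVField U X → SmoothVField U Y →
    ∀ q ∈ U, X q ∈ D q → Y q ∈ D q → nijenhuis J X Y q = 0

/-- `λ₁ ∧ ... ∧ λᵣ ∧ dα = 0` on `A`, evaluated on all smooth local vector fields (the sum below is
the wedge product up to a nonzero numerical factor). -/
def WedgeDVanishesOn {r : ℕ} (A : Set N) (l : Fin r → OneForm 𝕜 E N) (α : OneForm 𝕜 E N) : Prop :=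
  ∀ U ⊆ A, IsOpen U → ∀ Z : Fin (r + 2) → VField 𝕜 E N, (∀ i, SmoothVField U (Z i)) →
    ∀ q ∈ U, ∑ σ : Equiv.Perm (Fin (r + 2)), ((Equiv.Perm.sign σ : ℤ) : 𝕜) *
      ((∏ i : Fin r, l i q (Z (σ (Fin.castAdd 2 i)) q)) *
        dOneForm α (Z (σ (Fin.natAdd r 0))) (Z (σ (Fin.natAdd r 1))) q) = 0

/-- `J` is flat on `A`: around each point of `A` there are coordinates in which the coefficients
of `J` are constant. -/
def IsFlatOn (A : Set N) (J : Tensor11 𝕜 E N) : Prop :=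
  ∀ p ∈ A, ∃ e ∈ IsManifold.maximalAtlas 𝓘(𝕜, E) ∞ N, p ∈ e.source ∧ e.source ⊆ A ∧
    ∃ L : E →ₗ[𝕜] E, ∀ q ∈ e.source, ∀ v : TangentSpace 𝓘(𝕜, E) q,
      mvfderiv 𝓘(𝕜, E) e q (J q v) = L (mvfderiv 𝓘(𝕜, E) e q v)

/-- `J` is diagonalizable at each point of `A`. -/
def IsDiagonalizableOn (A : Set N) (J : Tensor11 𝕜 E N) : Prop :=
  ∀ q ∈ A, ⨆ μ : 𝕜, (J q).eigenspace μ = ⊤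

/-! ## Veronese webs on a manifold -/

/-- `γ` is a representative of the family `w` on `A`. -/
structure IsRepresentative {r : ℕ} (w : 𝕜 → Distribution 𝕜 E N) (A : Set N)
    (γ : 𝕜 → RForm 𝕜 E N r) : Prop where
  smooth : ∀ t, SmoothRForm A (γ t)
  ker : ∀ t, ∀ q ∈ A, formKer (γ t q) = w t q
  veronese : ∀ q ∈ A, IsVeroneseCurve (fun t => γ t q)

/-- Veronese webs of codimension `r`. -/
structure IsVeroneseWeb (r : ℕ) (w : 𝕜 → Distribution 𝕜 E N) : Prop where
  pos : 1 ≤ r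
  foliation : ∀ t, IsFoliation r (w t)
  local_repr : ∀ p : N, ∃ A : Set N, IsOpen A ∧ p ∈ A ∧
    ∃ γ : 𝕜 → RForm 𝕜 E N r, IsRepresentative w A γ

/-- The distribution `w(∞)` of a Veronese web of codimension `r`. -/
noncomputable def infinity (r : ℕ) (w : 𝕜 → Distribution 𝕜 E N) : Distribution 𝕜 E N :=
  fun q => atInfinity r (fun t => w t q)

/-- The annihilator of `D(q)` and `J^*(q)` span the cotangent space at `q`. -/
def SpansCotangent (D : Distribution 𝕜 E N) (J : Tensor11 𝕜 E N) (q : N) : Prop :=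
  Spans (D q).dualAnnihilator (J q).dualMap

/-- `β` is a smooth `r`-form on `B` whose kernel is `D`. -/
def DefinesOn {r : ℕ} (B : Set N) (β : RForm 𝕜 E N r) (D : Distribution 𝕜 E N) : Prop :=
  SmoothRForm B β ∧ ∀ q ∈ B, formKer (β q) = D q

/-- `γ(t) = f(t) ((J + t I)⁻¹)^* β` on `B`, where the scalar factor may depend on the point. -/
def IsResolventCurveOn {r : ℕ} (B : Set N) (f : N → 𝕜 → 𝕜) (J : Tensor11 𝕜 E N)
    (β : RForm 𝕜 E N r) (γ : 𝕜 → RForm 𝕜 E N r) : Prop :=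
  ∀ q ∈ B, IsResolventCurve (f q) (J q) (β q) (fun t => γ t q)

/-- `J` is a flat and diagonalizable `(1,1)`-tensor field on `A` with characteristic polynomial
`∏ i, (t - c i) ^ κ i`, such that `Ker (J^* - c i)` annihilates `w(- c i)` for all `i` and
`(w(∞)', J^*)` spans the cotangent spaces. -/
structure IsAdaptedTensor [FiniteDimensional 𝕜 E] (r : ℕ) (w : 𝕜 → Distribution 𝕜 E N) (A : Set N)
    (J : Tensor11 𝕜 E N) {ι : Type} [Fintype ι] (c : ι → 𝕜) (κ : ι → ℕ) : Prop where
  smooth : SmoothTensor11 A J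
  charpoly : ∀ q ∈ A, (J q).charpoly =
    ∏ i, (Polynomial.X - Polynomial.C (c i)) ^ κ i
  flat : IsFlatOn A J
  diagonalizable : IsDiagonalizableOn A J
  annihilates : ∀ q ∈ A, ∀ i, ∀ l : Dual 𝕜 (TangentSpace 𝓘(𝕜, E) q), l ∘ₗ J q = c i • l →
    ∀ v ∈ w (-c i) q, l v = 0
  spans : ∀ q ∈ A, SpansCotangent (infinity r w) J q

end Smooth

end Manifold

end VeroneseWeb

/-! Fix a point and a splitting basis `e i j` of the cotangent space, so that `γⱼ(t) = ∑ tⁱ e i j`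
(with `i` from `0`). Everything rests on one condition on an endomorphism `J`: on `w(∞)`, the common
kernel of the top covectors of the chains, `J` shifts the chains, `e 0 j (J v) = 0` and `e (i+1) j
(J v) = - e i j v` (`ShiftsChains`). Then `γⱼ(t) (J v + t v)` telescopes to zero, hence `(J + t)
w(∞) = w(t)`, and a determinant identity gives `(J + t)^* γ(t) = det (J + t) γ(∞)`. The resolvent
curve of `β = c γ(∞)` is therefore `c γ(t)`, whichever such `J` is used. This yields the
representative formulas, and the equality `γ = γ̃` of (1) and (2).

The shift condition arises in two ways. A diagonalizable `J` whose eigencovectors for each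
eigenvalue `c` vanish on `w(-c)` satisfies it: for `v` in `w(∞)` the vector `(shift - c) v` lies in
`w(-c)`, so every eigencovector gives `J v` and the shift of `v` the same value. Conversely, if
`(F', J^*)` spans, Kronecker's normal form of the pencil formed by the projection `V* → V*/F'` and
its composition with `J^*` produces a basis whose chains are shifted by `J` on `F`.

Existence in (1) and (2): Frobenius gives first integrals of the foliations `w(-c)`. Suitable linear
combinations of them have the covectors `γⱼ(-c)` as differentials at `p`; if the parameters are
distinct within each block, these covectors form a basis (Vandermonde), so the combinations are
coordinates. Take `J` diagonal in them. The two characteristic polynomials are two ways of labelling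
the basis vectors by eigenvalues.

Closedness and involutivity: with `B(X,Y) = [X,JY] + [JX,Y] - J[X,Y]` and vanishing torsion,
`[(J+t)X, (J+t)Y] = (J+t)(B(X,Y) + t[X,Y])`, while `d(λ∘J)(X,Y) = λ(B(X,Y))` for closed `λ` and `X`,
`Y` in the kernel of `λ`. In (1) and (2), involutivity of `w(t)` for two values of `t` puts `B(X,Y)`
in `w(∞)`. In (3) the same identity read backwards makes every `(J+t)F` involutive.

Smoothness of `γ(t)` where `J + t` is singular follows by Lagrange interpolation from `n + 1`
parameters at which it is invertible. The Frobenius theorem is proved over `ℝ` and `ℂ` at once: the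
total differential equation is solved along rays by the inverse function theorem in a Banach space
of curves, which makes the solution smooth over `𝕜` in its data. -/

namespace VeroneseWeb

set_option linter.unusedSectionVars false

/-! ### Superposition operators on spaces of continuous maps. -/

section Nemytskii

universe u

variable {𝕜 : Type*} [RCLike 𝕜] {K : Type*} [TopologicalSpace K] [CompactSpace K]

open scoped Classical in
/-- The superposition operator `y ↦ f ∘ y` on spaces of continuous maps, with value `0` where
`f ∘ y` is not continuous. -/
noncomputable def superpose {W F : Type*} [TopologicalSpace W] [NormedAddCommGroup F]
    (f : W → F) (y : C(K, W)) : C(K, F) :=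
  if h : Continuous (f ∘ y) then ⟨f ∘ y, h⟩ else 0

theorem superpose_apply {W F : Type*} [TopologicalSpace W] [NormedAddCommGroup F]
    {f : W → F} {O : Set W} (hf : ContinuousOn f O) {y : C(K, W)} (hy : ∀ s, y s ∈ O) (s : K) :
    superpose f y s = f (y s) := by
  have h : Continuous (f ∘ y) := hf.comp_continuous y.continuous hy
  simp [superpose, dif_pos h]

theorem isOpen_forall_mem {W : Type*} [TopologicalSpace W] {O : Set W} (hO : IsOpen O) :
    IsOpen {y : C(K, W) | ∀ s, y s ∈ O} := by
  have := ContinuousMap.isOpen_setOfPred_mapsTo (X := K) (Y := W) isCompact_univ hO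
  simpa [Set.MapsTo] using this

variable {W F : Type u} [NormedAddCommGroup W] [NormedSpace 𝕜 W] [NormedAddCommGroup F]
  [NormedSpace 𝕜 F]

-- The range of `y` is compact, so `f` is uniformly continuous near it, with one `δ` for all
-- parameters `s`.
omit [NormedSpace 𝕜 W] [NormedSpace 𝕜 F] in
theorem continuousOn_superpose {f : W → F} {O : Set W} (hO : IsOpen O) (hf : ContinuousOn f O) :
    ContinuousOn (superpose (K := K) f) {y | ∀ s, y s ∈ O} := by
  intro y hy
  refine ContinuousAt.continuousWithinAt ?_
  rw [Metric.continuousAt_iff]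
  intro ε hε
  have hc : IsCompact (Set.range y) := isCompact_range y.continuous
  have h1 := hc.uniformContinuousAt_of_continuousAt f
    (r := {p | dist p.1 p.2 < ε / 2}) (by
      rintro _ ⟨s, rfl⟩
      exact hf.continuousAt (hO.mem_nhds (hy s))) (Metric.dist_mem_uniformity (by positivity))
  obtain ⟨δ, hδ, h1⟩ := Metric.mem_uniformity_dist.1 h1
  obtain ⟨δ', hδ', h2⟩ := Metric.isOpen_iff.1 (isOpen_forall_mem (K := K) hO) y hy
  refine ⟨min δ δ', lt_min hδ hδ', fun {x} hx => ?_⟩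
  have hx' : ∀ s, x s ∈ O := h2 (hx.trans_le (min_le_right _ _))
  refine lt_of_le_of_lt ?_ (half_lt_self hε)
  rw [ContinuousMap.dist_le (by positivity)]
  intro s
  rw [superpose_apply hf hx', superpose_apply hf hy, dist_comm]
  refine (h1 ?_ ⟨s, rfl⟩).le
  rw [dist_comm]
  exact (ContinuousMap.dist_apply_le_dist s).trans_lt (hx.trans_le (min_le_left _ _))

variable (𝕜 K W F) in
/-- Pointwise application of a continuous family of operators, as a bounded bilinear map. -/
noncomputable def pointwiseApply : C(K, W →L[𝕜] F) →L[𝕜] C(K, W) →L[𝕜] C(K, F) :=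
  LinearMap.mkContinuous₂
    (LinearMap.mk₂ 𝕜 (fun (a : C(K, W →L[𝕜] F)) (h : C(K, W)) =>
      (⟨fun s => a s (h s), a.continuous.clm_apply h.continuous⟩ : C(K, F)))
      (fun _ _ _ => by ext; simp) (fun _ _ _ => by ext; simp)
      (fun _ _ _ => by ext; simp) (fun _ _ _ => by ext; simp)) 1 (by
      intro a h
      rw [one_mul]
      refine (ContinuousMap.norm_le _ (by positivity)).2 fun s => ?_
      exact (ContinuousLinearMap.le_opNorm (a s) (h s)).trans
        (mul_le_mul (a.norm_coe_le_norm s) (h.norm_coe_le_norm s) (norm_nonneg _) (norm_nonneg a)))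

@[simp]
theorem pointwiseApply_apply (a : C(K, W →L[𝕜] F)) (h : C(K, W)) (s : K) :
    pointwiseApply 𝕜 K W F a h s = a s (h s) := rfl

/-- Near the compact range of `y` the operator `Df` varies by less than `ε` on balls of a uniform
radius. The mean value inequality on the ball around each `y s` then bounds the remainder uniformly
in `s`. -/
theorem hasFDerivAt_superpose {f : W → F} {O : Set W} (hO : IsOpen O) (hf : ContDiffOn 𝕜 1 f O)
    {y : C(K, W)} (hy : ∀ s, y s ∈ O) :
    HasFDerivAt (𝕜 := 𝕜) (superpose (K := K) f)
      (pointwiseApply 𝕜 K W F (superpose (fderiv 𝕜 f) y)) y := by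
  have hf' : ContinuousOn (fderiv 𝕜 f) O := hf.continuousOn_fderiv_of_isOpen hO le_rfl
  have hd : DifferentiableOn 𝕜 f O := hf.differentiableOn one_ne_zero
  rw [hasFDerivAt_iff_isLittleO, Asymptotics.isLittleO_iff]
  intro ε hε
  have hc : IsCompact (Set.range y) := isCompact_range y.continuous
  have h1 := hc.uniformContinuousAt_of_continuousAt (fderiv 𝕜 f)
    (r := {p | dist p.1 p.2 < ε}) (by
      rintro _ ⟨s, rfl⟩
      exact hf'.continuousAt (hO.mem_nhds (hy s))) (Metric.dist_mem_uniformity hε)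
  obtain ⟨δ, hδ, h1⟩ := Metric.mem_uniformity_dist.1 h1
  obtain ⟨δ', hδ', h2⟩ := hc.exists_thickening_subset_open hO (by rintro _ ⟨s, rfl⟩; exact hy s)
  filter_upwards [Metric.ball_mem_nhds y (lt_min hδ hδ')] with x hx
  have hball : ∀ s, Metric.ball (y s) (min δ δ') ⊆ O := fun s w hw =>
    h2 (Metric.mem_thickening_iff.2 ⟨y s, ⟨s, rfl⟩, hw.trans_le (min_le_right _ _)⟩)
  have hxs : ∀ s, x s ∈ Metric.ball (y s) (min δ δ') := fun s =>
    (ContinuousMap.dist_apply_le_dist s).trans_lt hx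
  rw [ContinuousMap.norm_le _ (by positivity)]
  intro s
  have hx' : ∀ s, x s ∈ O := fun s => hball s (hxs s)
  let _ : NormedSpace ℝ W := NormedSpace.restrictScalars ℝ 𝕜 W
  have key := (convex_ball (y s) (min δ δ')).norm_image_sub_le_of_norm_fderiv_le'
    (𝕜 := 𝕜) (f := f) (φ := fderiv 𝕜 f (y s)) (C := ε) (x := y s) (y := x s)
    (fun w hw => (hd.differentiableAt (hO.mem_nhds (hball s hw))))
    (fun w hw => by
      rw [← dist_eq_norm, dist_comm]
      refine (h1 ?_ ⟨s, rfl⟩).le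
      rw [dist_comm]
      exact hw.trans_le (min_le_left _ _))
    (Metric.mem_ball_self (lt_min hδ hδ')) (hxs s)
  simp only [ContinuousMap.sub_apply, pointwiseApply_apply, superpose_apply hd.continuousOn hx',
    superpose_apply hd.continuousOn hy, superpose_apply hf' hy]
  refine key.trans (mul_le_mul_of_nonneg_left ?_ hε.le)
  exact (x - y).norm_coe_le_norm s

/-- The derivative is superposition with `Df` followed by a bounded linear operator, so the order of
smoothness increases by induction. The target is generalized because `Df` takes values in `W →L[𝕜]
F`. -/
theorem contDiffOn_superpose_nat (n : ℕ) : ∀ {F : Type u} [NormedAddCommGroup F] [NormedSpace 𝕜 F]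
    {f : W → F} {O : Set W}, IsOpen O → ContDiffOn 𝕜 n f O →
    ContDiffOn 𝕜 n (superpose (K := K) f) {y | ∀ s, y s ∈ O} := by
  induction n with
  | zero =>
    intro F _ _ f O hO hf
    have hf : ContDiffOn 𝕜 0 f O := by exact_mod_cast hf
    have := continuousOn_superpose (K := K) hO (contDiffOn_zero.1 hf)
    exact_mod_cast (contDiffOn_zero (𝕜 := 𝕜)).2 this
  | succ n ih =>
    intro F _ _ f O hO hf
    have hf1 : ContDiffOn 𝕜 1 f O := hf.of_le (by simp)
    have hOK := isOpen_forall_mem (K := K) hO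
    push_cast at hf ⊢
    rw [contDiffOn_succ_iff_fderiv_of_isOpen hOK]
    refine ⟨fun y hy => (hasFDerivAt_superpose hO hf1 hy).differentiableAt.differentiableWithinAt,
      by simp, ?_⟩
    have h2 := ((contDiffOn_succ_iff_fderiv_of_isOpen hO).1 hf).2.2
    have h3 := ih hO h2
    have h4 : ContDiff 𝕜 n (pointwiseApply 𝕜 K W F) :=
      ContinuousLinearMap.contDiff (𝕜 := 𝕜) (E := C(K, W →L[𝕜] F))
        (F := C(K, W) →L[𝕜] C(K, F)) (pointwiseApply 𝕜 K W F)
    refine ContDiffOn.congr (f := fun y => pointwiseApply 𝕜 K W F (superpose (fderiv 𝕜 f) y))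
      (h4.comp_contDiffOn h3) fun y hy => (hasFDerivAt_superpose hO hf1 hy).fderiv

theorem contDiffOn_superpose {f : W → F} {O : Set W} (hO : IsOpen O) (hf : ContDiffOn 𝕜 ∞ f O) :
    ContDiffOn 𝕜 ∞ (superpose (K := K) f) {y | ∀ s, y s ∈ O} :=
  contDiffOn_infty.2 fun n => contDiffOn_superpose_nat n hO (contDiffOn_infty.1 hf n)

end Nemytskii

/-! ### The integration operator on curves. -/

section Volterra

variable (𝕜 : Type*) [RCLike 𝕜] (F : Type*) [NormedAddCommGroup F] [NormedSpace 𝕜 F]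
  [NormedSpace ℝ F] [IsScalarTower ℝ 𝕜 F] [CompleteSpace F]

/-- Integration from `0`, as a bounded operator on continuous curves defined on `[0, 1]`. -/
noncomputable def volterra : C(unitInterval, F) →L[𝕜] C(unitInterval, F) :=
  haveI : SMulCommClass ℝ 𝕜 F := IsScalarTower.to_smulCommClass
  LinearMap.mkContinuous
    { toFun := fun g =>
        ⟨fun s => ∫ σ in (0 : ℝ)..s, g (Set.projIcc 0 1 zero_le_one σ),
          (intervalIntegral.continuous_primitive
            (fun a b => (g.continuous.comp continuous_projIcc).intervalIntegrable a b) 0).comp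
            continuous_subtype_val⟩
      map_add' := fun g h => by
        ext s
        exact intervalIntegral.integral_add
          ((g.continuous.comp continuous_projIcc).intervalIntegrable _ _)
          ((h.continuous.comp continuous_projIcc).intervalIntegrable _ _)
      map_smul' := fun c g => by
        ext s
        exact intervalIntegral.integral_smul c _ } 1 (by
    intro g
    rw [one_mul]
    refine (ContinuousMap.norm_le _ (norm_nonneg _)).2 fun s => ?_
    refine (intervalIntegral.norm_integral_le_of_norm_le_const
      fun σ _ => g.norm_coe_le_norm (Set.projIcc 0 1 zero_le_one σ)).trans ?_
    have h0 : (0 : ℝ) ≤ s := s.2.1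
    have h1 : (s : ℝ) ≤ 1 := s.2.2
    rw [sub_zero, abs_of_nonneg h0]
    exact mul_le_of_le_one_right (norm_nonneg _) h1)

theorem volterra_apply (g : C(unitInterval, F)) (s : unitInterval) :
    volterra 𝕜 F g s = ∫ σ in (0 : ℝ)..s, g (Set.projIcc 0 1 zero_le_one σ) := rfl

theorem norm_volterra_le (g : C(unitInterval, F)) : ‖volterra 𝕜 F g‖ ≤ ‖g‖ := by
  simpa using (volterra 𝕜 F).le_of_opNorm_le (LinearMap.mkContinuous_norm_le _ zero_le_one _) g

end Volterra

/-! ### Inverse function theorem. -/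

section LocalInverse

variable {𝕜 : Type*} [RCLike 𝕜] {E F : Type*} [NormedAddCommGroup E] [NormedSpace 𝕜 E]
  [NormedAddCommGroup F] [NormedSpace 𝕜 F] [CompleteSpace E]

/-- The inverse function theorem, with smoothness of the inverse on its whole domain. -/
theorem exists_smooth_localInverse {f : E → F} {O : Set E} (hO : IsOpen O)
    (hf : ContDiffOn 𝕜 ∞ f O) {a : E} (ha : a ∈ O) {f' : E ≃L[𝕜] F}
    (hf' : HasFDerivAt f (f' : E →L[𝕜] F) a) :
    ∃ e : OpenPartialHomeomorph E F, a ∈ e.source ∧ e.source ⊆ O ∧ (∀ x, e x = f x) ∧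
      ContDiffOn 𝕜 ∞ e.symm e.target := by
  have hfa : ContDiffAt 𝕜 ∞ f a := hf.contDiffAt (hO.mem_nhds ha)
  let e₀ := hfa.toOpenPartialHomeomorph f hf' (by simp)
  have hcont : ContinuousOn (fderiv 𝕜 f) O := hf.continuousOn_fderiv_of_isOpen hO (by simp)
  -- Restricting to the open set where `Df` is invertible makes the inverse smooth at every point of
  -- its domain, not only at `f a`.
  let O' : Set E := O ∩ fderiv 𝕜 f ⁻¹' (Set.range ((↑) : (E ≃L[𝕜] F) → E →L[𝕜] F))
  have hO' : IsOpen O' := hcont.isOpen_inter_preimage hO ContinuousLinearEquiv.isOpen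
  refine ⟨e₀.restrOpen O' hO', ?_, ?_, ?_, ?_⟩
  · rw [OpenPartialHomeomorph.restrOpen_source]
    exact ⟨hfa.mem_toOpenPartialHomeomorph_source hf' (by simp), ha, f', hf'.fderiv.symm⟩
  · rw [OpenPartialHomeomorph.restrOpen_source]
    exact fun x hx => hx.2.1
  · intro x
    rfl
  · intro y hy
    set e := e₀.restrOpen O' hO'
    have hx : e.symm y ∈ e.source := e.map_target hy
    have hx2 : e.symm y ∈ O' := by
      rw [OpenPartialHomeomorph.restrOpen_source] at hx
      exact hx.2
    obtain ⟨hxO, g, hg⟩ := hx2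
    have h1 : HasFDerivAt f (g : E →L[𝕜] F) (e.symm y) := by
      rw [hg]
      exact ((hf.contDiffAt (hO.mem_nhds hxO)).differentiableAt (by simp)).hasFDerivAt
    exact (e.contDiffAt_symm hy (f₀' := g) h1 (hf.contDiffAt (hO.mem_nhds hxO))).contDiffWithinAt

end LocalInverse

/-! ### The integral equation along rays. -/

section GraphFrobenius

universe u

variable {𝕜 : Type*} [RCLike 𝕜] {P C : Type u} [NormedAddCommGroup P] [NormedSpace 𝕜 P]
  [NormedAddCommGroup C] [NormedSpace 𝕜 C] [CompleteSpace P] [CompleteSpace C]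
  [NormedSpace ℝ P] [IsScalarTower ℝ 𝕜 P] [NormedSpace ℝ C] [IsScalarTower ℝ 𝕜 C]

variable (𝕜) in
/-- Constant curves. -/
noncomputable def constCurve (F : Type*) [NormedAddCommGroup F] [NormedSpace 𝕜 F] :
    F →L[𝕜] C(unitInterval, F) :=
  LinearMap.mkContinuous
    { toFun := fun c => ContinuousMap.const _ c
      map_add' := fun _ _ => rfl
      map_smul' := fun _ _ => rfl } 1 (fun c => by
        rw [one_mul]
        exact (ContinuousMap.norm_le _ (norm_nonneg _)).2 fun s => le_rfl)

theorem constCurve_apply (F : Type*) [NormedAddCommGroup F] [NormedSpace 𝕜 F] (c : F)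
    (s : unitInterval) : constCurve 𝕜 F c s = c := rfl

variable (𝕜 P C) in
/-- The curve `σ ↦ (σ x, y(σ))` over the segment from `0` to `x`. -/
noncomputable def rayCurve : P × C(unitInterval, C) →L[𝕜] C(unitInterval, P × C) :=
  LinearMap.mkContinuous
    { toFun := fun p => ⟨fun s => ((s : ℝ) • p.1, p.2 s), by fun_prop⟩
      map_add' := fun p q => by ext <;> simp
      map_smul' := fun c p => by
        have : SMulCommClass ℝ 𝕜 P := IsScalarTower.to_smulCommClass
        ext s
        · exact smul_comm _ _ _
        · simp } 1 (fun p => by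
      rw [one_mul]
      refine (ContinuousMap.norm_le _ (norm_nonneg _)).2 fun s => ?_
      refine max_le_max ?_ (p.2.norm_coe_le_norm s)
      refine (norm_smul_le _ _).trans (mul_le_of_le_one_left (norm_nonneg _) ?_)
      rw [Real.norm_of_nonneg s.2.1]
      exact s.2.2)

theorem rayCurve_apply (x : P) (y : C(unitInterval, C)) (s : unitInterval) :
    rayCurve 𝕜 P C (x, y) s = ((s : ℝ) • x, y s) := rfl

/-- The defect of `y` as a solution of `y' = A(σ x, y) x`, `y(0) = c`. -/
noncomputable def rayDefect (A : P × C → P →L[𝕜] C) (q : (P × C) × C(unitInterval, C)) :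
    C(unitInterval, C) :=
  q.2 - constCurve 𝕜 C q.1.2 - volterra 𝕜 C (pointwiseApply 𝕜 unitInterval P C
    (superpose A (rayCurve 𝕜 P C (q.1.1, q.2))) (constCurve 𝕜 P q.1.1))

/-- The explicit formula serves twice: at `x = 0` it shows that the partial derivative in the curve
is the identity, and on a family of solutions it is the linearized equation. -/
theorem hasFDerivAt_rayDefect {A : P × C → P →L[𝕜] C} {O : Set (P × C)} (hO : IsOpen O)
    (hA : ContDiffOn 𝕜 ∞ A O) {q : (P × C) × C(unitInterval, C)}
    (hq : ∀ s, rayCurve 𝕜 P C (q.1.1, q.2) s ∈ O) :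
    ∃ D : ((P × C) × C(unitInterval, C)) →L[𝕜] C(unitInterval, C),
      HasFDerivAt (rayDefect A) D q ∧ ∀ v w, D (v, w) = w - constCurve 𝕜 C v.2 -
        volterra 𝕜 C (pointwiseApply 𝕜 unitInterval P C
            (superpose A (rayCurve 𝕜 P C (q.1.1, q.2))) (constCurve 𝕜 P v.1) +
          pointwiseApply 𝕜 unitInterval P C
            (pointwiseApply 𝕜 unitInterval (P × C) (P →L[𝕜] C)
              (superpose (fderiv 𝕜 A) (rayCurve 𝕜 P C (q.1.1, q.2)))
              (rayCurve 𝕜 P C (v.1, w))) (constCurve 𝕜 P q.1.1)) := by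
  let L : ((P × C) × C(unitInterval, C)) →L[𝕜] P × C(unitInterval, C) :=
    ((ContinuousLinearMap.fst 𝕜 P C).comp (ContinuousLinearMap.fst 𝕜 _ _)).prod
      (ContinuousLinearMap.snd 𝕜 _ _)
  let Lx : ((P × C) × C(unitInterval, C)) →L[𝕜] P :=
    ((ContinuousLinearMap.fst 𝕜 P C).comp (ContinuousLinearMap.fst 𝕜 _ _))
  let Lc : ((P × C) × C(unitInterval, C)) →L[𝕜] C :=
    ((ContinuousLinearMap.snd 𝕜 P C).comp (ContinuousLinearMap.fst 𝕜 _ _))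
  have h1 : HasFDerivAt (fun q : (P × C) × C(unitInterval, C) => rayCurve 𝕜 P C (q.1.1, q.2))
      ((rayCurve 𝕜 P C).comp L) q := ((rayCurve 𝕜 P C).comp L).hasFDerivAt
  have h2 := (hasFDerivAt_superpose (K := unitInterval) hO
    (hA.of_le (by simp)) hq).comp q h1
  have h3 : HasFDerivAt (fun q : (P × C) × C(unitInterval, C) => constCurve 𝕜 P q.1.1)
      ((constCurve 𝕜 P).comp Lx) q := ((constCurve 𝕜 P).comp Lx).hasFDerivAt
  have h4 : HasFDerivAt (fun q : (P × C) × C(unitInterval, C) => q.2 - constCurve 𝕜 C q.1.2)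
      (ContinuousLinearMap.snd 𝕜 _ _ - (constCurve 𝕜 C).comp Lc) q :=
    (ContinuousLinearMap.snd 𝕜 _ _ - (constCurve 𝕜 C).comp Lc).hasFDerivAt
  have h5 := (pointwiseApply 𝕜 unitInterval P C).hasFDerivAt_of_bilinear h2 h3
  have h6 := h4.sub ((volterra 𝕜 C).hasFDerivAt.comp q h5)
  refine ⟨_, h6, fun v w => ?_⟩
  simp [L, Lx, Lc]

theorem contDiffOn_rayDefect {A : P × C → P →L[𝕜] C} {O : Set (P × C)} (hO : IsOpen O)
    (hA : ContDiffOn 𝕜 ∞ A O) :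
    ContDiffOn 𝕜 ∞ (rayDefect A)
      {q : (P × C) × C(unitInterval, C) | ∀ s, rayCurve 𝕜 P C (q.1.1, q.2) s ∈ O} := by
  have h1 : ContDiff 𝕜 ∞
      (fun q : (P × C) × C(unitInterval, C) => rayCurve 𝕜 P C (q.1.1, q.2)) := by fun_prop
  have h2 : ContDiffOn 𝕜 ∞ (fun q : (P × C) × C(unitInterval, C) =>
      superpose A (rayCurve 𝕜 P C (q.1.1, q.2)))
      {q : (P × C) × C(unitInterval, C) | ∀ s, rayCurve 𝕜 P C (q.1.1, q.2) s ∈ O} :=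
    (contDiffOn_superpose (K := unitInterval) hO hA).comp h1.contDiffOn (fun q hq => hq)
  have h3 : ContDiff 𝕜 ∞ fun p : C(unitInterval, P →L[𝕜] C) × C(unitInterval, P) =>
      pointwiseApply 𝕜 unitInterval P C p.1 p.2 :=
    (ContinuousLinearMap.isBoundedBilinearMap (𝕜 := 𝕜) (E := C(unitInterval, P →L[𝕜] C))
      (F := C(unitInterval, P)) (G := C(unitInterval, C))
      (pointwiseApply 𝕜 unitInterval P C)).contDiff
  have h4 : ContDiff 𝕜 ∞
      (fun q : (P × C) × C(unitInterval, C) => constCurve 𝕜 P q.1.1) := by fun_prop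
  have h5 := h3.comp_contDiffOn (h2.prodMk h4.contDiffOn)
  exact ContDiffOn.sub (ContDiff.contDiffOn (by fun_prop))
    ((volterra 𝕜 C).contDiff.comp_contDiffOn h5)

end GraphFrobenius

/-! ### Existence of solutions along rays. -/

section GraphFrobenius

universe u

variable {𝕜 : Type*} [RCLike 𝕜] {P C : Type u} [NormedAddCommGroup P] [NormedSpace 𝕜 P]
  [NormedAddCommGroup C] [NormedSpace 𝕜 C] [CompleteSpace P] [CompleteSpace C]
  [NormedSpace ℝ P] [IsScalarTower ℝ 𝕜 P] [NormedSpace ℝ C] [IsScalarTower ℝ 𝕜 C]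

/-- Apply the inverse function theorem to `(x, c, y) ↦ (x, c, defect)` at the origin. There the term
with `DA` is multiplied by `x = 0`, so the derivative is block triangular with identity diagonal.
Smooth dependence of the solution on `(x, c)` comes for free. -/
theorem exists_raySolution {A : P × C → P →L[𝕜] C} {O : Set (P × C)} (hO : IsOpen O)
    (hA : ContDiffOn 𝕜 ∞ A O) (h0 : (0 : P × C) ∈ O) :
    ∃ (Z : Set (P × C)) (ψ : P × C → C(unitInterval, C)), IsOpen Z ∧ (0 : P × C) ∈ Z ∧
      ContDiffOn 𝕜 ∞ ψ Z ∧ ∀ z ∈ Z, rayDefect A (z, ψ z) = 0 ∧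
        ∀ s, rayCurve 𝕜 P C (z.1, ψ z) s ∈ O := by
  let O₂ : Set ((P × C) × C(unitInterval, C)) :=
    {q | ∀ s, rayCurve 𝕜 P C (q.1.1, q.2) s ∈ O}
  have hO₂ : IsOpen O₂ := by
    have h1 : Continuous
      (fun q : (P × C) × C(unitInterval, C) => rayCurve 𝕜 P C (q.1.1, q.2)) := by fun_prop
    exact (isOpen_forall_mem (K := unitInterval) hO).preimage h1
  have h0' : (0 : (P × C) × C(unitInterval, C)) ∈ O₂ := by
    intro s
    rw [rayCurve_apply]
    have h1 : ((s : ℝ) • (0 : P), (0 : C)) = (0 : P × C) := Prod.ext (smul_zero _) rfl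
    exact h1 ▸ h0
  have hΘ : ContDiffOn 𝕜 ∞ (fun q : (P × C) × C(unitInterval, C) => (q.1, rayDefect A q)) O₂ :=
    contDiffOn_fst.prodMk (contDiffOn_rayDefect hO hA)
  obtain ⟨D, hD, hDf⟩ := hasFDerivAt_rayDefect hO hA h0'
  let T : ((P × C) × C(unitInterval, C)) ≃L[𝕜] ((P × C) × C(unitInterval, C)) :=
    ContinuousLinearEquiv.equivOfInverse
      ((ContinuousLinearMap.fst 𝕜 _ _).prod D)
      ((ContinuousLinearMap.fst 𝕜 _ _).prod (ContinuousLinearMap.snd 𝕜 _ _ -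
        D.comp ((ContinuousLinearMap.inl 𝕜 _ _).comp (ContinuousLinearMap.fst 𝕜 _ _))))
      (by
        rintro ⟨v, w⟩
        simp [hDf])
      (by
        rintro ⟨v, w⟩
        simp [hDf]
        abel)
  have hT : HasFDerivAt (fun q : (P × C) × C(unitInterval, C) => (q.1, rayDefect A q))
      (T : ((P × C) × C(unitInterval, C)) →L[𝕜] ((P × C) × C(unitInterval, C))) 0 :=
    hasFDerivAt_fst.prodMk hD
  obtain ⟨e, h0e, heO, hef, hes⟩ := exists_smooth_localInverse hO₂ hΘ h0' hT
  have hmap : ContDiff 𝕜 ∞ (fun z : P × C => (z, (0 : C(unitInterval, C)))) := by fun_prop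
  refine ⟨{z | (z, 0) ∈ e.target}, fun z => (e.symm (z, 0)).2,
    e.open_target.preimage hmap.continuous, ?_, ?_, ?_⟩
  · have := e.map_source h0e
    rw [hef] at this
    have h2 : rayDefect A (0 : (P × C) × C(unitInterval, C)) = 0 := by
      simp [rayDefect]
    rw [h2] at this
    exact this
  · exact contDiff_snd.comp_contDiffOn (hes.comp hmap.contDiffOn (fun z hz => hz))
  · intro z hz
    have h1 := e.right_inv hz
    rw [hef] at h1
    have h2 : (e.symm (z, 0)).1 = z := congrArg Prod.fst h1
    have h3 : rayDefect A (e.symm (z, 0)) = 0 := congrArg Prod.snd h1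
    have h4 : (z, (e.symm (z, 0)).2) = e.symm (z, 0) := Prod.ext h2.symm rfl
    refine ⟨by rw [h4]; exact h3, fun s => ?_⟩
    have h5 := heO (e.map_target hz) s
    rwa [h2] at h5

/-- Along a solution over a ray, `σ ↦ σ A(σ x, y(σ)) v` is the integral of its derivative. -/
theorem ray_smul_eq_volterra {A : P × C → P →L[𝕜] C} {O : Set (P × C)} (hO : IsOpen O)
    (hA : ContDiffOn 𝕜 ∞ A O) {z : P × C} {y : C(unitInterval, C)}
    (hy : rayDefect A (z, y) = 0) (hyO : ∀ s, rayCurve 𝕜 P C (z.1, y) s ∈ O) (v : P)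
    (g f : C(unitInterval, C))
    (hg : ∀ s : unitInterval, g s = (s : ℝ) • A (rayCurve 𝕜 P C (z.1, y) s) v)
    (hf : ∀ s : unitInterval, f s = A (rayCurve 𝕜 P C (z.1, y) s) v +
      (s : ℝ) • fderiv 𝕜 A (rayCurve 𝕜 P C (z.1, y) s)
        (z.1, A (rayCurve 𝕜 P C (z.1, y) s) z.1) v) :
    g = volterra 𝕜 C f := by
  -- Curves on `[0, 1]` are extended to the line by constants; derivatives are taken only on the
  -- open interval, which is enough for the fundamental theorem of calculus.
  let pr : ℝ → unitInterval := Set.projIcc 0 1 zero_le_one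
  have hpr : ∀ t ∈ Set.Ioo (0 : ℝ) 1, ((pr t : unitInterval) : ℝ) = t := fun t ht => by
    simp only [pr]
    rw [Set.projIcc_of_mem zero_le_one (Set.Ioo_subset_Icc_self ht)]
  have hprc : Continuous pr := continuous_projIcc
  let w : C(unitInterval, P × C) := rayCurve 𝕜 P C (z.1, y)
  have hwO : ∀ s, w s ∈ O := hyO
  have hAc := hA.continuousOn
  -- the derivative of `y`
  let k : C(unitInterval, C) := pointwiseApply 𝕜 unitInterval P C (superpose A w)
    (constCurve 𝕜 P z.1)
  have hk : ∀ s, k s = A (w s) z.1 := fun s => by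
    simp only [k, pointwiseApply_apply, constCurve_apply, superpose_apply hAc hwO]
  have hyk : ∀ s, y s = z.2 + ∫ σ in (0 : ℝ)..s, k (pr σ) := by
    intro s
    have := DFunLike.congr_fun hy s
    simp only [rayDefect, ContinuousMap.sub_apply, constCurve_apply, volterra_apply,
      ContinuousMap.zero_apply] at this
    rw [sub_eq_zero, sub_eq_iff_eq_add'] at this
    exact this
  have hyd : ∀ t ∈ Set.Ioo (0 : ℝ) 1, HasDerivAt (fun t => y (pr t)) (A (w (pr t)) z.1) t := by
    intro t ht
    have h1 : HasDerivAt (fun t : ℝ => z.2 + ∫ σ in (0 : ℝ)..t, k (pr σ)) (k (pr t)) t :=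
      ((k.continuous.comp hprc).integral_hasStrictDerivAt 0 t).hasDerivAt.const_add _
    rw [hk] at h1
    refine h1.congr_of_eventuallyEq ?_
    filter_upwards [isOpen_Ioo.mem_nhds ht] with t' ht'
    rw [hyk, hpr t' ht']
  have hwd : ∀ t ∈ Set.Ioo (0 : ℝ) 1,
      HasDerivAt (fun t => w (pr t)) (z.1, A (w (pr t)) z.1) t := by
    intro t ht
    have h1 : HasDerivAt (fun t : ℝ => t • z.1) z.1 t := by
      simpa using (hasDerivAt_id t).smul_const z.1
    refine (h1.prodMk (hyd t ht)).congr_of_eventuallyEq ?_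
    filter_upwards [isOpen_Ioo.mem_nhds ht] with t' ht'
    simp only [w, rayCurve_apply, hpr t' ht']
  have hgd : ∀ t ∈ Set.Ioo (0 : ℝ) 1, HasDerivAt (fun t => g (pr t)) (f (pr t)) t := by
    intro t ht
    have h1 : HasFDerivAt A (fderiv 𝕜 A (w (pr t))) (w (pr t)) :=
      ((hA.contDiffAt (hO.mem_nhds (hwO _))).differentiableAt (by simp)).hasFDerivAt
    have h2 : HasDerivAt (fun t => A (w (pr t)))
        (fderiv 𝕜 A (w (pr t)) (z.1, A (w (pr t)) z.1)) t := by
      have h1' := h1.restrictScalars ℝ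
      have := h1'.comp_hasDerivAt t (hwd t ht)
      exact this
    let ev : (P →L[𝕜] C) →L[𝕜] C := ContinuousLinearMap.apply 𝕜 C v
    have h3 : HasDerivAt (fun t => A (w (pr t)) v)
        (fderiv 𝕜 A (w (pr t)) (z.1, A (w (pr t)) z.1) v) t :=
      (ev.hasFDerivAt.restrictScalars ℝ).comp_hasDerivAt t h2
    have h4 := (hasDerivAt_id t).smul h3
    rw [hf]
    simp only [hpr t ht]
    convert h4.congr_of_eventuallyEq ?_ using 1
    · simp only [id, one_smul]
      exact add_comm _ _
    · filter_upwards [isOpen_Ioo.mem_nhds ht] with t' ht'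
      simp only [hg, hpr t' ht', Pi.smul_apply', id]
      rfl
  ext s
  rw [volterra_apply]
  have hs0 : (0 : ℝ) ≤ s := s.2.1
  have hs1 : (s : ℝ) ≤ 1 := s.2.2
  have key := intervalIntegral.integral_eq_sub_of_hasDerivAt_of_le hs0
    (f := fun t => g (pr t)) (f' := fun t => f (pr t))
    (g.continuous.comp hprc).continuousOn
    (fun t ht => hgd t ⟨ht.1, ht.2.trans_le hs1⟩)
    ((f.continuous.comp hprc).intervalIntegrable _ _)
  refine Eq.trans ?_ key.symm
  have h1 : pr (s : ℝ) = s := Set.projIcc_val zero_le_one s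
  have h2 : g (pr 0) = 0 := by
    rw [hg]
    have : ((pr 0 : unitInterval) : ℝ) = 0 := by simp [pr]
    rw [this, zero_smul]
  simp only [h1, h2, sub_zero]

end GraphFrobenius

/-! ### Integrability and first integrals of a graph distribution. -/

section GraphFrobenius

universe u

variable {𝕜 : Type*} [RCLike 𝕜] {P C : Type u} [NormedAddCommGroup P] [NormedSpace 𝕜 P]
  [NormedAddCommGroup C] [NormedSpace 𝕜 C] [CompleteSpace P] [CompleteSpace C]
  [NormedSpace ℝ P] [IsScalarTower ℝ 𝕜 P] [NormedSpace ℝ C] [IsScalarTower ℝ 𝕜 C]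

/-- If the total differential equation `dy = A(x, y) dx` is integrable, then the endpoints of the
solutions over rays solve it. -/
theorem fderiv_rayEnd {A : P × C → P →L[𝕜] C} {O : Set (P × C)} (hO : IsOpen O)
    (hA : ContDiffOn 𝕜 ∞ A O)
    (hint : ∀ z ∈ O, ∀ u v, fderiv 𝕜 A z (u, A z u) v = fderiv 𝕜 A z (v, A z v) u)
    {M : ℝ} (hM : ∀ z ∈ O, ‖fderiv 𝕜 A z‖ ≤ M) {Z : Set (P × C)} (hZ : IsOpen Z)
    {ψ : P × C → C(unitInterval, C)} (hψ : ContDiffOn 𝕜 ∞ ψ Z)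
    (hψZ : ∀ z ∈ Z, rayDefect A (z, ψ z) = 0 ∧ ∀ s, rayCurve 𝕜 P C (z.1, ψ z) s ∈ O)
    {z : P × C} (hz : z ∈ Z) (hMz : M * ‖z.1‖ < 1) (v : P) :
    fderiv 𝕜 (fun z => ψ z 1) z (v, 0) = A (z.1, ψ z 1) v := by
  obtain ⟨hy, hyO⟩ := hψZ z hz
  have hAc := hA.continuousOn
  have hAc' : ContinuousOn (fderiv 𝕜 A) O := hA.continuousOn_fderiv_of_isOpen hO (by simp)
  have hψd : HasFDerivAt ψ (fderiv 𝕜 ψ z) z :=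
    ((hψ.contDiffAt (hZ.mem_nhds hz)).differentiableAt (by simp)).hasFDerivAt
  let w : C(unitInterval, P × C) := rayCurve 𝕜 P C (z.1, ψ z)
  have hwO : ∀ s, w s ∈ O := hyO
  let yd : C(unitInterval, C) := fderiv 𝕜 ψ z (v, 0)
  let Aw : C(unitInterval, P →L[𝕜] C) := superpose A w
  let DAw : C(unitInterval, P × C →L[𝕜] P →L[𝕜] C) := superpose (fderiv 𝕜 A) w
  have hAw : ∀ s, Aw s = A (w s) := fun s => superpose_apply hAc hwO s
  have hDAw : ∀ s, DAw s = fderiv 𝕜 A (w s) := fun s => superpose_apply hAc' hwO s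
  -- the linearized equation
  let k : C(unitInterval, C) := pointwiseApply 𝕜 unitInterval P C Aw (constCurve 𝕜 P v) +
    pointwiseApply 𝕜 unitInterval P C
      (pointwiseApply 𝕜 unitInterval (P × C) (P →L[𝕜] C) DAw (rayCurve 𝕜 P C (v, yd)))
      (constCurve 𝕜 P z.1)
  -- Differentiate the identity `rayDefect A (z, ψ z) = 0` in the direction `(v, 0)`.
  have hlin : yd = volterra 𝕜 C k := by
    obtain ⟨D, hD, hDf⟩ := hasFDerivAt_rayDefect hO hA (q := (z, ψ z)) hyO
    have h1 : HasFDerivAt (fun z => rayDefect A (z, ψ z))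
        (D.comp ((ContinuousLinearMap.id 𝕜 _).prod (fderiv 𝕜 ψ z))) z :=
      HasFDerivAt.comp (g := rayDefect A) (f := fun z => (z, ψ z)) z hD
        ((hasFDerivAt_id z).prodMk hψd)
    have h2 : HasFDerivAt (fun z => rayDefect A (z, ψ z))
        (0 : P × C →L[𝕜] C(unitInterval, C)) z :=
      (hasFDerivAt_const (0 : C(unitInterval, C)) z).congr_of_eventuallyEq
        (by filter_upwards [hZ.mem_nhds hz] with z' hz' using (hψZ z' hz').1)
    have h3 := DFunLike.congr_fun (h1.unique h2) (v, 0)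
    have h4 : D ((v, 0), yd) = 0 := h3
    rw [hDf] at h4
    simp only [map_zero, sub_zero] at h4
    exact sub_eq_zero.1 h4
  -- the comparison curve
  let g : C(unitInterval, C) := ⟨fun s => (s : ℝ) • A (w s) v, by
    have : Continuous fun s => A (w s) := hAc.comp_continuous w.continuous hwO
    exact continuous_subtype_val.smul (this.clm_apply continuous_const)⟩
  let f : C(unitInterval, C) := ⟨fun s => A (w s) v + (s : ℝ) • fderiv 𝕜 A (w s)
      (z.1, A (w s) z.1) v, by
    have h1 : Continuous fun s => A (w s) := hAc.comp_continuous w.continuous hwO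
    have h2 : Continuous fun s => fderiv 𝕜 A (w s) := hAc'.comp_continuous w.continuous hwO
    exact (h1.clm_apply continuous_const).add (continuous_subtype_val.smul
      ((h2.clm_apply (continuous_const.prodMk (h1.clm_apply continuous_const))).clm_apply
        continuous_const))⟩
  have hgf : g = volterra 𝕜 C f :=
    ray_smul_eq_volterra hO hA hy hyO v g f (fun s => rfl) (fun s => rfl)
  -- The curve `s ↦ s A(w s) v` is the expected derivative of the solution; `η` measures the error
  -- and will satisfy a homogeneous linear Volterra equation.
  let η : C(unitInterval, C) := yd - g
  have hη : η = volterra 𝕜 C (k - f) := by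
    rw [map_sub, ← hlin, ← hgf]
  have hη0 : η = 0 := by
    by_contra hne
    have hpos : 0 < ‖η‖ := norm_pos_iff.2 hne
    have hbound : ‖k - f‖ ≤ M * ‖z.1‖ * ‖η‖ := by
      have hM0 : 0 ≤ M := (norm_nonneg (fderiv 𝕜 A (w 0))).trans (hM _ (hwO 0))
      refine (ContinuousMap.norm_le _ (by positivity)).2 fun s => ?_
      have h1 : (k - f) s = fderiv 𝕜 A (w s) (0, η s) z.1 := by
        have h2 : ((0 : P), η s) =
            ((s : ℝ) • v, yd s) - (s : ℝ) • (v, A (w s) v) := by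
          ext
          · simp
          · simp [η, g]
        have h5 : ∀ a b : P × C, fderiv 𝕜 A (w s) (a - b) z.1 =
            fderiv 𝕜 A (w s) a z.1 - fderiv 𝕜 A (w s) b z.1 := fun a b => by
          rw [map_sub]
          rfl
        rw [h2, h5]
        -- Here integrability enters: exchanging `v` and `z.1` makes all terms cancel except the one
        -- in `η`.
        have h3 : fderiv 𝕜 A (w s) ((s : ℝ) • (v, A (w s) v)) z.1 =
            (s : ℝ) • fderiv 𝕜 A (w s) (z.1, A (w s) z.1) v := by
          rw [hint _ (hwO s) z.1 v]
          rw [← algebraMap_smul 𝕜 (s : ℝ), map_smul, algebraMap_smul]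
          rfl
        rw [h3]
        simp only [k, f, ContinuousMap.sub_apply, ContinuousMap.add_apply, pointwiseApply_apply,
          constCurve_apply, rayCurve_apply, hAw, hDAw, ContinuousMap.coe_mk]
        abel
      rw [h1]
      calc ‖fderiv 𝕜 A (w s) (0, η s) z.1‖ ≤ ‖fderiv 𝕜 A (w s) (0, η s)‖ * ‖z.1‖ :=
            ContinuousLinearMap.le_opNorm _ _
        _ ≤ ‖fderiv 𝕜 A (w s)‖ * ‖((0 : P), η s)‖ * ‖z.1‖ :=
            mul_le_mul_of_nonneg_right (ContinuousLinearMap.le_opNorm _ _) (norm_nonneg _)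
        _ ≤ M * ‖η‖ * ‖z.1‖ := by
            refine mul_le_mul_of_nonneg_right (mul_le_mul (hM _ (hwO s)) ?_ (norm_nonneg _) hM0)
              (norm_nonneg _)
            rw [Prod.norm_mk, norm_zero]
            exact max_le (norm_nonneg _) (η.norm_coe_le_norm s)
        _ = M * ‖z.1‖ * ‖η‖ := by ring
    -- Integration has norm at most one and `M * ‖z.1‖ < 1`, so this inequality is incompatible with
    -- `η ≠ 0`.
    have h1 : ‖η‖ ≤ M * ‖z.1‖ * ‖η‖ := by
      calc ‖η‖ = ‖volterra 𝕜 C (k - f)‖ := by rw [← hη]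
        _ ≤ _ := (norm_volterra_le 𝕜 C _).trans hbound
    nlinarith
  let ev : C(unitInterval, C) →L[𝕜] C := ContinuousMap.evalCLM 𝕜 1
  have h1 : HasFDerivAt (fun z => ψ z 1) (ev.comp (fderiv 𝕜 ψ z)) z :=
    ev.hasFDerivAt.comp z hψd
  rw [h1.fderiv]
  have h2 := DFunLike.congr_fun hη0 1
  have h3 : yd 1 - (1 : ℝ) • A (w 1) v = 0 := h2
  rw [one_smul, sub_eq_zero] at h3
  have h4 : w 1 = (z.1, ψ z 1) := by
    simp [w, rayCurve_apply]
  rw [h4] at h3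
  exact h3

/-- **Frobenius theorem** for a distribution given as a graph. -/
theorem exists_firstIntegral_graph {A : P × C → P →L[𝕜] C} {O : Set (P × C)} (hO : IsOpen O)
    (h0 : (0 : P × C) ∈ O) (hA : ContDiffOn 𝕜 ∞ A O)
    (hint : ∀ z ∈ O, ∀ u v, fderiv 𝕜 A z (u, A z u) v = fderiv 𝕜 A z (v, A z v) u) :
    ∃ (Y : Set (P × C)) (h : P × C → C), IsOpen Y ∧ (0 : P × C) ∈ Y ∧ Y ⊆ O ∧
      ContDiffOn 𝕜 ∞ h Y ∧ ∀ z ∈ Y, (∀ v, fderiv 𝕜 h z (v, A z v) = 0) ∧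
        Function.Surjective (fderiv 𝕜 h z) := by
  have hAc' : ContinuousOn (fderiv 𝕜 A) O := hA.continuousOn_fderiv_of_isOpen hO (by simp)
  -- shrink `O` so that the derivative of `A` is bounded
  let M : ℝ := ‖fderiv 𝕜 A 0‖ + 1
  let O₁ : Set (P × C) := O ∩ fderiv 𝕜 A ⁻¹' {B | ‖B‖ < M}
  have hO₁ : IsOpen O₁ :=
    hAc'.isOpen_inter_preimage hO (isOpen_lt (continuous_norm (E := P × C →L[𝕜] P →L[𝕜] C)) continuous_const)
  have h0₁ : (0 : P × C) ∈ O₁ := ⟨h0, by simp [M]⟩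
  have hA₁ : ContDiffOn 𝕜 ∞ A O₁ := hA.mono Set.inter_subset_left
  have hM : ∀ z ∈ O₁, ‖fderiv 𝕜 A z‖ ≤ M := fun z hz => le_of_lt hz.2
  obtain ⟨Z, ψ, hZ, h0Z, hψ, hψZ⟩ := exists_raySolution hO₁ hA₁ h0₁
  let ev : C(unitInterval, C) →L[𝕜] C := ContinuousMap.evalCLM 𝕜 1
  let G : P × C → C := fun z => ψ z 1
  have hG : ContDiffOn 𝕜 ∞ G Z := ev.contDiff.comp_contDiffOn hψ
  let Z₁ : Set (P × C) := Z ∩ {z | M * ‖z.1‖ < 1}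
  have hZ₁ : IsOpen Z₁ := hZ.inter (isOpen_lt (by fun_prop) continuous_const)
  have h0Z₁ : (0 : P × C) ∈ Z₁ := ⟨h0Z, by simp⟩
  have hGd : ∀ z ∈ Z₁, ∀ v, fderiv 𝕜 G z (v, 0) = A (z.1, G z) v := fun z hz v =>
    fderiv_rayEnd hO₁ hA₁ (fun z hz => hint z hz.1) hM hZ hψ hψZ hz.1 hz.2 v
  have hG0 : ∀ c, ((0 : P), c) ∈ Z → G (0, c) = c := by
    intro c hc
    have h1 := (hψZ _ hc).1
    simp only [rayDefect, map_zero, sub_zero] at h1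
    have h2 := DFunLike.congr_fun h1 1
    exact sub_eq_zero.1 h2
  have hGhas : ∀ z ∈ Z, HasFDerivAt G (fderiv 𝕜 G z) z := fun z hz =>
    ((hG.contDiffAt (hZ.mem_nhds hz)).differentiableAt (by simp)).hasFDerivAt
  have hG0d : ∀ c, fderiv 𝕜 G 0 ((0 : P), c) = c := by
    intro c
    have h1 : HasFDerivAt (fun c : C => G ((0 : P), c))
        ((fderiv 𝕜 G 0).comp (ContinuousLinearMap.inr 𝕜 P C)) 0 :=
      HasFDerivAt.comp (0 : C) (g := G) (f := fun c : C => ((0 : P), c)) (hGhas 0 h0Z)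
        (ContinuousLinearMap.inr 𝕜 P C).hasFDerivAt
    have h2 : HasFDerivAt (fun c : C => G ((0 : P), c)) (ContinuousLinearMap.id 𝕜 C) 0 := by
      refine (hasFDerivAt_id (0 : C)).congr_of_eventuallyEq ?_
      have hcont : Continuous (fun c : C => ((0 : P), c)) := by fun_prop
      filter_upwards [(hZ.preimage hcont).mem_nhds h0Z] with c hc using hG0 c hc
    exact DFunLike.congr_fun (h1.unique h2) c
  -- `Φ` carries the slices `c = const` to integral manifolds of the graph, so the second component
  -- of its local inverse is a first integral.
  let Φ : P × C → P × C := fun z => (z.1, G z)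
  have hΦ : ContDiffOn 𝕜 ∞ Φ Z₁ := contDiffOn_fst.prodMk (hG.mono Set.inter_subset_left)
  have hΦ0 : Φ 0 = 0 := Prod.ext rfl (hG0 0 h0Z)
  have hΦhas : ∀ z ∈ Z, HasFDerivAt Φ ((ContinuousLinearMap.fst 𝕜 P C).prod (fderiv 𝕜 G z)) z :=
    fun z hz => hasFDerivAt_fst.prodMk (hGhas z hz)
  have hsplit : ∀ v c, fderiv 𝕜 G 0 (v, c) = fderiv 𝕜 G 0 (v, 0) + c := by
    intro v c
    have h1 : ((v, c) : P × C) = (v, 0) + (0, c) := by simp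
    rw [h1, map_add, hG0d]
  let T : (P × C) ≃L[𝕜] (P × C) :=
    ContinuousLinearEquiv.equivOfInverse
      ((ContinuousLinearMap.fst 𝕜 P C).prod (fderiv 𝕜 G 0))
      ((ContinuousLinearMap.fst 𝕜 P C).prod (ContinuousLinearMap.snd 𝕜 P C -
        (fderiv 𝕜 G 0).comp ((ContinuousLinearMap.inl 𝕜 P C).comp
          (ContinuousLinearMap.fst 𝕜 P C))))
      (by
        rintro ⟨v, c⟩
        simp [hsplit v c])
      (by
        rintro ⟨v, c⟩
        simp [hsplit v (c - fderiv 𝕜 G 0 (v, 0))])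
  have hT : HasFDerivAt Φ (T : P × C →L[𝕜] P × C) 0 := hΦhas 0 h0Z
  obtain ⟨e, h0e, heZ, hef, hes⟩ := exists_smooth_localInverse hZ₁ hΦ h0Z₁ hT
  have h0t : (0 : P × C) ∈ e.target := by
    have := e.map_source h0e
    rwa [hef, hΦ0] at this
  refine ⟨e.target ∩ O, fun z => (e.symm z).2, e.open_target.inter hO, ⟨h0t, h0⟩,
    Set.inter_subset_right, (contDiff_snd.comp_contDiffOn hes).mono Set.inter_subset_left, ?_⟩
  rintro z ⟨hz, -⟩
  have hzs : e.symm z ∈ e.source := e.map_target hz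
  obtain ⟨p, hp⟩ : ∃ p, p = e.symm z := ⟨_, rfl⟩
  have hzp : z = Φ p := by rw [hp, ← hef, e.right_inv hz]
  rw [← hp] at hzs
  have hpZ := heZ hzs
  have hhas : HasFDerivAt (fun z => (e.symm z).2) (fderiv 𝕜 (fun z => (e.symm z).2) z) z :=
    (((contDiff_snd.comp_contDiffOn hes).contDiffAt
      (e.open_target.mem_nhds hz)).differentiableAt (by simp)).hasFDerivAt
  have hcomp : ∀ q, fderiv 𝕜 (fun z => (e.symm z).2) z
      ((ContinuousLinearMap.fst 𝕜 P C).prod (fderiv 𝕜 G p) q) = q.2 := by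
    intro q
    have hhas' := hhas
    rw [hzp] at hhas'
    have h1 := hhas'.comp p (hΦhas p hpZ.1)
    have h2 : HasFDerivAt ((fun z => (e.symm z).2) ∘ Φ) (ContinuousLinearMap.snd 𝕜 P C) p := by
      refine hasFDerivAt_snd.congr_of_eventuallyEq ?_
      filter_upwards [e.open_source.mem_nhds hzs] with x hx
      simp only [Function.comp]
      rw [← hef, e.left_inv hx]
    have h3 := DFunLike.congr_fun (h1.unique h2) q
    rw [← hzp] at h3
    exact h3
  constructor
  · intro v
    have h1 := hcomp (v, 0)
    simp only [ContinuousLinearMap.prod_apply, ContinuousLinearMap.coe_fst'] at h1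
    rw [hGd p hpZ v] at h1
    have h2 : A z = A (p.1, G p) := by rw [hzp]
    rw [h2]
    exact h1
  · intro c
    exact ⟨_, hcomp (0, c)⟩

end GraphFrobenius

/-! ### Frobenius theorem in a vector space. -/

section Frobenius

variable {𝕜 : Type*} [RCLike 𝕜] {E : Type*} [NormedAddCommGroup E] [NormedSpace 𝕜 E]
  [FiniteDimensional 𝕜 E]

/-- **Frobenius theorem** in a vector space, over the real or the complex numbers. -/
theorem exists_firstIntegrals {U : Set E} (hU : IsOpen U) {p : E} (hp : p ∈ U)
    {D : E → Submodule 𝕜 E} {d r : ℕ} {X : Fin d → E → E} (hX : ∀ i, ContDiffOn 𝕜 ∞ (X i) U)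
    (hD : ∀ x ∈ U, LinearIndependent 𝕜 (fun i => X i x) ∧
      Submodule.span 𝕜 (Set.range fun i => X i x) = D x)
    (hr : finrank 𝕜 (E ⧸ D p) = r)
    (hinv : ∀ V ⊆ U, IsOpen V → ∀ Y Z : E → E, ContDiffOn 𝕜 ∞ Y V → ContDiffOn 𝕜 ∞ Z V →
      (∀ x ∈ V, Y x ∈ D x) → (∀ x ∈ V, Z x ∈ D x) →
        ∀ x ∈ V, VectorField.lieBracket 𝕜 Y Z x ∈ D x) :
    ∃ (V : Set E) (h : Fin r → E → 𝕜), IsOpen V ∧ p ∈ V ∧ V ⊆ U ∧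
      (∀ i, ContDiffOn 𝕜 ∞ (h i) V) ∧
        ∀ x ∈ V, ∀ v, v ∈ D x ↔ ∀ i, fderiv 𝕜 (h i) x v = 0 := by
  have : CompleteSpace E := FiniteDimensional.complete 𝕜 E
  obtain ⟨C, hC⟩ := Submodule.exists_isCompl (D p)
  let P : Submodule 𝕜 E := D p
  let _ : NormedSpace ℝ P := NormedSpace.restrictScalars ℝ 𝕜 P
  let _ : NormedSpace ℝ C := NormedSpace.restrictScalars ℝ 𝕜 C
  have : IsScalarTower ℝ 𝕜 P := ⟨fun a b c => by
    rw [Algebra.smul_def, mul_smul]; rfl⟩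
  have : IsScalarTower ℝ 𝕜 C := ⟨fun a b c => by
    rw [Algebra.smul_def, mul_smul]; rfl⟩
  have : CompleteSpace P := FiniteDimensional.complete 𝕜 P
  have : CompleteSpace C := FiniteDimensional.complete 𝕜 C
  let S : (P × C) ≃L[𝕜] E := (Submodule.prodEquivOfIsCompl P C hC).toContinuousLinearEquiv
  have hS : ∀ v : P, ∀ c : C, S (v, c) = (v : E) + c := fun v c =>
    Submodule.coe_prodEquivOfIsCompl' P C hC (v, c)
  let πP : E →L[𝕜] P := (ContinuousLinearMap.fst 𝕜 P C).comp (S.symm : E →L[𝕜] P × C)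
  let πC : E →L[𝕜] C := (ContinuousLinearMap.snd 𝕜 P C).comp (S.symm : E →L[𝕜] P × C)
  have hπ : ∀ y, S (πP y, πC y) = y := fun y => S.apply_symm_apply y
  have hπP : ∀ v c, πP (S (v, c)) = v := fun v c => by simp [πP]
  -- the frame as an operator
  let Xm : E → (Fin d → 𝕜) →L[𝕜] E := fun x =>
    ∑ i, (ContinuousLinearMap.proj (R := 𝕜) (φ := fun _ : Fin d => 𝕜) i).smulRight (X i x)
  have hXm : ContDiffOn 𝕜 ∞ Xm U :=
    ContDiffOn.sum fun i _ => contDiffOn_const.smulRight (hX i)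
  have hXmr : ∀ x ∈ U, ∀ v, v ∈ D x ↔ ∃ c, Xm x c = v := by
    intro x hx v
    rw [← (hD x hx).2, Submodule.mem_span_range_iff_exists_fun]
    simp [Xm]
  have hXmi : ∀ x ∈ U, Function.Injective (Xm x) := by
    intro x hx
    rw [injective_iff_map_eq_zero]
    intro c hc
    have h1 := Fintype.linearIndependent_iff.1 (hD x hx).1 c (by simpa [Xm] using hc)
    exact funext h1
  let B : E → (Fin d → 𝕜) →L[𝕜] P := fun x => πP.comp (Xm x)
  have hB : ContDiffOn 𝕜 ∞ B U := contDiffOn_const.clm_comp hXm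
  have hπPid : ∀ v : P, πP (v : E) = v := fun v => by
    have : S (v, 0) = v := by simp [hS]
    rw [← this, hπP]
  have hBp : Function.Bijective (B p) := by
    constructor
    · rw [injective_iff_map_eq_zero]
      intro c hc
      have h1 : Xm p c ∈ D p := (hXmr p hp _).2 ⟨c, rfl⟩
      have h2 : πP (Xm p c) = ⟨Xm p c, h1⟩ := hπPid ⟨Xm p c, h1⟩
      have h3 : (⟨Xm p c, h1⟩ : P) = 0 := h2.symm.trans hc
      exact (injective_iff_map_eq_zero _).1 (hXmi p hp) c (congrArg Subtype.val h3)
    · intro v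
      obtain ⟨c, hc⟩ := (hXmr p hp v).1 v.2
      exact ⟨c, (congrArg πP hc).trans (hπPid v)⟩
  let Bp : (Fin d → 𝕜) ≃L[𝕜] P := ContinuousLinearEquiv.ofBijective (B p)
    (LinearMap.ker_eq_bot.2 hBp.1) (LinearMap.range_eq_top.2 hBp.2)
  -- Near `p` the projection of `D x` onto `P = D p` along `C` stays bijective; there `D x` is the
  -- graph of `A' x : P → C`.
  let U₁ : Set E := U ∩ B ⁻¹' Set.range ((↑) : ((Fin d → 𝕜) ≃L[𝕜] P) → (Fin d → 𝕜) →L[𝕜] P)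
  have hU₁ : IsOpen U₁ := hB.continuousOn.isOpen_inter_preimage hU ContinuousLinearEquiv.isOpen
  have hp₁ : p ∈ U₁ := ⟨hp, Bp, by ext; rfl⟩
  let A' : E → P →L[𝕜] C := fun x => (πC.comp (Xm x)).comp (B x).inverse
  have hA' : ContDiffOn 𝕜 ∞ A' U₁ := by
    have h1 : ContDiffOn 𝕜 ∞ (fun x => (B x).inverse) U₁ := by
      intro x hx
      obtain ⟨e, he⟩ := hx.2
      have h2 := contDiffAt_map_inverse (𝕜 := 𝕜) (n := ∞) e
      rw [he] at h2
      exact h2.comp_contDiffWithinAt x ((hB x hx.1).mono Set.inter_subset_left)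
    exact (contDiffOn_const.clm_comp (hXm.mono Set.inter_subset_left)).clm_comp h1
  have hDA : ∀ x ∈ U₁, ∀ v : P, ∀ c : C, S (v, c) ∈ D x ↔ c = A' x v := by
    intro x hx v c
    obtain ⟨e, he⟩ := hx.2
    have hinv1 : ∀ v, B x ((B x).inverse v) = v := fun v => by
      rw [← he, ContinuousLinearMap.inverse_equiv]
      exact e.apply_symm_apply v
    have hinv2 : ∀ v, (B x).inverse (B x v) = v := fun v => by
      rw [← he, ContinuousLinearMap.inverse_equiv]
      exact e.symm_apply_apply v
    rw [hXmr x hx.1]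
    constructor
    · rintro ⟨b, hb⟩
      have h1 : B x b = v := (congrArg πP hb).trans (hπP v c)
      have h2 : πC (Xm x b) = c := by rw [hb]; simp [πC]
      simp only [A', ContinuousLinearMap.comp_apply, ← h1, hinv2, h2]
    · rintro rfl
      refine ⟨(B x).inverse v, ?_⟩
      conv_lhs => rw [← hπ (Xm x ((B x).inverse v))]
      congr 2
      exact hinv1 v
  -- translate to the origin
  let ξ : P × C → E := fun z => p + S z
  have hξ : ContDiff 𝕜 ∞ ξ := contDiff_const.add S.contDiff
  let O : Set (P × C) := ξ ⁻¹' U₁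
  have hO : IsOpen O := hU₁.preimage hξ.continuous
  have h0 : (0 : P × C) ∈ O := by simpa [O, ξ] using hp₁
  let A : P × C → P →L[𝕜] C := fun z => A' (ξ z)
  have hA : ContDiffOn 𝕜 ∞ A O := hA'.comp hξ.contDiffOn fun z hz => hz
  let ζ : E → P × C := fun x => S.symm (x - p)
  have hζ : ContDiff 𝕜 ∞ ζ := S.symm.contDiff.comp (contDiff_id.sub contDiff_const)
  have hζd : ∀ x, HasFDerivAt ζ (S.symm : E →L[𝕜] P × C) x := fun x =>
    (S.symm : E →L[𝕜] P × C).hasFDerivAt.comp x ((hasFDerivAt_id x).sub_const p)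
  have hξζ : ∀ x, ξ (ζ x) = x := fun x => by simp [ξ, ζ]
  have hζξ : ∀ z, ζ (ξ z) = z := fun z => by simp [ξ, ζ]
  -- The sections `x ↦ S (v, A (ζ x) v)` of `D` have constant `P`-component, so their bracket lies
  -- in `C`. A vector of `C` lying in a graph over `P` is zero, and this is the integrability
  -- identity.
  have hint : ∀ z ∈ O, ∀ u v, fderiv 𝕜 A z (u, A z u) v = fderiv 𝕜 A z (v, A z v) u := by
    intro z hz u v
    let Y : P → E → E := fun v x => S (v, A (ζ x) v)
    have hAζ : ContDiffOn 𝕜 ∞ (fun x => A (ζ x)) U₁ := hA'.congr fun x _ => by simp [A, hξζ]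
    have hY : ∀ v, ContDiffOn 𝕜 ∞ (Y v) U₁ := fun v =>
      S.contDiff.comp_contDiffOn (contDiffOn_const.prodMk (hAζ.clm_apply contDiffOn_const))
    have hYD : ∀ v, ∀ x ∈ U₁, Y v x ∈ D x := fun v x hx => by
      simp only [Y]
      rw [hDA x hx]
      simp [A, hξζ]
    have hx : ξ z ∈ U₁ := hz
    have hbr := hinv U₁ Set.inter_subset_left hU₁ (Y u) (Y v) (hY u) (hY v) (hYD u) (hYD v)
      (ξ z) hx
    have hYd : ∀ v w, fderiv 𝕜 (Y v) (ξ z) w = S (0, fderiv 𝕜 A z (S.symm w) v) := by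
      intro v w
      have h1 : HasFDerivAt A (fderiv 𝕜 A z) (ζ (ξ z)) := by
        rw [hζξ]
        exact ((hA.contDiffAt (hO.mem_nhds hz)).differentiableAt (by simp)).hasFDerivAt
      have h2 := h1.comp (ξ z) (hζd (ξ z))
      let ev : (P →L[𝕜] C) →L[𝕜] C := ContinuousLinearMap.apply 𝕜 C v
      have h3 := ev.hasFDerivAt.comp (ξ z) h2
      have h4 := S.hasFDerivAt.comp (ξ z)
        ((hasFDerivAt_const (v : P) (ξ z)).prodMk h3)
      exact DFunLike.congr_fun h4.fderiv w
    rw [VectorField.lieBracket_eq] at hbr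
    simp only [hYd] at hbr
    have hS0 : ∀ u, S.symm (Y u (ξ z)) = (u, A z u) := fun u => by simp [Y, hζξ]
    rw [hS0, hS0, ← map_sub, Prod.mk_sub_mk, sub_self, hDA _ hx, map_zero] at hbr
    exact sub_eq_zero.1 hbr
  obtain ⟨Y, h, hY, h0Y, hYO, hh, hhY⟩ := exists_firstIntegral_graph hO h0 hA hint
  have hCr : finrank 𝕜 C = r := by
    rw [← hr]
    exact (Submodule.quotientEquivOfIsCompl P C hC).finrank_eq.symm
  let eC : C ≃L[𝕜] (Fin r → 𝕜) := ContinuousLinearEquiv.ofFinrankEq (by simp [hCr])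
  have hhE : ContDiffOn 𝕜 ∞ (fun x => h (ζ x)) (ζ ⁻¹' Y) := hh.comp hζ.contDiffOn fun x hx => hx
  have hhd : ∀ x ∈ ζ ⁻¹' Y, HasFDerivAt (fun x => h (ζ x))
      ((fderiv 𝕜 h (ζ x)).comp (S.symm : E →L[𝕜] P × C)) x := by
    intro x hx
    exact HasFDerivAt.comp x ((hh.contDiffAt (hY.mem_nhds hx)).differentiableAt
      (by simp)).hasFDerivAt (hζd x)
  refine ⟨ζ ⁻¹' Y, fun i x => eC (h (ζ x)) i, hY.preimage hζ.continuous, ?_, ?_, ?_, ?_⟩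
  · simpa [ζ] using h0Y
  · intro x hx
    have h1 : ξ (ζ x) ∈ U₁ := hYO hx
    rw [hξζ] at h1
    exact h1.1
  · intro i
    exact ((ContinuousLinearMap.proj (R := 𝕜) (φ := fun _ : Fin r => 𝕜) i).comp
      (eC : C →L[𝕜] (Fin r → 𝕜))).contDiff.comp_contDiffOn hhE
  · intro x hx v
    have hxU : x ∈ U₁ := by
      have h1 : ξ (ζ x) ∈ U₁ := hYO hx
      rwa [hξζ] at h1
    have hcomp : ∀ i, fderiv 𝕜 (fun x => eC (h (ζ x)) i) x v =
        eC (fderiv 𝕜 h (ζ x) (S.symm v)) i := by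
      intro i
      have h1 := ((ContinuousLinearMap.proj (R := 𝕜) (φ := fun _ : Fin r => 𝕜) i).comp
        (eC : C →L[𝕜] (Fin r → 𝕜))).hasFDerivAt.comp x (hhd x hx)
      exact DFunLike.congr_fun h1.fderiv v
    obtain ⟨hk, hs⟩ := hhY _ hx
    obtain ⟨⟨a, c⟩, rfl⟩ := S.surjective v
    have hsplit : ∀ a c, fderiv 𝕜 h (ζ x) (a, c) = fderiv 𝕜 h (ζ x) (0, c - A (ζ x) a) := by
      intro a c
      have h1 : ((a, c) : P × C) = (a, A (ζ x) a) + (0, c - A (ζ x) a) := by simp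
      rw [h1, map_add, hk, zero_add]
    -- `dh` is surjective onto `C` and kills the graph, so its restriction to `C` is a surjective
    -- endomorphism, hence injective; the kernel of `dh` is exactly the graph.
    have hinj : Function.Injective
        ((fderiv 𝕜 h (ζ x)).comp (ContinuousLinearMap.inr 𝕜 P C) : C →ₗ[𝕜] C) := by
      rw [LinearMap.injective_iff_surjective]
      intro c
      obtain ⟨⟨a', c'⟩, hac⟩ := hs c
      exact ⟨c' - A (ζ x) a', (hsplit a' c').symm.trans hac⟩
    have hAx : A (ζ x) = A' x := by simp [A, hξζ]
    rw [hDA x hxU]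
    simp only [hcomp, ContinuousLinearEquiv.symm_apply_apply]
    constructor
    · intro hc i
      rw [hsplit, hAx, hc, sub_self]
      have : ((0 : P), (0 : C)) = 0 := rfl
      rw [this, map_zero, map_zero]
      rfl
    · intro hi
      have h1 : fderiv 𝕜 h (ζ x) (a, c) = 0 := by
        apply eC.injective
        rw [map_zero]
        exact funext hi
      rw [hsplit, hAx] at h1
      have h2 : c - A' x a = 0 := (injective_iff_map_eq_zero _).1 hinj _ h1
      exact sub_eq_zero.1 h2

end Frobenius

/-! ### Decomposable forms and their kernels. -/

section Wedge

variable {𝕜 V : Type*} [RCLike 𝕜] [AddCommGroup V] [Module 𝕜 V] {r : ℕ}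

theorem wedge_apply (l : Fin r → Dual 𝕜 V) (x : Fin r → V) :
    wedge l x = Matrix.det (Matrix.of fun i j => l j (x i)) := rfl

theorem wedge_compLinearMap (l : Fin r → Dual 𝕜 V) (Q : End 𝕜 V) :
    (wedge l).compLinearMap Q = wedge fun j => l j ∘ₗ Q := by
  ext x
  rfl

theorem wedge_smul (c : Fin r → 𝕜) (l : Fin r → Dual 𝕜 V) :
    wedge (fun j => c j • l j) = (∏ j, c j) • wedge l := by
  ext x
  rw [AlternatingMap.smul_apply, wedge_apply, wedge_apply, smul_eq_mul,
    ← Matrix.det_mul_row]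
  rfl

/-- The arguments are replaced one at a time, each replacement changing the argument by a vector of
the kernel. -/
theorem map_eq_of_sub_mem_formKer {β : V [⋀^Fin r]→ₗ[𝕜] 𝕜} {x y : Fin r → V}
    (h : ∀ i, x i - y i ∈ formKer β) : β x = β y := by
  classical
  have key : ∀ s : Finset (Fin r), β (s.piecewise x y) = β y := by
    intro s
    induction s using Finset.induction_on with
    | empty => simp
    | insert i s hi ih =>
      rw [Finset.piecewise_insert]
      have h1 : Function.update (s.piecewise x y) i (x i) =
          Function.update (s.piecewise x y) i ((x i - y i) + y i) := by simp
      rw [h1, AlternatingMap.map_update_add, h i, zero_add]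
      have h2 : Function.update (s.piecewise x y) i (y i) = s.piecewise x y := by
        rw [Function.update_eq_self_iff]
        simp [hi]
      rw [h2, ih]
  simpa using key Finset.univ

theorem mem_formKer_smul {β : V [⋀^Fin r]→ₗ[𝕜] 𝕜} {c : 𝕜} (hc : c ≠ 0) :
    formKer (c • β) = formKer β := by
  ext v
  refine forall_congr' fun x => forall_congr' fun i => ?_
  simp [hc]

variable [FiniteDimensional 𝕜 V]

/-- A functional vanishing on the image is a linear relation among the covectors. -/
theorem surjective_pi_of_linearIndependent {ι : Type*} [Fintype ι] {l : ι → Dual 𝕜 V}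
    (hl : LinearIndependent 𝕜 l) : Function.Surjective (LinearMap.pi l) := by
  classical
  rw [← LinearMap.dualMap_injective_iff, injective_iff_map_eq_zero]
  intro φ hφ
  have h1 : ∑ j, φ (Pi.single j 1) • l j = 0 := by
    ext v
    have h2 := DFunLike.congr_fun hφ v
    rw [LinearMap.dualMap_apply, ← (Pi.basisFun 𝕜 ι).sum_repr (LinearMap.pi l v)] at h2
    simpa [mul_comm] using h2
  have h3 := Fintype.linearIndependent_iff.1 hl _ h1
  refine (Pi.basisFun 𝕜 ι).ext fun j => ?_
  simpa using h3 j

theorem exists_dual_vectors {ι : Type*} [Fintype ι] [DecidableEq ι] {l : ι → Dual 𝕜 V}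
    (hl : LinearIndependent 𝕜 l) :
    ∃ e : ι → V, ∀ i j, l j (e i) = if i = j then 1 else 0 := by
  choose e he using fun i => surjective_pi_of_linearIndependent hl (Pi.single i 1)
  refine ⟨e, fun i j => ?_⟩
  have := congrFun (he i) j
  rw [LinearMap.pi_apply] at this
  rw [this, Pi.single_apply]
  simp [eq_comm]

/-- Evaluated on a dual system with the `j`th vector replaced by `v`, the wedge is the determinant
of the identity with one row changed, that is `l j v`. -/
theorem mem_formKer_wedge {l : Fin r → Dual 𝕜 V} (hl : LinearIndependent 𝕜 l) {v : V} :
    v ∈ formKer (wedge l) ↔ ∀ j, l j v = 0 := by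
  constructor
  · intro hv j
    obtain ⟨e, he⟩ := exists_dual_vectors hl
    have h1 := hv e j
    rw [wedge_apply] at h1
    have h2 : (Matrix.of fun i k => l k (Function.update e j v i)) =
        (1 : Matrix (Fin r) (Fin r) 𝕜).updateRow j (fun k => l k v) := by
      ext i k
      by_cases hi : i = j
      · subst hi
        simp
      · simp [hi, he, Matrix.one_apply]
    rw [h2, ← Matrix.cramer_transpose_apply, Matrix.transpose_one, Matrix.cramer_one] at h1
    exact h1
  · intro hv x i
    rw [wedge_apply]
    exact Matrix.det_eq_zero_of_row_eq_zero i fun j => by simp [hv]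

/-- A form whose kernel contains the common kernel of `l` is a multiple of `wedge l`. -/
theorem exists_eq_smul_wedge {l : Fin r → Dual 𝕜 V} (hl : LinearIndependent 𝕜 l)
    {β : V [⋀^Fin r]→ₗ[𝕜] 𝕜} (hβ : ∀ v, (∀ j, l j v = 0) → v ∈ formKer β) :
    ∃ c : 𝕜, β = c • wedge l := by
  obtain ⟨s, hs⟩ := (LinearMap.pi l).exists_rightInverse_of_surjective
    (LinearMap.range_eq_top.2 (surjective_pi_of_linearIndependent hl))
  have hs' : ∀ u, LinearMap.pi l (s u) = u := fun u => DFunLike.congr_fun hs u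
  refine ⟨(β.compLinearMap s) (Pi.basisFun 𝕜 (Fin r)), ?_⟩
  have h1 := (β.compLinearMap s).eq_smul_basis_det (Pi.basisFun 𝕜 (Fin r))
  rw [Pi.basisFun_det] at h1
  ext x
  have h2 : β x = β fun i => s (LinearMap.pi l (x i)) := by
    refine map_eq_of_sub_mem_formKer fun i => hβ _ fun j => ?_
    have := congrFun (hs' (LinearMap.pi l (x i))) j
    simp only [LinearMap.pi_apply] at this
    simp [this]
  have h3 := DFunLike.congr_fun h1 fun i => LinearMap.pi l (x i)
  rw [h2]
  exact h3

/-- The factor is nonzero because `l 0 ≠ 0`. For `r = 0` every form, zero included, has full kernel,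
so `1 ≤ r` is essential. -/
theorem exists_eq_smul_wedge_of_formKer_eq {l : Fin r → Dual 𝕜 V} (hl : LinearIndependent 𝕜 l)
    (hr : 1 ≤ r) {β : V [⋀^Fin r]→ₗ[𝕜] 𝕜} (hβ : formKer β = ⨅ j, LinearMap.ker (l j)) :
    ∃ c : 𝕜, c ≠ 0 ∧ β = c • wedge l := by
  obtain ⟨c, hc⟩ := exists_eq_smul_wedge hl (β := β) fun v hv => by
    rw [hβ]
    simpa [Submodule.mem_iInf] using hv
  refine ⟨c, ?_, hc⟩
  rintro rfl
  refine hl.ne_zero ⟨0, hr⟩ (LinearMap.ext fun v => ?_)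
  have hv : v ∈ formKer β := by
    intro x i
    rw [hc]
    simp
  rw [hβ, Submodule.mem_iInf] at hv
  exact hv _

theorem finrank_iInf_ker {ι : Type*} [Fintype ι] {l : ι → Dual 𝕜 V}
    (hl : LinearIndependent 𝕜 l) :
    finrank 𝕜 (⨅ j, LinearMap.ker (l j) : Submodule 𝕜 V) + Fintype.card ι = finrank 𝕜 V := by
  have h1 := LinearMap.finrank_range_add_finrank_ker (LinearMap.pi l)
  rw [LinearMap.range_eq_top.2 (surjective_pi_of_linearIndependent hl), LinearMap.ker_pi,
    finrank_top, finrank_fintype_fun_eq_card] at h1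
  omega

/-- Transforming `wedge l` by a map which is the identity on its kernel. -/
theorem wedge_comp_eq_det_smul (l : Fin r → Dual 𝕜 V) (hl : LinearIndependent 𝕜 l)
    {Q : End 𝕜 V} (hQ : ∀ v, (∀ j, l j v = 0) → Q v = v) :
    (wedge l).compLinearMap Q = LinearMap.det Q • wedge l := by
  classical
  let L : V →ₗ[𝕜] (Fin r → 𝕜) := LinearMap.pi l
  obtain ⟨s, hs⟩ := L.exists_rightInverse_of_surjective
    (LinearMap.range_eq_top.2 (surjective_pi_of_linearIndependent hl))
  -- `Q - 1` vanishes on the kernel of `L`, so it factors as `T ∘ L`. Then `Q` induces `1 + L T` on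
  -- `𝕜ʳ`, and `det (1 + T L) = det (1 + L T)`.
  let T : (Fin r → 𝕜) →ₗ[𝕜] V := (Q - 1) ∘ₗ s
  have hQT : Q = 1 + T ∘ₗ L := by
    ext v
    have h1 : Q (v - s (L v)) = v - s (L v) := hQ _ fun j => by
      have := congrFun (DFunLike.congr_fun hs (L v)) j
      have h2 : l j (s (L v)) = l j v := this
      simp [h2]
    rw [map_sub] at h1
    simp only [T, LinearMap.add_apply, LinearMap.comp_apply, LinearMap.sub_apply,
      Module.End.one_apply]
    rw [← sub_eq_zero] at h1 ⊢
    rw [← h1]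
    abel
  have hLQ : ∀ v, L (Q v) = (1 + L ∘ₗ T) (L v) := by
    intro v
    rw [hQT]
    simp
  have hdet : LinearMap.det Q = LinearMap.det (1 + L ∘ₗ T) := by
    let b := Module.finBasis 𝕜 V
    let b' := Pi.basisFun 𝕜 (Fin r)
    rw [hQT, ← LinearMap.det_toMatrix b, ← LinearMap.det_toMatrix b', map_add, map_add,
      LinearMap.toMatrix_comp b b' b, LinearMap.toMatrix_comp b' b b', LinearMap.toMatrix_one,
      LinearMap.toMatrix_one]
    exact Matrix.det_one_add_mul_comm _ _
  ext x
  have h1 : (wedge l).compLinearMap Q x =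
      (Matrix.detRowAlternating.compLinearMap (1 + L ∘ₗ T)) fun i => L (x i) := by
    change Matrix.detRowAlternating (fun i => L (Q (x i))) = _
    simp only [hLQ]
    rfl
  rw [h1, ← Pi.basisFun_det, hdet]
  have h2 := ((Pi.basisFun 𝕜 (Fin r)).det.compLinearMap (1 + L ∘ₗ T)).eq_smul_basis_det
    (Pi.basisFun 𝕜 (Fin r))
  have h3 : ((Pi.basisFun 𝕜 (Fin r)).det.compLinearMap (1 + L ∘ₗ T)) (Pi.basisFun 𝕜 (Fin r)) =
      LinearMap.det (1 + L ∘ₗ T) := by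
    have h4 := (Pi.basisFun 𝕜 (Fin r)).det_comp (1 + L ∘ₗ T) (Pi.basisFun 𝕜 (Fin r))
    rw [Basis.det_self, mul_one] at h4
    exact h4
  rw [h2, h3, Pi.basisFun_det]
  rfl

end Wedge

/-! ### Endomorphisms shifting the chains of a Veronese curve. -/

section Chains

variable {𝕜 V : Type*} [RCLike 𝕜] [AddCommGroup V] [Module 𝕜 V] {r : ℕ} {m : Fin r → ℕ}

/-- The covectors of a splitting basis, extended by zero. -/
noncomputable def chain (b : Basis (Σ j : Fin r, Fin (m j)) 𝕜 (Dual 𝕜 V)) (j : Fin r) (i : ℕ) :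
    Dual 𝕜 V :=
  if h : i < m j then b ⟨j, ⟨i, h⟩⟩ else 0

/-- The factors `γⱼ(t)` of the Veronese curve of a splitting basis. -/
noncomputable def factor (b : Basis (Σ j : Fin r, Fin (m j)) 𝕜 (Dual 𝕜 V)) (t : 𝕜) (j : Fin r) :
    Dual 𝕜 V :=
  ∑ i : Fin (m j), t ^ (i : ℕ) • b ⟨j, i⟩

/-- The leading coefficients of the factors. -/
noncomputable def lastCovector (b : Basis (Σ j : Fin r, Fin (m j)) 𝕜 (Dual 𝕜 V)) (j : Fin r) :
    Dual 𝕜 V :=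
  chain b j (m j - 1)

/-- `J` shifts the chains of the basis on the common kernel of the leading coefficients. -/
def ShiftsChains (b : Basis (Σ j : Fin r, Fin (m j)) 𝕜 (Dual 𝕜 V)) (J : End 𝕜 V) : Prop :=
  ∀ v, (∀ j, lastCovector b j v = 0) → ∀ j, chain b j 0 (J v) = 0 ∧
    ∀ i, i + 1 < m j → chain b j (i + 1) (J v) = -chain b j i v

variable {b : Basis (Σ j : Fin r, Fin (m j)) 𝕜 (Dual 𝕜 V)}

theorem chain_of_lt {j : Fin r} {i : ℕ} (h : i < m j) : chain b j i = b ⟨j, ⟨i, h⟩⟩ := dif_pos h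

theorem chain_coe (j : Fin r) (i : Fin (m j)) : chain b j i = b ⟨j, i⟩ := dif_pos i.2

theorem factor_eq_sum_range (t : 𝕜) (j : Fin r) :
    factor b t j = ∑ i ∈ Finset.range (m j), t ^ i • chain b j i := by
  rw [← Fin.sum_univ_eq_sum_range (fun i => t ^ i • chain b j i)]
  simp only [factor, chain_coe]

theorem sum_range_telescope {m : ℕ} (hm : 1 ≤ m) (t : 𝕜) (x y : ℕ → 𝕜) (h0 : x 0 = 0)
    (h : ∀ i, i + 1 < m → x (i + 1) = -y i) :
    ∑ i ∈ Finset.range m, t ^ i * (x i + t * y i) = t ^ m * y (m - 1) := by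
  have key : ∀ k, k + 1 ≤ m →
      ∑ i ∈ Finset.range (k + 1), t ^ i * (x i + t * y i) = t ^ (k + 1) * y k := by
    intro k
    induction k with
    | zero =>
      intro _
      simp [h0]
    | succ k ih =>
      intro hk
      rw [Finset.sum_range_succ, ih (by omega), h k (by omega)]
      ring
  obtain ⟨k, rfl⟩ : ∃ k, m = k + 1 := ⟨m - 1, by omega⟩
  simpa using key k le_rfl

/-- The sum telescopes: `tⁱ⁺¹ e (i+1) j w` cancels `tⁱ (t e i j v)`, and only the top term in `v`
survives. If `v` is killed by the top covectors, `w + t v` is killed by every `γⱼ(t)`. -/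
theorem factor_shift (hm : ∀ j, 1 ≤ m j) {v w : V} {j : Fin r} (h0 : chain b j 0 w = 0)
    (h : ∀ i, i + 1 < m j → chain b j (i + 1) w = -chain b j i v) (t : 𝕜) :
    factor b t j (w + t • v) = t ^ m j * lastCovector b j v := by
  rw [factor_eq_sum_range]
  have := sum_range_telescope (hm j) t (fun i => chain b j i w) (fun i => chain b j i v) h0 h
  simp only [lastCovector]
  rw [← this]
  simp [LinearMap.sum_apply, mul_add]

theorem ShiftsChains.factor_eq_zero (hm : ∀ j, 1 ≤ m j) {J : End 𝕜 V} (hJ : ShiftsChains b J)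
    {v : V} (hv : ∀ j, lastCovector b j v = 0) (t : 𝕜) (j : Fin r) :
    factor b t j (J v + t • v) = 0 := by
  rw [factor_shift hm (hJ v hv j).1 (hJ v hv j).2, hv, mul_zero]

/-- Each `γⱼ(t)` has coefficient `1` on `e 0 j`, which occurs in no other factor; this works for `t
= 0` too. -/
theorem linearIndependent_factor (hm : ∀ j, 1 ≤ m j) (t : 𝕜) :
    LinearIndependent 𝕜 (factor b t) := by
  classical
  rw [Fintype.linearIndependent_iff]
  intro g hg j
  have h1 := congrArg (fun l => b.repr l ⟨j, ⟨0, hm j⟩⟩) hg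
  simp only [map_sum, map_smul, Finsupp.coe_finsetSum, Finset.sum_apply, factor, map_zero,
    Finsupp.coe_smul, Pi.smul_apply, Basis.repr_self] at h1
  rw [Finset.sum_eq_single j, Finset.sum_eq_single ⟨0, hm j⟩] at h1
  · simpa using h1
  · intro i _ hi
    rw [Finsupp.single_eq_of_ne, smul_zero]
    intro h
    apply hi
    simpa using h.symm
  · simp
  · intro j' _ hj'
    rw [Finset.sum_eq_zero, smul_zero]
    intro i _
    rw [Finsupp.single_eq_of_ne, smul_zero]
    intro h
    exact hj' (congrArg Sigma.fst h).symm
  · simp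

theorem linearIndependent_lastCovector (hm : ∀ j, 1 ≤ m j) :
    LinearIndependent 𝕜 (lastCovector b) := by
  have hlt : ∀ j, m j - 1 < m j := fun j => by have := hm j; omega
  have h1 : lastCovector b = b ∘ fun j => ⟨j, ⟨m j - 1, hlt j⟩⟩ := by
    ext1 j
    exact chain_of_lt (hlt j)
  rw [h1]
  exact b.linearIndependent.comp _ fun j j' h => congrArg Sigma.fst h

variable [FiniteDimensional 𝕜 V]

theorem sum_eq_finrank (b : Basis (Σ j : Fin r, Fin (m j)) 𝕜 (Dual 𝕜 V)) :
    ∑ j, m j = finrank 𝕜 V := by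
  rw [← Subspace.dual_finrank_eq, finrank_eq_card_basis b, Fintype.card_sigma]
  simp

/-- The coordinates of a vector with respect to a basis of the dual space. -/
noncomputable def coordEquiv {ι : Type*} [Fintype ι] (b : Basis ι 𝕜 (Dual 𝕜 V)) :
    V ≃ₗ[𝕜] (ι → 𝕜) :=
  LinearEquiv.ofBijective (LinearMap.pi b) ⟨by
    rw [injective_iff_map_eq_zero]
    intro v hv
    rw [← Module.forall_dual_apply_eq_zero_iff 𝕜 v]
    intro l
    have h1 : ∀ i, b i v = 0 := fun i => congrFun hv i
    rw [← b.sum_repr l, LinearMap.sum_apply]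
    exact Finset.sum_eq_zero fun i _ => by rw [LinearMap.smul_apply, h1, smul_zero],
  surjective_pi_of_linearIndependent b.linearIndependent⟩

theorem coordEquiv_apply {ι : Type*} [Fintype ι] (b : Basis ι 𝕜 (Dual 𝕜 V)) (v : V) (i : ι) :
    coordEquiv b v i = b i v := rfl

theorem basis_coordEquiv_symm {ι : Type*} [Fintype ι] (b : Basis ι 𝕜 (Dual 𝕜 V)) (f : ι → 𝕜)
    (i : ι) : b i ((coordEquiv b).symm f) = f i := by
  rw [← coordEquiv_apply, LinearEquiv.apply_symm_apply]

theorem eq_of_chain_eq {v w : V} (h : ∀ j i, i < m j → chain b j i v = chain b j i w) : v = w := by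
  apply (coordEquiv b).injective
  ext ⟨j, i⟩
  rw [coordEquiv_apply, coordEquiv_apply, ← chain_coe]
  exact h j i i.2

/-- The endomorphism shifting all the chains. -/
noncomputable def shiftEnd (b : Basis (Σ j : Fin r, Fin (m j)) 𝕜 (Dual 𝕜 V)) : End 𝕜 V :=
  (coordEquiv b).symm.toLinearMap ∘ₗ
    (LinearMap.pi fun a => if (a.2 : ℕ) = 0 then 0 else -chain b a.1 ((a.2 : ℕ) - 1))

theorem chain_zero_shiftEnd (j : Fin r) (v : V) : chain b j 0 (shiftEnd b v) = 0 := by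
  unfold chain
  split_ifs with h
  · simp [shiftEnd, basis_coordEquiv_symm]
  · rfl

theorem chain_succ_shiftEnd {j : Fin r} {i : ℕ} (h : i + 1 < m j) (v : V) :
    chain b j (i + 1) (shiftEnd b v) = -chain b j i v := by
  rw [chain_of_lt h]
  simp [shiftEnd, basis_coordEquiv_symm]

/-- A vector is determined by its chain coordinates, so `J` is prescribed on the common kernel and
free elsewhere. Comparison with the nilpotent model is what the determinant formula exploits. -/
theorem shiftsChains_iff {J : End 𝕜 V} :
    ShiftsChains b J ↔ ∀ v, (∀ j, lastCovector b j v = 0) → J v = shiftEnd b v := by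
  constructor
  · intro h v hv
    refine eq_of_chain_eq (b := b) fun j i hi => ?_
    cases i with
    | zero => rw [(h v hv j).1, chain_zero_shiftEnd]
    | succ i => rw [(h v hv j).2 i hi, chain_succ_shiftEnd hi]
  · intro h v hv j
    rw [h v hv]
    exact ⟨chain_zero_shiftEnd j v, fun i hi => chain_succ_shiftEnd hi v⟩

/-- After `k` applications the first `k` coordinates of every chain vanish. -/
theorem isNilpotent_shiftEnd (b : Basis (Σ j : Fin r, Fin (m j)) 𝕜 (Dual 𝕜 V)) :
    IsNilpotent (shiftEnd b) := by
  refine ⟨∑ j, m j, LinearMap.ext fun v => ?_⟩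
  have key : ∀ k j i, i < k → i < m j → chain b j i ((shiftEnd b ^ k) v) = 0 := by
    intro k
    induction k with
    | zero => intro j i hi; omega
    | succ k ih =>
      intro j i hi hij
      rw [pow_succ', Module.End.mul_apply]
      cases i with
      | zero => exact chain_zero_shiftEnd j _
      | succ i => rw [chain_succ_shiftEnd hij, ih j i (by omega) (by omega), neg_zero]
  refine eq_of_chain_eq (b := b) fun j i hi => ?_
  rw [key _ j i (hi.trans_le (Finset.single_le_sum (fun _ _ => Nat.zero_le _)
    (Finset.mem_univ j))) hi]
  simp

theorem det_add_smul_one (J : End 𝕜 V) (t : 𝕜) :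
    LinearMap.det (J + t • (1 : End 𝕜 V)) =
      (-1) ^ finrank 𝕜 V * J.charpoly.eval (-t) := by
  rw [LinearMap.eval_charpoly, ← LinearMap.det_smul]
  congr 1
  ext v
  simp [Algebra.algebraMap_eq_smul_one]

theorem det_shiftEnd_add (b : Basis (Σ j : Fin r, Fin (m j)) 𝕜 (Dual 𝕜 V)) (t : 𝕜) :
    LinearMap.det (shiftEnd b + t • (1 : End 𝕜 V)) = t ^ finrank 𝕜 V := by
  rw [det_add_smul_one, (isNilpotent_shiftEnd b).charpoly_eq_X_pow_finrank, Polynomial.eval_pow,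
    Polynomial.eval_X, ← mul_pow, neg_one_mul, neg_neg]

theorem continuous_det_add_smul_one (J : End 𝕜 V) :
    Continuous fun t : 𝕜 => LinearMap.det (J + t • (1 : End 𝕜 V)) := by
  simp only [det_add_smul_one]
  exact continuous_const.mul (J.charpoly.continuous.comp continuous_neg)

theorem continuous_wedge_factor_apply (x : 𝕜 → Fin r → V)
    (hx : ∀ (l : Dual 𝕜 V) i, Continuous fun t => l (x t i)) :
    Continuous fun t => wedge (factor b t) (x t) := by
  simp only [wedge_apply]
  refine Continuous.matrix_det (continuous_matrix fun i j => ?_)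
  simp only [Matrix.of_apply, factor, LinearMap.sum_apply, LinearMap.smul_apply]
  exact continuous_finsetSum _ fun k _ => (continuous_id.pow _).smul (hx _ _)

/-- The transformation formula `(J + t)^* γ(t) = det (J + t) γ(∞)`. -/
theorem ShiftsChains.wedge_comp (hm : ∀ j, 1 ≤ m j) {J : End 𝕜 V} (hJ : ShiftsChains b J) (t : 𝕜) :
    (wedge (factor b t)).compLinearMap (J + t • (1 : End 𝕜 V)) =
      LinearMap.det (J + t • (1 : End 𝕜 V)) • wedge (lastCovector b) := by
  -- For `t ≠ 0` the model `S = shiftEnd b + t` is invertible and multiplies the `j`th factor into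
  -- `t ^ m j` times its top covector. Write `J + t = S Q`; since `J` and the shift agree on the
  -- kernel of the top covectors, `Q` is the identity there and contributes only its determinant.
  have key : ∀ t : 𝕜, t ≠ 0 → (wedge (factor b t)).compLinearMap (J + t • (1 : End 𝕜 V)) =
      LinearMap.det (J + t • (1 : End 𝕜 V)) • wedge (lastCovector b) := by
    intro t ht
    let S : End 𝕜 V := shiftEnd b + t • (1 : End 𝕜 V)
    have hSd : LinearMap.det S = t ^ finrank 𝕜 V := det_shiftEnd_add b t
    have hSu : IsUnit S := by
      rw [LinearMap.isUnit_iff_isUnit_det, hSd]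
      exact (isUnit_iff_ne_zero.2 ht).pow _
    obtain ⟨u, hu⟩ := hSu
    let Q : End 𝕜 V := (↑u⁻¹ : End 𝕜 V) * (J + t • (1 : End 𝕜 V))
    have hSQ : S * Q = J + t • (1 : End 𝕜 V) := by
      rw [← hu, ← mul_assoc, Units.mul_inv, one_mul]
    have hQ : ∀ v, (∀ j, lastCovector b j v = 0) → Q v = v := by
      intro v hv
      have h1 : (J + t • (1 : End 𝕜 V)) v = S v := by
        simp [S, shiftsChains_iff.1 hJ v hv]
      have h2 : (↑u⁻¹ : End 𝕜 V) (S v) = v := by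
        rw [← hu, ← Module.End.mul_apply, Units.inv_mul, Module.End.one_apply]
      simp only [Q, Module.End.mul_apply]
      rw [h1, h2]
    have h1 : (wedge (factor b t)).compLinearMap S = t ^ finrank 𝕜 V • wedge (lastCovector b) := by
      rw [wedge_compLinearMap, ← sum_eq_finrank b, ← Finset.prod_pow_eq_pow_sum, ← wedge_smul]
      congr 1
      ext j v
      have := factor_shift hm (b := b) (v := v) (j := j) (chain_zero_shiftEnd j v)
        (fun i hi => chain_succ_shiftEnd hi v) t
      simpa [S] using this
    have hcomp : (wedge (factor b t)).compLinearMap (J + t • (1 : End 𝕜 V)) =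
        ((wedge (factor b t)).compLinearMap S).compLinearMap Q := by
      rw [← hSQ]
      rfl
    rw [hcomp, h1, ← hSQ, map_mul, hSd, mul_smul,
      ← wedge_comp_eq_det_smul _ (linearIndependent_lastCovector hm) hQ]
    rfl
  -- Both sides are continuous in `t`, which recovers `t = 0`.
  ext x
  have h1 : Continuous fun t : 𝕜 =>
      (wedge (factor b t)).compLinearMap (J + t • (1 : End 𝕜 V)) x := by
    refine continuous_wedge_factor_apply (fun t i => (J + t • (1 : End 𝕜 V)) (x i)) fun l i => ?_
    simp only [LinearMap.add_apply, LinearMap.smul_apply, map_add, map_smul]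
    fun_prop
  have h2 : Continuous fun t : 𝕜 =>
      (LinearMap.det (J + t • (1 : End 𝕜 V)) • wedge (lastCovector b)) x := by
    simp only [AlternatingMap.smul_apply]
    exact (continuous_det_add_smul_one J).smul continuous_const
  exact congrFun (h1.ext_on (dense_compl_singleton (0 : 𝕜)) h2
    fun t ht => DFunLike.congr_fun (key t ht) x) t

/-- The kernel of `γ(∞)` contains no nonzero invariant subspace. -/
theorem ShiftsChains.eq_bot {J : End 𝕜 V} (hJ : ShiftsChains b J) {S : Submodule 𝕜 V}
    (hS : ∀ v ∈ S, ∀ j, lastCovector b j v = 0) (hJS : S.map J ≤ S) : S = ⊥ := by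
  -- Induction from the top of each chain downwards: `e i j v = - e (i+1) j (J v)`, and `J v` is
  -- again in `S`.
  have key : ∀ k, ∀ v ∈ S, ∀ j i, i < m j → m j ≤ i + k + 1 → chain b j i v = 0 := by
    intro k
    induction k with
    | zero =>
      intro v hv j i hi hk
      obtain rfl : i = m j - 1 := by omega
      exact hS v hv j
    | succ k ih =>
      intro v hv j i hi hk
      rcases Nat.lt_or_ge (i + 1) (m j) with h | h
      · have h1 := (hJ v (hS v hv) j).2 i h
        rw [ih (J v) (hJS ⟨v, hv, rfl⟩) j (i + 1) h (by omega)] at h1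
        exact neg_eq_zero.1 h1.symm
      · obtain rfl : i = m j - 1 := by omega
        exact hS v hv j
  rw [eq_bot_iff]
  intro v hv
  refine (Submodule.mem_bot 𝕜).2 (eq_of_chain_eq (b := b) fun j i hi => ?_)
  rw [key (m j) v hv j i hi (by omega), map_zero]

/-- An eigenvector in the kernel of `γ(∞)` would span an invariant line there. -/
theorem ShiftsChains.injective {J : End 𝕜 V} (hJ : ShiftsChains b J) {t : 𝕜} {v : V}
    (hv : ∀ j, lastCovector b j v = 0) (h : J v + t • v = 0) : v = 0 := by
  have h1 : Submodule.span 𝕜 {v} = ⊥ := hJ.eq_bot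
    (by
      intro w hw j
      obtain ⟨c, rfl⟩ := Submodule.mem_span_singleton.1 hw
      rw [map_smul, hv, smul_zero])
    (by
      rintro _ ⟨w, hw, rfl⟩
      obtain ⟨c, rfl⟩ := Submodule.mem_span_singleton.1 hw
      refine Submodule.mem_span_singleton.2 ⟨-(c * t), ?_⟩
      rw [map_smul, eq_neg_of_add_eq_zero_left h, smul_neg, neg_smul, mul_smul])
  simpa using h1

/-- The inclusion is the telescoping identity. `J + t` is injective on the kernel of `γ(∞)`, even
when it is singular on the whole space, and both sides have codimension `r`. -/
theorem ShiftsChains.map_eq (hm : ∀ j, 1 ≤ m j) {J : End 𝕜 V} (hJ : ShiftsChains b J) (t : 𝕜) :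
    (⨅ j, LinearMap.ker (lastCovector b j)).map (J + t • (1 : End 𝕜 V)) =
      ⨅ j, LinearMap.ker (factor b t j) := by
  apply Submodule.eq_of_le_of_finrank_eq
  · rintro _ ⟨v, hv, rfl⟩
    have hv' : ∀ j, lastCovector b j v = 0 := fun j => (Submodule.mem_iInf _).1 hv j
    exact (Submodule.mem_iInf _).2 fun j => hJ.factor_eq_zero hm hv' t j
  · have h1 := finrank_iInf_ker (linearIndependent_factor (b := b) hm t)
    have h2 := finrank_iInf_ker (linearIndependent_lastCovector (b := b) hm)
    have h3 : Function.Injective ((J + t • (1 : End 𝕜 V)).domRestrict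
        (⨅ j, LinearMap.ker (lastCovector b j))) := by
      rw [injective_iff_map_eq_zero]
      intro v hv
      exact Subtype.ext (hJ.injective (fun j => (Submodule.mem_iInf _).1 v.2 j) hv)
    rw [← LinearMap.range_domRestrict, LinearMap.finrank_range_of_inj h3]
    omega

end Chains

/-! ### Limits, interpolation and resolvent curves of Veronese curves. -/

section AlgebraicWebs

variable {𝕜 V : Type*} [RCLike 𝕜] [AddCommGroup V] [Module 𝕜 V] [FiniteDimensional 𝕜 V] {r : ℕ}
  {m : Fin r → ℕ} {b : Basis (Σ j : Fin r, Fin (m j)) 𝕜 (Dual 𝕜 V)}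

theorem alternatingMap_sum_apply {ι : Type*} (s : Finset ι) (f : ι → V [⋀^Fin r]→ₗ[𝕜] 𝕜)
    (x : Fin r → V) : (∑ i ∈ s, f i) x = ∑ i ∈ s, f i x := by
  classical
  induction s using Finset.induction_on with
  | empty => rfl
  | insert i s hi ih => rw [Finset.sum_insert hi, Finset.sum_insert hi, AlternatingMap.add_apply, ih]

theorem formKer_wedge {l : Fin r → Dual 𝕜 V} (hl : LinearIndependent 𝕜 l) :
    formKer (wedge l) = ⨅ j, LinearMap.ker (l j) := by
  ext v
  rw [mem_formKer_wedge hl, Submodule.mem_iInf]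
  rfl

/-- Since `n - r = ∑ (m j - 1)`, the power of `t` can be distributed over the factors; `γⱼ(t) / t ^
(m j - 1)` is a polynomial in `1 / t` with constant term the top covector. -/
theorem tendsto_wedge_factor (hm : ∀ j, 1 ≤ m j) (x : Fin r → V) :
    Tendsto (fun t : 𝕜 => wedge (factor b t) x / t ^ (finrank 𝕜 V - r)) (Bornology.cobounded 𝕜)
      (𝓝 (wedge (lastCovector b) x)) := by
  have hpow : finrank 𝕜 V - r = ∑ j, (m j - 1) := by
    have h1 : ∑ j, m j = ∑ j, (m j - 1) + ∑ j : Fin r, 1 := by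
      rw [← Finset.sum_add_distrib]
      exact Finset.sum_congr rfl fun j _ => by have := hm j; omega
    have h2 := sum_eq_finrank b
    simp only [Finset.sum_const, Finset.card_univ, Fintype.card_fin, smul_eq_mul, mul_one] at h1
    omega
  have h1 : ∀ t : 𝕜, wedge (factor b t) x / t ^ (finrank 𝕜 V - r) =
      wedge (fun j => (t ^ (m j - 1))⁻¹ • factor b t j) x := by
    intro t
    rw [wedge_smul, AlternatingMap.smul_apply, Finset.prod_inv_distrib,
      Finset.prod_pow_eq_pow_sum, ← hpow, smul_eq_mul, div_eq_inv_mul]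
  refine Tendsto.congr (fun t => (h1 t).symm) ?_
  simp only [wedge_apply]
  have hdet : Continuous fun M : Matrix (Fin r) (Fin r) 𝕜 => M.det := continuous_id.matrix_det
  refine (hdet.tendsto _).comp (tendsto_pi_nhds.2 fun i => tendsto_pi_nhds.2 fun j => ?_)
  have hne : ∀ᶠ t : 𝕜 in Bornology.cobounded 𝕜, t ≠ 0 :=
    (tendsto_inv₀_cobounded'.eventually self_mem_nhdsWithin).mono fun t ht h => ht (by simp [h])
  have h2 : Tendsto (fun t : 𝕜 => ∑ k ∈ Finset.range (m j),
      (t⁻¹) ^ (m j - 1 - k) * chain b j k (x i)) (Bornology.cobounded 𝕜)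
      (𝓝 (∑ k ∈ Finset.range (m j), (0 : 𝕜) ^ (m j - 1 - k) * chain b j k (x i))) :=
    tendsto_finsetSum _ fun k _ => (tendsto_inv₀_cobounded.pow _).mul_const _
  have h3 : ∑ k ∈ Finset.range (m j), (0 : 𝕜) ^ (m j - 1 - k) * chain b j k (x i) =
      lastCovector b j (x i) := by
    rw [Finset.sum_eq_single (m j - 1)]
    · simp [lastCovector]
    · intro k hk hne
      have := Finset.mem_range.1 hk
      rw [zero_pow (by omega), zero_mul]
    · intro h
      have := hm j
      exact absurd (Finset.mem_range.2 (by omega)) h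
  rw [h3] at h2
  refine h2.congr' ?_
  filter_upwards [hne] with t ht
  simp only [Matrix.of_apply, factor_eq_sum_range, LinearMap.smul_apply, LinearMap.sum_apply,
    smul_eq_mul, Finset.mul_sum]
  refine Finset.sum_congr rfl fun k hk => ?_
  have hk' := Finset.mem_range.1 hk
  rw [← mul_assoc]
  congr 1
  have h4 : m j - 1 = (m j - 1 - k) + k := by omega
  conv_rhs => rw [h4, pow_add, mul_inv, mul_assoc, inv_mul_cancel₀ (pow_ne_zero k ht), mul_one,
    ← inv_pow]

theorem wedge_ne_zero {l : Fin r → Dual 𝕜 V} (hl : LinearIndependent 𝕜 l) : wedge l ≠ 0 := by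
  intro h
  obtain ⟨e, he⟩ := exists_dual_vectors hl
  have h1 := DFunLike.congr_fun h e
  rw [wedge_apply] at h1
  have h2 : (Matrix.of fun i j => l j (e i)) = (1 : Matrix (Fin r) (Fin r) 𝕜) := by
    ext i j
    simp [he, Matrix.one_apply]
  rw [h2, Matrix.det_one] at h1
  exact one_ne_zero h1

/-- Any two representatives differ by a scalar function of `t`. This function converges, as a
quotient of convergent values, and its limit is nonzero because the limit forms are. So all the
subspaces in the infimum defining `atInfinity` coincide. -/
theorem atInfinity_eq (hr : 1 ≤ r) (hm : ∀ j, 1 ≤ m j) {u : 𝕜 → Submodule 𝕜 V}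
    (hu : ∀ t, u t = ⨅ j, LinearMap.ker (factor b t j)) :
    atInfinity r u = ⨅ j, LinearMap.ker (lastCovector b j) := by
  have hk : ∀ t, formKer (wedge (factor b t)) = u t := fun t => by
    rw [hu, formKer_wedge (linearIndependent_factor hm t)]
  have hδ := formKer_wedge (linearIndependent_lastCovector (b := b) hm)
  apply le_antisymm
  · rw [← hδ]
    exact sInf_le ⟨fun t => wedge (factor b t), ⟨m, hm, b, fun t => rfl⟩, hk,
      wedge (lastCovector b), tendsto_wedge_factor hm, rfl⟩
  · refine le_sInf ?_
    rintro S ⟨γ, ⟨m', hm', b', hb'⟩, hγ, δ, hδ', rfl⟩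
    obtain rfl : γ = fun t => wedge (factor b' t) := funext hb'
    have hd : δ = wedge (lastCovector b') := by
      ext x
      exact tendsto_nhds_unique (hδ' x) (tendsto_wedge_factor hm' x)
    choose c hc0 hc using fun t => exists_eq_smul_wedge_of_formKer_eq
      (linearIndependent_factor (b := b) hm t) hr ((hγ t).trans (hu t))
    obtain ⟨x, hx⟩ : ∃ x, wedge (lastCovector b) x ≠ 0 := by
      by_contra h
      push Not at h
      exact wedge_ne_zero (linearIndependent_lastCovector (b := b) hm) (AlternatingMap.ext h)
    have hlim : Tendsto c (Bornology.cobounded 𝕜) (𝓝 (δ x / wedge (lastCovector b) x)) := by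
      refine ((hδ' x).div (tendsto_wedge_factor (b := b) hm x) hx).congr' ?_
      have hne : ∀ᶠ t : 𝕜 in Bornology.cobounded 𝕜, t ≠ 0 :=
        (tendsto_inv₀_cobounded'.eventually self_mem_nhdsWithin).mono
          fun t ht h => ht (by simp [h])
      have hne' := (tendsto_wedge_factor (b := b) hm x).eventually_ne hx
      filter_upwards [hne'] with t ht
      simp only [Pi.div_apply, hc, AlternatingMap.smul_apply, smul_eq_mul]
      rw [mul_div_assoc, mul_div_cancel_right₀ _ ht]
    have hδc : δ = (δ x / wedge (lastCovector b) x) • wedge (lastCovector b) := by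
      ext y
      refine tendsto_nhds_unique (hδ' y) ?_
      have h1 := hlim.mul (tendsto_wedge_factor (b := b) hm y)
      refine h1.congr fun t => ?_
      simp only [hc, AlternatingMap.smul_apply, smul_eq_mul]
      ring
    have hne : δ x / wedge (lastCovector b) x ≠ 0 := by
      intro h0
      rw [h0, zero_smul, hd] at hδc
      exact wedge_ne_zero (linearIndependent_lastCovector hm') hδc
    rw [hδc, mem_formKer_smul hne, hδ]

/-- The value at `x` of a Veronese curve is a polynomial. -/
theorem exists_polynomial_wedge_factor (b : Basis (Σ j : Fin r, Fin (m j)) 𝕜 (Dual 𝕜 V))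
    (x : Fin r → V) :
    ∃ P : Polynomial 𝕜, P.natDegree ≤ finrank 𝕜 V ∧ ∀ t, wedge (factor b t) x = P.eval t := by
  let M : Matrix (Fin r) (Fin r) (Polynomial 𝕜) := Matrix.of fun i j =>
    ∑ k : Fin (m j), Polynomial.C (b ⟨j, k⟩ (x i)) * Polynomial.X ^ (k : ℕ)
  refine ⟨M.det, ?_, fun t => ?_⟩
  -- Column `j` has degree at most `m j`, and the `m j` add up to `n`. This crude bound is enough
  -- for interpolation at `n + 1` nodes.
  · rw [Matrix.det_apply']
    refine Polynomial.natDegree_sum_le_of_forall_le Finset.univ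
      (fun σ : Equiv.Perm (Fin r) => ((Equiv.Perm.sign σ : ℤ) : Polynomial 𝕜) *
        ∏ i, M (σ i) i) fun σ _ => ?_
    have h1 : ∀ j, (M (σ j) j).natDegree ≤ m j := fun j => by
      refine Polynomial.natDegree_sum_le_of_forall_le Finset.univ
        (fun k : Fin (m j) => Polynomial.C (b ⟨j, k⟩ (x (σ j))) * Polynomial.X ^ (k : ℕ))
        fun k _ => ?_
      exact (Polynomial.natDegree_C_mul_X_pow_le _ _).trans k.2.le
    have h2 : ((Equiv.Perm.sign σ : ℤ) : Polynomial 𝕜) =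
        Polynomial.C ((Equiv.Perm.sign σ : ℤ) : 𝕜) := by
      simp
    rw [h2, ← sum_eq_finrank b]
    refine (Polynomial.natDegree_C_mul_le _ _).trans ?_
    exact (Polynomial.natDegree_prod_le _ _).trans (Finset.sum_le_sum fun j _ => h1 j)
  · rw [wedge_apply, ← Polynomial.coe_evalRingHom, RingHom.map_det]
    congr 1
    ext i j
    simp only [M, factor, LinearMap.sum_apply, Matrix.of_apply, RingHom.mapMatrix_apply,
      Matrix.map_apply, Polynomial.coe_evalRingHom, Polynomial.eval_finsetSum,
      Polynomial.eval_mul, Polynomial.eval_C, Polynomial.eval_pow, Polynomial.eval_X,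
      LinearMap.smul_apply, smul_eq_mul]
    exact Finset.sum_congr rfl fun k _ => mul_comm _ _

/-- Lagrange interpolation of a Veronese curve. -/
theorem wedge_factor_eq_sum_lagrange (b : Basis (Σ j : Fin r, Fin (m j)) 𝕜 (Dual 𝕜 V))
    {ν : Fin (finrank 𝕜 V + 1) → 𝕜} (hν : Function.Injective ν) (t : 𝕜) :
    wedge (factor b t) =
      ∑ s, (Lagrange.basis Finset.univ ν s).eval t • wedge (factor b (ν s)) := by
  ext x
  obtain ⟨P, hP, hPx⟩ := exists_polynomial_wedge_factor b x
  have hdeg : P.degree < (Finset.univ : Finset (Fin (finrank 𝕜 V + 1))).card := by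
    rw [Finset.card_univ, Fintype.card_fin]
    exact Polynomial.degree_le_natDegree.trans_lt (by exact_mod_cast Nat.lt_succ_of_le hP)
  have h1 := Lagrange.eq_interpolate (s := Finset.univ) (hν.injOn) hdeg
  rw [hPx, h1, Lagrange.interpolate_apply, Polynomial.eval_finsetSum]
  simp only [alternatingMap_sum_apply, AlternatingMap.smul_apply, hPx, smul_eq_mul]
  refine Finset.sum_congr rfl fun s _ => ?_
  rw [Polynomial.eval_mul, Polynomial.eval_C, mul_comm]

theorem exists_coefficients_wedge_factor (b : Basis (Σ j : Fin r, Fin (m j)) 𝕜 (Dual 𝕜 V)) :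
    ∃ (d : ℕ) (c : ℕ → V [⋀^Fin r]→ₗ[𝕜] 𝕜), ∀ t,
      wedge (factor b t) = ∑ i ∈ Finset.range d, t ^ i • c i := by
  obtain ⟨ν⟩ : Nonempty (Fin (finrank 𝕜 V + 1) ↪ 𝕜) := by
    have : Infinite 𝕜 := inferInstance
    exact ⟨(Fin.valEmbedding).trans (Infinite.natEmbedding 𝕜)⟩
  let L := fun s => Lagrange.basis Finset.univ ν s
  refine ⟨Finset.univ.sup (fun s => (L s).natDegree) + 1,
    fun i => ∑ s, (L s).coeff i • wedge (factor b (ν s)), fun t => ?_⟩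
  rw [wedge_factor_eq_sum_lagrange b ν.injective t]
  simp only [Finset.smul_sum, smul_smul]
  rw [Finset.sum_comm]
  refine Finset.sum_congr rfl fun s _ => ?_
  rw [← Finset.sum_smul]
  congr 1
  have h1 : (L s).natDegree < Finset.univ.sup (fun s => (L s).natDegree) + 1 :=
    Nat.lt_succ_of_le (Finset.le_sup (f := fun s => (L s).natDegree) (Finset.mem_univ s))
  rw [Polynomial.eval_eq_sum_range' h1]
  exact Finset.sum_congr rfl fun i _ => mul_comm _ _

/-- The scalar is absorbed by rescaling the covectors of a single block. -/
theorem isVeroneseCurve_smul_wedge_factor (hr : 1 ≤ r) (hm : ∀ j, 1 ≤ m j) {c : 𝕜} (hc : c ≠ 0)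
    (b : Basis (Σ j : Fin r, Fin (m j)) 𝕜 (Dual 𝕜 V)) :
    IsVeroneseCurve fun t => c • wedge (factor b t) := by
  classical
  let j₀ : Fin r := ⟨0, hr⟩
  let w : Fin r → 𝕜 := fun j => if j = j₀ then c else 1
  have hw : ∀ j, IsUnit (w j) := fun j => by
    simp only [w]
    split_ifs
    · exact isUnit_iff_ne_zero.2 hc
    · exact isUnit_one
  refine ⟨m, hm, b.isUnitSMul (w := fun a => w a.1) fun a => hw a.1, fun t => ?_⟩
  have h1 : (fun j => ∑ i : Fin (m j), t ^ (i : ℕ) •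
      b.isUnitSMul (w := fun a => w a.1) (fun a => hw a.1) ⟨j, i⟩) =
      fun j => w j • factor b t j := by
    ext1 j
    simp only [factor, Finset.smul_sum, Basis.isUnitSMul_apply]
    exact Finset.sum_congr rfl fun i _ => smul_comm _ _ _
  rw [h1, wedge_smul]
  simp [w]

/-- The resolvent curve of an endomorphism which shifts the chains of a splitting basis. -/
theorem ShiftsChains.isResolventCurve (hm : ∀ j, 1 ≤ m j) {J : End 𝕜 V} (hJ : ShiftsChains b J)
    (c : 𝕜) :
    IsResolventCurve (fun t => LinearMap.det (J + t • (1 : End 𝕜 V))) J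
      (c • wedge (lastCovector b)) (fun t => c • wedge (factor b t)) := by
  constructor
  · obtain ⟨d, a, ha⟩ := exists_coefficients_wedge_factor b
    refine ⟨d, fun i => c • a i, fun t => ?_⟩
    beta_reduce
    rw [ha, Finset.smul_sum]
    exact Finset.sum_congr rfl fun i _ => smul_comm _ _ _
  · intro t ht
    have h1 := hJ.wedge_comp hm t
    obtain ⟨u, hu⟩ := ht
    rw [← hu] at h1
    simp only [← hu, Ring.inverse_unit]
    have h2 : ∀ v, (u : End 𝕜 V) ((↑u⁻¹ : End 𝕜 V) v) = v := fun v => by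
      rw [← Module.End.mul_apply, Units.mul_inv, Module.End.one_apply]
    ext x
    have h3 := DFunLike.congr_fun h1 fun i => (↑u⁻¹ : End 𝕜 V) (x i)
    simp only [AlternatingMap.compLinearMap_apply, AlternatingMap.smul_apply, h2] at h3 ⊢
    rw [h3, smul_comm]

/-- A resolvent curve is determined by its values at the invertible points. -/
theorem IsResolventCurve.unique {f : 𝕜 → 𝕜} {J : End 𝕜 V} {β : V [⋀^Fin r]→ₗ[𝕜] 𝕜}
    {γ γ' : 𝕜 → V [⋀^Fin r]→ₗ[𝕜] 𝕜} (h : IsResolventCurve f J β γ)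
    (h' : IsResolventCurve f J β γ') : γ = γ' := by
  have hcont : ∀ {γ : 𝕜 → V [⋀^Fin r]→ₗ[𝕜] 𝕜}, IsResolventCurve f J β γ → ∀ x,
      Continuous fun t => γ t x := by
    rintro γ ⟨⟨d, c, hc⟩, -⟩ x
    simp only [hc, alternatingMap_sum_apply, AlternatingMap.smul_apply]
    fun_prop
  -- The singular parameters are the negatives of the roots of the characteristic polynomial, a
  -- finite set.
  have hdense : Dense {t : 𝕜 | IsUnit (J + t • (1 : End 𝕜 V))} := by
    have hfin : {t : 𝕜 | ¬IsUnit (J + t • (1 : End 𝕜 V))}.Finite := by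
      have h1 : (J.charpoly.rootSet 𝕜).Finite := Polynomial.rootSet_finite _ _
      refine (h1.image Neg.neg).subset fun t ht => ⟨-t, ?_, neg_neg t⟩
      rw [Set.mem_ofPred_eq, LinearMap.isUnit_iff_isUnit_det, isUnit_iff_ne_zero, not_not,
        det_add_smul_one] at ht
      rw [Polynomial.mem_rootSet]
      refine ⟨J.charpoly_monic.ne_zero, ?_⟩
      rw [Polynomial.coe_aeval_eq_eval]
      exact (mul_eq_zero.1 ht).resolve_left (pow_ne_zero _ (by simp))
    have := hfin.countable.dense_compl 𝕜
    convert this using 1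
    ext t
    simp
  funext t
  ext x
  refine congrFun ((hcont h x).ext_on hdense (hcont h' x) fun t ht => ?_) t
  simp only [h.2 t ht, h'.2 t ht]

end AlgebraicWebs

/-! ### Kronecker normal form. -/

section Kronecker

universe u

variable {𝕜 : Type*} [Field 𝕜]

/-- The chain decomposition of a Kronecker pencil with surjective first map. -/
theorem exists_chains_of_pencil (n : ℕ) {X Y : Type u} [AddCommGroup X] [Module 𝕜 X]
    [FiniteDimensional 𝕜 X] [AddCommGroup Y] [Module 𝕜 Y] [FiniteDimensional 𝕜 Y]
    (hX : finrank 𝕜 X = n) (π κ : X →ₗ[𝕜] Y) (hπ : Function.Surjective π)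
    (hT : ∀ T : Submodule 𝕜 Y, (T.comap π).map κ ≤ T → T = ⊤) :
    ∃ (ι : Type) (_ : Fintype ι) (m : ι → ℕ) (x : ι → ℕ → X), (∀ j, 1 ≤ m j) ∧
      ∑ j, m j = finrank 𝕜 X ∧ Fintype.card ι = finrank 𝕜 (LinearMap.ker π) ∧
      Submodule.span 𝕜 {y | ∃ j i, i < m j ∧ y = x j i} = ⊤ ∧
      Submodule.span 𝕜 (Set.range fun j => x j (m j - 1)) = LinearMap.ker π ∧
      (∀ j, κ (x j 0) = 0) ∧ ∀ j i, i + 1 < m j → κ (x j (i + 1)) = π (x j i) := by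
  induction n using Nat.strong_induction_on generalizing X Y with
  | _ n ih =>
  rcases Nat.eq_zero_or_pos (finrank 𝕜 (LinearMap.ker π)) with h0 | hpos
  · have hker : LinearMap.ker π = ⊥ := Submodule.finrank_eq_zero.1 h0
    have htop : (⊥ : Submodule 𝕜 Y) = ⊤ := hT ⊥ (by
      rw [Submodule.comap_bot, hker, Submodule.map_bot])
    have hXbot : (⊤ : Submodule 𝕜 X) = ⊥ := by
      rw [← hker, eq_comm, LinearMap.ker_eq_top]
      ext v
      exact (Submodule.mem_bot 𝕜).1 (htop.symm ▸ Submodule.mem_top)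
    refine ⟨Empty, inferInstance, fun _ => 0, fun _ _ => 0, fun j => j.elim, ?_, ?_, ?_, ?_,
      fun j => j.elim, fun j => j.elim⟩
    · rw [← finrank_top, hXbot, finrank_bot]; rfl
    · rw [h0]; rfl
    · rw [hXbot, eq_bot_iff, Submodule.span_le]
      rintro y ⟨j, -⟩
      exact j.elim
    · rw [hker, eq_bot_iff, Submodule.span_le]
      rintro y ⟨j, -⟩
      exact j.elim
  -- Induction on the dimension: `κ` after a section of `π` is well defined modulo `W = κ (ker π)`,
  -- so `Y → Y / W` carries a smaller pencil of the same kind. Its chains are lifted to `X` and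
  -- prolonged.
  · let W : Submodule 𝕜 Y := (LinearMap.ker π).map κ
    let σ : Y →ₗ[𝕜] X := (π.exists_rightInverse_of_surjective (LinearMap.range_eq_top.2 hπ)).choose
    have hσ : ∀ y, π (σ y) = y := fun y => LinearMap.congr_fun
      (π.exists_rightInverse_of_surjective (LinearMap.range_eq_top.2 hπ)).choose_spec y
    have hdim : finrank 𝕜 Y + finrank 𝕜 (LinearMap.ker π) = finrank 𝕜 X := by
      rw [← π.finrank_range_add_finrank_ker, LinearMap.range_eq_top.2 hπ, finrank_top]
    have hκ' : ∀ z, W.mkQ (κ (σ (π z))) = W.mkQ (κ z) := by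
      intro z
      rw [← sub_eq_zero, ← map_sub, ← map_sub, Submodule.mkQ_apply, Submodule.Quotient.mk_eq_zero]
      exact Submodule.mem_map_of_mem (by rw [LinearMap.mem_ker, map_sub, hσ, sub_self])
    obtain ⟨ι, _, m, f, hm, hsum, hcard, hspan, hlast, hf0, hf⟩ :=
      ih (finrank 𝕜 Y) (by omega) rfl W.mkQ (W.mkQ ∘ₗ κ ∘ₗ σ) W.mkQ_surjective (by
        intro T hTT
        have h1 : T.comap W.mkQ = ⊤ := by
          apply hT
          rintro _ ⟨z, hz, rfl⟩
          have h2 : (W.mkQ ∘ₗ κ ∘ₗ σ) (π z) ∈ T := hTT (Submodule.mem_map_of_mem hz)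
          rw [LinearMap.comp_apply, LinearMap.comp_apply, hκ'] at h2
          exact h2
        rw [eq_top_iff, ← Submodule.map_comap_eq_of_surjective W.mkQ_surjective T, h1,
          Submodule.map_top, Submodule.range_mkQ])
    rw [Submodule.ker_mkQ] at hcard hlast
    -- The error of a lift lies in `W = κ (ker π)`, so it is corrected without changing the image
    -- under `π`.
    have hlift : ∀ y z : Y, W.mkQ (κ (σ y)) = W.mkQ z → ∃ u : X, π u = y ∧ κ u = z := by
      intro y z h
      rw [← sub_eq_zero, ← map_sub, Submodule.mkQ_apply, Submodule.Quotient.mk_eq_zero] at h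
      obtain ⟨a, ha, ha'⟩ := h
      refine ⟨σ y - a, ?_, ?_⟩
      · rw [map_sub, hσ, LinearMap.mem_ker.1 ha, sub_zero]
      · rw [map_sub, ha', sub_sub_cancel]
    have hg : ∀ j i, ∃ u : X, i < m j → π u = f j i ∧ κ u = if i = 0 then 0 else f j (i - 1) := by
      intro j i
      by_cases hi : i < m j
      · cases i with
        | zero =>
          obtain ⟨u, hu⟩ := hlift (f j 0) 0 (by rw [map_zero]; exact hf0 j)
          exact ⟨u, fun _ => by simpa using hu⟩
        | succ i =>
          obtain ⟨u, hu⟩ := hlift (f j (i + 1)) (f j i) (hf j i hi)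
          exact ⟨u, fun _ => by simpa using hu⟩
      · exact ⟨0, fun h => absurd h hi⟩
    choose g hg using hg
    -- The end of each chain downstairs lies in `W`, so the lifted chain can be prolonged by one
    -- vector of `ker π`.
    have hw : ∀ j, ∃ u : X, π u = 0 ∧ κ u = f j (m j - 1) := by
      intro j
      have h : f j (m j - 1) ∈ W := hlast ▸ Submodule.subset_span ⟨j, rfl⟩
      obtain ⟨u, hu, hu'⟩ := h
      exact ⟨u, hu, hu'⟩
    choose w hw0 hw1 using hw
    let K := LinearMap.ker (κ.domRestrict (LinearMap.ker π))
    have hK : finrank 𝕜 W + finrank 𝕜 K = finrank 𝕜 (LinearMap.ker π) := by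
      rw [← (κ.domRestrict (LinearMap.ker π)).finrank_range_add_finrank_ker,
        LinearMap.range_domRestrict]
    let u := finBasis 𝕜 K
    have hKspan : ∀ z, π z = 0 → κ z = 0 →
        z ∈ Submodule.span 𝕜 (Set.range fun k => ((u k : LinearMap.ker π) : X)) := by
      intro z h1 h2
      let z' : K := ⟨⟨z, h1⟩, h2⟩
      have h3 := u.mem_span z'
      have h4 := Submodule.mem_map_of_mem (f := (LinearMap.ker π).subtype ∘ₗ K.subtype) h3
      rw [Submodule.map_span, ← Set.range_comp] at h4
      exact h4
    -- The vectors of `ker π` not accounted for by the prolonged ends come from `ker π ∩ ker κ`,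
    -- whose basis gives chains of length one.
    let y : ι ⊕ Fin (finrank 𝕜 K) → ℕ → X := Sum.elim (fun j i => if i < m j then g j i else w j)
      (fun k _ => ((u k : LinearMap.ker π) : X))
    let m' : ι ⊕ Fin (finrank 𝕜 K) → ℕ := Sum.elim (fun j => m j + 1) (fun _ => 1)
    have hylast : ∀ j, y (Sum.inl j) (m' (Sum.inl j) - 1) = w j := fun j => by simp [y, m']
    have hkerspan : LinearMap.ker π ≤
        Submodule.span 𝕜 (Set.range fun j => y j (m' j - 1)) := by
      intro z hz
      have h1 : W ≤ (Submodule.span 𝕜 (Set.range w)).map κ := by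
        rw [← hlast, Submodule.span_le]
        rintro _ ⟨j, rfl⟩
        exact ⟨w j, Submodule.subset_span ⟨j, rfl⟩, hw1 j⟩
      obtain ⟨s, hs, hsz⟩ := h1 (Submodule.mem_map_of_mem hz)
      have hs0 : π s = 0 := by
        have : Submodule.span 𝕜 (Set.range w) ≤ LinearMap.ker π := by
          rw [Submodule.span_le]
          rintro _ ⟨j, rfl⟩
          exact hw0 j
        exact this hs
      have h2 := hKspan (z - s) (by rw [map_sub, hs0, LinearMap.mem_ker.1 hz, sub_zero])
        (by rw [map_sub, hsz, sub_self])
      rw [← sub_add_cancel z s]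
      refine Submodule.add_mem _ (Submodule.span_mono ?_ h2) (Submodule.span_mono ?_ hs)
      · rintro _ ⟨k, rfl⟩
        exact ⟨Sum.inr k, rfl⟩
      · rintro _ ⟨j, rfl⟩
        exact ⟨Sum.inl j, hylast j⟩
    refine ⟨ι ⊕ Fin (finrank 𝕜 K), inferInstance, m', y, ?_, ?_, ?_, ?_, ?_, ?_, ?_⟩
    · rintro (j | k) <;> simp [m']
    · simp only [m', Fintype.sum_sum_type, Sum.elim_inl, Sum.elim_inr, Finset.sum_add_distrib, hsum,
        Finset.sum_const, Finset.card_univ, smul_eq_mul, mul_one, Fintype.card_fin]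
      omega
    · rw [Fintype.card_sum, Fintype.card_fin]
      omega
    · rw [eq_top_iff]
      intro z _
      have h1 : (⊤ : Submodule 𝕜 Y) ≤
          (Submodule.span 𝕜 {a | ∃ j i, i < m' j ∧ a = y j i}).map π := by
        rw [← hspan, Submodule.span_le]
        rintro _ ⟨j, i, hi, rfl⟩
        refine ⟨y (Sum.inl j) i, Submodule.subset_span ⟨Sum.inl j, i, ?_, rfl⟩, ?_⟩
        · exact Nat.lt_succ_of_lt hi
        · simp only [y, Sum.elim_inl, if_pos hi]
          exact (hg j i hi).1
      obtain ⟨s, hs, hsz⟩ := h1 (Submodule.mem_top (x := π z))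
      rw [← sub_add_cancel z s]
      refine Submodule.add_mem _ (Submodule.span_mono ?_ (hkerspan (x := z - s) ?_)) hs
      · rintro _ ⟨j, rfl⟩
        refine ⟨j, m' j - 1, ?_, rfl⟩
        rcases j with j | k <;> simp [m']
      · rw [LinearMap.mem_ker, map_sub, hsz, sub_self]
    · refine le_antisymm ?_ hkerspan
      rw [Submodule.span_le]
      rintro _ ⟨j | k, rfl⟩
      · simp only [hylast]
        exact hw0 j
      · exact (u k : LinearMap.ker π).2
    · rintro (j | k)
      · have h := hg j 0 (hm j)
        have h' : 0 < m j := hm j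
        simp only [y, Sum.elim_inl, if_pos h', h.2, if_true]
      · exact (u k).2
    · rintro (j | k) i hi
      · have hi' : i < m j := Nat.lt_of_succ_lt_succ hi
        simp only [y, Sum.elim_inl, if_pos hi', (hg j i hi').1]
        split_ifs with h
        · rw [(hg j (i + 1) h).2, if_neg (Nat.succ_ne_zero i), Nat.add_sub_cancel]
        · rw [hw1 j, show m j - 1 = i by omega]
      · simp only [m', Sum.elim_inr] at hi
        omega

end Kronecker

/-! ### Bases adapted to an endomorphism. -/

section Spans

variable {𝕜 V : Type*} [RCLike 𝕜] [AddCommGroup V] [Module 𝕜 V] [FiniteDimensional 𝕜 V] {r : ℕ}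
  {m : Fin r → ℕ} {b : Basis (Σ j : Fin r, Fin (m j)) 𝕜 (Dual 𝕜 V)}

theorem eq_top_of_spans {W T : Submodule 𝕜 V} {J : End 𝕜 V} (h : Spans W J) (hW : W ≤ T)
    (hT : ∀ v ∈ T, J v ∈ T) : T = ⊤ := by
  rw [eq_top_iff, ← h, iSup_le_iff]
  intro i
  induction i with
  | zero => simpa [Module.End.one_eq_id] using hW
  | succ i ih =>
    rw [pow_succ', Module.End.mul_eq_comp, Submodule.map_comp]
    rintro _ ⟨v, hv, rfl⟩
    exact hT v (ih hv)

/-- The subspace generated by the annihilator of `F` under the transpose of `J` has a common kernel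
which is `J`-invariant and contained in `F`, hence zero. -/
theorem spans_dualAnnihilator_of_forall_eq_bot {F : Submodule 𝕜 V} {J : End 𝕜 V}
    (h : ∀ S ≤ F, S.map J ≤ S → S = ⊥) : Spans F.dualAnnihilator J.dualMap := by
  let Z : Submodule 𝕜 (Dual 𝕜 V) := ⨆ i : ℕ, F.dualAnnihilator.map (J.dualMap ^ i)
  have hZ : ∀ φ ∈ Z, J.dualMap φ ∈ Z := by
    have : Z.map J.dualMap ≤ Z := by
      simp only [Z]
      rw [Submodule.map_iSup]
      refine iSup_le fun i => ?_
      rw [← Submodule.map_comp, ← Module.End.mul_eq_comp, ← pow_succ']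
      exact le_iSup (fun i : ℕ => F.dualAnnihilator.map (J.dualMap ^ i)) (i + 1)
    exact fun φ hφ => this (Submodule.mem_map_of_mem hφ)
  have hFZ : F.dualAnnihilator ≤ Z := by
    refine le_trans ?_ (le_iSup _ 0)
    simp [Module.End.one_eq_id]
  have hbot := h Z.dualCoannihilator (by
      refine (Submodule.dualCoannihilator_anti hFZ).trans ?_
      rw [Subspace.dualAnnihilator_dualCoannihilator_eq]) (by
      rintro _ ⟨v, hv, rfl⟩
      rw [Submodule.mem_dualCoannihilator]
      intro φ hφ
      exact (Submodule.mem_dualCoannihilator _).1 hv _ (hZ φ hφ))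
  have := congrArg Submodule.dualAnnihilator hbot
  rw [Subspace.dualCoannihilator_dualAnnihilator_eq, Submodule.dualAnnihilator_bot] at this
  exact this

/-- Apply the chain decomposition to `π : V* → V*/F'` and `κ = -π ∘ J^*`. The relation `κ x (i+1) =
π x i` says that `x (i+1) ∘ J + x i` vanishes on `F`, which is the shift condition. Spanning is
exactly the hypothesis on invariant subspaces, and there are `dim F' = r` chains, whose ends span
`F'`. -/
theorem exists_basis_shiftsChains {F : Submodule 𝕜 V} {J : End 𝕜 V} (hF : finrank 𝕜 (V ⧸ F) = r)
    (h : Spans F.dualAnnihilator J.dualMap) :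
    ∃ m : Fin r → ℕ, (∀ j, 1 ≤ m j) ∧ ∃ b : Basis (Σ j : Fin r, Fin (m j)) 𝕜 (Dual 𝕜 V),
      F = ⨅ j, LinearMap.ker (lastCovector b j) ∧ ShiftsChains b J := by
  let W := F.dualAnnihilator
  obtain ⟨ι, _, m, x, hm, hsum, hcard, hspan, hlast, hx0, hx⟩ :=
    exists_chains_of_pencil (finrank 𝕜 (Dual 𝕜 V)) rfl W.mkQ (-(W.mkQ ∘ₗ J.dualMap))
      W.mkQ_surjective (by
        intro T hT
        have h1 : T.comap W.mkQ = ⊤ := by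
          refine eq_top_of_spans h ?_ ?_
          · intro φ hφ
            rw [Submodule.mem_comap, Submodule.mkQ_apply, (Submodule.Quotient.mk_eq_zero W).2 hφ]
            exact T.zero_mem
          · intro φ hφ
            have := hT (Submodule.mem_map_of_mem hφ)
            rw [LinearMap.neg_apply, Submodule.neg_mem_iff] at this
            exact this
        rw [eq_top_iff, ← Submodule.map_comap_eq_of_surjective W.mkQ_surjective T, h1,
          Submodule.map_top, Submodule.range_mkQ])
  rw [Submodule.ker_mkQ] at hcard hlast
  have hr : Fintype.card ι = r := by
    rw [hcard, ← hF]
    exact (Subspace.quotEquivAnnihilator F).symm.finrank_eq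
  let e : Fin r ≃ ι := (Fintype.equivFinOfCardEq hr).symm
  let m' : Fin r → ℕ := m ∘ e
  let y : (Σ j : Fin r, Fin (m' j)) → Dual 𝕜 V := fun a => x (e a.1) a.2
  have hy : ⊤ ≤ Submodule.span 𝕜 (Set.range y) := by
    rw [← hspan]
    refine Submodule.span_mono ?_
    rintro _ ⟨j, i, hi, rfl⟩
    exact ⟨⟨e.symm j, ⟨i, by simpa [m'] using hi⟩⟩, by simp [y]⟩
  have hcard' : Fintype.card (Σ j : Fin r, Fin (m' j)) = finrank 𝕜 (Dual 𝕜 V) := by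
    rw [Fintype.card_sigma, ← hsum, ← e.sum_comp]
    simp [m']
  let b : Basis (Σ j : Fin r, Fin (m' j)) 𝕜 (Dual 𝕜 V) :=
    basisOfTopLeSpanOfCardEqFinrank y hy hcard'
  have hb : ∀ a, b a = y a := fun a => by simp [b]
  have hchain : ∀ j i, i < m' j → chain b j i = x (e j) i := by
    intro j i hi
    rw [chain_of_lt hi, hb]
  have hlastb : ∀ j, lastCovector b j = x (e j) (m (e j) - 1) := fun j =>
    hchain j _ (Nat.sub_lt (hm _) one_pos)
  have hFmem : ∀ v, v ∈ F ↔ ∀ j, lastCovector b j v = 0 := by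
    intro v
    rw [← Subspace.dualAnnihilator_dualCoannihilator_eq (W := F),
      Submodule.mem_dualCoannihilator]
    constructor
    · intro hv j
      refine hv _ ?_
      rw [hlastb]
      change _ ∈ W
      rw [← hlast]
      exact Submodule.subset_span ⟨e j, rfl⟩
    · intro hv φ hφ
      change φ ∈ W at hφ
      rw [← hlast] at hφ
      induction hφ using Submodule.span_induction with
      | mem φ hφ =>
        obtain ⟨j, rfl⟩ := hφ
        have := hv (e.symm j)
        rwa [hlastb, e.apply_symm_apply] at this
      | zero => rfl
      | add _ _ _ _ h1 h2 => rw [LinearMap.add_apply, h1, h2, add_zero]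
      | smul c _ _ h1 => rw [LinearMap.smul_apply, h1, smul_zero]
  refine ⟨m', fun j => hm _, b, ?_, ?_⟩
  · ext v
    rw [hFmem, Submodule.mem_iInf]
    rfl
  · intro v hv j
    have hvF := (hFmem v).2 hv
    constructor
    · rw [hchain j 0 (hm _)]
      have h0 := hx0 (e j)
      rw [LinearMap.neg_apply, neg_eq_zero, LinearMap.comp_apply, Submodule.mkQ_apply,
        Submodule.Quotient.mk_eq_zero, Submodule.mem_dualAnnihilator] at h0
      exact h0 v hvF
    · intro i hi
      have h0 := hx (e j) i hi
      rw [LinearMap.neg_apply, LinearMap.comp_apply, ← sub_eq_zero, ← map_neg, ← map_sub,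
        Submodule.mkQ_apply, Submodule.Quotient.mk_eq_zero, Submodule.mem_dualAnnihilator] at h0
      have h1 := h0 v hvF
      rw [LinearMap.sub_apply, LinearMap.neg_apply, LinearMap.dualMap_apply, sub_eq_zero] at h1
      rw [hchain j _ hi, hchain j _ (Nat.lt_of_succ_lt hi), ← h1, neg_neg]

/-- A diagonalizable endomorphism whose eigencovectors are adapted to the web shifts the chains. -/
theorem shiftsChains_of_eigencovectors (hm : ∀ j, 1 ≤ m j) {J : End 𝕜 V}
    (hJ : ⨆ μ : 𝕜, J.eigenspace μ = ⊤)
    (h : ∀ c, J.charpoly.IsRoot c → ∀ l : Dual 𝕜 V, l ∘ₗ J = c • l →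
      ∀ v, (∀ j, factor b (-c) j v = 0) → l v = 0) : ShiftsChains b J := by
  classical
  rw [shiftsChains_iff]
  intro v hv
  have hint := DirectSum.isInternal_submodule_of_iSupIndep_of_iSup_eq_top
    J.eigenspaces_iSupIndep hJ
  let B := hint.collectedBasis fun μ => Basis.ofVectorSpace 𝕜 (J.eigenspace μ)
  have hB : ∀ a, J (B a) = a.1 • B a := fun a =>
    Module.End.mem_eigenspace_iff.1 (hint.collectedBasis_mem _ a)
  apply B.ext_elem
  intro a
  have hl : B.coord a ∘ₗ J = a.1 • B.coord a := by
    refine B.ext fun a' => ?_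
    rw [LinearMap.comp_apply, hB, map_smul, LinearMap.smul_apply, Basis.coord_apply,
      Basis.repr_self, Finsupp.single_apply]
    split_ifs with haa
    · rw [haa]
    · simp
  have hroot : J.charpoly.IsRoot a.1 := by
    rw [← Module.End.hasEigenvalue_iff_isRoot_charpoly]
    exact Module.End.hasEigenvalue_of_hasEigenvector ⟨hint.collectedBasis_mem _ a, B.ne_zero a⟩
  -- With `c` the eigenvalue, `(shift - c) v` lies in the kernel of `γ(-c)` by telescoping. So the
  -- eigencovector takes the value `c l(v) = l(J v)` on the shift of `v`.
  have h1 := h a.1 hroot _ hl (shiftEnd b v + (-a.1) • v) fun j => by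
    rw [factor_shift hm (chain_zero_shiftEnd j v) fun i hi => chain_succ_shiftEnd hi v, hv j,
      mul_zero]
  have h2 := LinearMap.congr_fun hl v
  rw [map_add, map_smul] at h1
  rw [LinearMap.comp_apply, LinearMap.smul_apply] at h2
  change B.coord a (J v) = B.coord a (shiftEnd b v)
  rw [h2, ← sub_eq_zero, ← neg_eq_zero, ← h1, neg_smul]
  abel

/-- Values of the factors at sufficiently different parameters are independent. -/
theorem linearIndependent_factor_points {pts : (Σ j : Fin r, Fin (m j)) → 𝕜}
    (hpts : ∀ j, Function.Injective fun i : Fin (m j) => pts ⟨j, i⟩)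
    (b : Basis (Σ j : Fin r, Fin (m j)) 𝕜 (Dual 𝕜 V)) :
    LinearIndependent 𝕜 fun a => factor b (pts a) a.1 := by
  classical
  -- Different blocks involve different basis vectors, so distinctness is needed, and used, only
  -- inside each block.
  have hM : ∀ j, IsUnit (Matrix.vandermonde fun i : Fin (m j) => pts ⟨j, i⟩).det := fun j =>
    isUnit_iff_ne_zero.2 (Matrix.det_vandermonde_ne_zero_iff.2 (hpts j))
  rw [Fintype.linearIndependent_iff]
  intro g hg
  have h1 : ∀ j (s : Fin (m j)), ∑ i : Fin (m j), g ⟨j, i⟩ * pts ⟨j, i⟩ ^ (s : ℕ) = 0 := by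
    have h2 : ∑ a : (Σ j : Fin r, Fin (m j)),
        (∑ i : Fin (m a.1), g ⟨a.1, i⟩ * pts ⟨a.1, i⟩ ^ (a.2 : ℕ)) • b a = 0 := by
      rw [← hg, Fintype.sum_sigma, Fintype.sum_sigma]
      refine Finset.sum_congr rfl fun j _ => ?_
      simp only [factor, Finset.smul_sum, smul_smul, Finset.sum_smul]
      change ∑ s : Fin (m j), ∑ i : Fin (m j), (g ⟨j, i⟩ * pts ⟨j, i⟩ ^ (s : ℕ)) • b ⟨j, s⟩ =
        ∑ i : Fin (m j), ∑ s : Fin (m j), (g ⟨j, i⟩ * pts ⟨j, i⟩ ^ (s : ℕ)) • b ⟨j, s⟩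
      rw [Finset.sum_comm]
    intro j s
    exact Fintype.linearIndependent_iff (R := 𝕜) (v := b).1 b.linearIndependent _ h2 ⟨j, s⟩
  rintro ⟨j, i⟩
  have h3 : Matrix.vecMul (fun i : Fin (m j) => g ⟨j, i⟩) (Matrix.vandermonde fun i : Fin (m j) => pts ⟨j, i⟩) = 0 := by
    ext s
    exact h1 j s
  have h4 := congrArg (fun v => Matrix.vecMul v (Matrix.vandermonde fun i : Fin (m j) => pts ⟨j, i⟩)⁻¹) h3
  simp only [Matrix.vecMul_vecMul, Matrix.mul_nonsing_inv _ (hM j), Matrix.vecMul_one,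
    Matrix.zero_vecMul] at h4
  exact congrFun h4 i

end Spans

/-! ### Vector fields and brackets in charts. -/

section Charts

variable {𝕜 E N : Type*} [RCLike 𝕜] [NormedAddCommGroup E] [NormedSpace 𝕜 E]
  [FiniteDimensional 𝕜 E] [TopologicalSpace N] [ChartedSpace E N] [IsManifold 𝓘(𝕜, E) ∞ N]
  {F : Type*} [NormedAddCommGroup F] [NormedSpace 𝕜 F]
  {e : OpenPartialHomeomorph N E} {q : N} {U : Set N}

theorem two_le_infty : (2 : WithTop ℕ∞) ≤ ∞ :=
  WithTop.coe_le_coe.2 (le_top : (2 : ℕ∞) ≤ ⊤)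

theorem minSmoothness_two_le_infty : minSmoothness 𝕜 2 ≤ ∞ := by
  rw [minSmoothness_of_isRCLikeNormedField]
  exact two_le_infty

theorem mdifferentiable_of_mem_maximalAtlas (he : e ∈ IsManifold.maximalAtlas 𝓘(𝕜, E) ∞ N) :
    e.MDifferentiable 𝓘(𝕜, E) 𝓘(𝕜, E) :=
  ⟨(contMDiffOn_of_mem_maximalAtlas he).mdifferentiableOn (by simp),
    (contMDiffOn_symm_of_mem_maximalAtlas he).mdifferentiableOn (by simp)⟩

theorem isInvertible_mfderiv_chart (he : e ∈ IsManifold.maximalAtlas 𝓘(𝕜, E) ∞ N)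
    (hq : q ∈ e.source) : (mfderiv 𝓘(𝕜, E) 𝓘(𝕜, E) e q).IsInvertible :=
  ⟨(mdifferentiable_of_mem_maximalAtlas he).mfderiv hq, rfl⟩

theorem mvfderiv_chart_injective (he : e ∈ IsManifold.maximalAtlas 𝓘(𝕜, E) ∞ N)
    (hq : q ∈ e.source) : Function.Injective (mvfderiv 𝓘(𝕜, E) e q) :=
  (mdifferentiable_of_mem_maximalAtlas he).mfderiv_injective hq

variable (𝕜) in
/-- The vector field with given coordinates in a chart. -/
noncomputable def pullField (e : OpenPartialHomeomorph N E) (Y : E → E) : VField 𝕜 E N :=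
  VectorField.mpullback 𝓘(𝕜, E) 𝓘(𝕜, E) e Y

/-- The coordinates of a vector field in a chart. -/
noncomputable def pushField (e : OpenPartialHomeomorph N E) (X : VField 𝕜 E N) : E → E :=
  fun y => mvfderiv 𝓘(𝕜, E) e (e.symm y) (X (e.symm y))

theorem mvfderiv_pullField (he : e ∈ IsManifold.maximalAtlas 𝓘(𝕜, E) ∞ N) (hq : q ∈ e.source)
    (Y : E → E) : mvfderiv 𝓘(𝕜, E) e q (pullField 𝕜 e Y q) = Y (e q) :=
  (isInvertible_mfderiv_chart he hq).self_apply_inverse (Y (e q))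

theorem eq_pullField (he : e ∈ IsManifold.maximalAtlas 𝓘(𝕜, E) ∞ N) (hq : q ∈ e.source)
    {Y : E → E} {v : TangentSpace 𝓘(𝕜, E) q} (h : mvfderiv 𝓘(𝕜, E) e q v = Y (e q)) :
    v = pullField 𝕜 e Y q :=
  mvfderiv_chart_injective he hq (by rw [h, mvfderiv_pullField he hq])

theorem pullField_pushField (he : e ∈ IsManifold.maximalAtlas 𝓘(𝕜, E) ∞ N) (hq : q ∈ e.source)
    (X : VField 𝕜 E N) : pullField 𝕜 e (pushField e X) q = X q := by
  refine (eq_pullField he hq ?_).symm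
  simp only [pushField]
  rw [e.left_inv hq]

theorem SmoothVField.mono {U V : Set N} {X : VField 𝕜 E N} (h : SmoothVField U X) (hV : V ⊆ U) :
    SmoothVField V X := ContMDiffOn.mono h hV

theorem SmoothVField.congr {U : Set N} {X Y : VField 𝕜 E N} (h : SmoothVField U X)
    (hXY : ∀ q ∈ U, Y q = X q) : SmoothVField U Y :=
  ContMDiffOn.congr h fun q hq => by rw [hXY q hq]

theorem SmoothVField.mdifferentiableAt {U : Set N} {X : VField 𝕜 E N} (h : SmoothVField U X)
    (hU : IsOpen U) (hq : q ∈ U) :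
    MDifferentiableAt 𝓘(𝕜, E) 𝓘(𝕜, E).tangent
      (fun q => (⟨q, X q⟩ : TangentBundle 𝓘(𝕜, E) N)) q :=
  (ContMDiffOn.contMDiffAt h (hU.mem_nhds hq)).mdifferentiableAt (by simp)

theorem smoothVField_of_locally {U : Set N} {X : VField 𝕜 E N}
    (h : ∀ q ∈ U, ∃ V, IsOpen V ∧ q ∈ V ∧ SmoothVField V X) : SmoothVField U X := by
  intro q hq
  obtain ⟨V, hV, hqV, hX⟩ := h q hq
  exact (ContMDiffOn.contMDiffAt hX (hV.mem_nhds hqV)).contMDiffWithinAt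

theorem smoothVField_pullField (he : e ∈ IsManifold.maximalAtlas 𝓘(𝕜, E) ∞ N) {V : Set E}
    (hV : IsOpen V) {Y : E → E} (hY : ContDiffOn 𝕜 ∞ Y V) :
    SmoothVField (e.source ∩ e ⁻¹' V) (pullField 𝕜 e Y) := by
  rintro q ⟨hq, hqV⟩
  have h1 : ContMDiffAt 𝓘(𝕜, E) 𝓘(𝕜, E).tangent ∞
      (fun y => (⟨y, Y y⟩ : TangentBundle 𝓘(𝕜, E) E)) (e q) :=
    contMDiffAt_vectorSpace_iff_contDiffAt.2 (hY.contDiffAt (hV.mem_nhds hqV))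
  have _ : CompleteSpace E := FiniteDimensional.complete 𝕜 E
  exact (h1.mpullback_vectorField_preimage (contMDiffAt_of_mem_maximalAtlas he hq)
    (isInvertible_mfderiv_chart he hq) (by simp)).contMDiffWithinAt

/-- The function is the fibre component of the tangent map of `h` applied to the section `X`. -/
theorem contMDiffOn_mvfderiv_apply (hU : IsOpen U) {h : N → F}
    (hh : ContMDiffOn 𝓘(𝕜, E) 𝓘(𝕜, F) ∞ h U) {X : VField 𝕜 E N} (hX : SmoothVField U X) :
    ContMDiffOn 𝓘(𝕜, E) 𝓘(𝕜, F) ∞ (fun q => mvfderiv 𝓘(𝕜, E) h q (X q)) U := by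
  have h1 := hh.contMDiffOn_tangentMapWithin (m := ∞) (by simp) hU.uniqueMDiffOn
  have h2 : ContMDiffOn 𝓘(𝕜, E) 𝓘(𝕜, F).tangent ∞
      (tangentMapWithin 𝓘(𝕜, E) 𝓘(𝕜, F) h U ∘
        fun q => (⟨q, X q⟩ : TangentBundle 𝓘(𝕜, E) N)) U :=
    h1.comp hX fun q hq => hq
  have h3 : ContMDiffOn 𝓘(𝕜, E) 𝓘(𝕜, F).tangent ∞
      (fun q => (⟨h q, mvfderiv 𝓘(𝕜, E) h q (X q)⟩ : TangentBundle 𝓘(𝕜, F) F)) U := by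
    refine h2.congr fun q hq => ?_
    simp only [Function.comp_apply, tangentMapWithin]
    rw [mfderivWithin_of_isOpen hU hq]
    rfl
  intro q hq
  exact ((Bundle.contMDiffWithinAt_totalSpace.1 (h3 q hq)).2).congr (fun y _ => by simp) (by simp)

theorem contMDiffOn_chart (he : e ∈ IsManifold.maximalAtlas 𝓘(𝕜, E) ∞ N) (hU : U ⊆ e.source) :
    ContMDiffOn 𝓘(𝕜, E) 𝓘(𝕜, E) ∞ e U :=
  (contMDiffOn_of_mem_maximalAtlas he).mono hU

theorem contDiffOn_comp_symm (he : e ∈ IsManifold.maximalAtlas 𝓘(𝕜, E) ∞ N) {h : N → F}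
    (hh : ContMDiffOn 𝓘(𝕜, E) 𝓘(𝕜, F) ∞ h U) :
    ContDiffOn 𝕜 ∞ (h ∘ e.symm) (e.target ∩ e.symm ⁻¹' U) :=
  (hh.comp ((contMDiffOn_symm_of_mem_maximalAtlas he).mono Set.inter_subset_left)
    fun _ hy => hy.2).contDiffOn

theorem contMDiffOn_comp_chart (he : e ∈ IsManifold.maximalAtlas 𝓘(𝕜, E) ∞ N) {V : Set E}
    {f : E → F} (hf : ContDiffOn 𝕜 ∞ f V) :
    ContMDiffOn 𝓘(𝕜, E) 𝓘(𝕜, F) ∞ (f ∘ e) (e.source ∩ e ⁻¹' V) :=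
  hf.contMDiffOn.comp ((contMDiffOn_of_mem_maximalAtlas he).mono Set.inter_subset_left)
    fun _ hy => hy.2

theorem contDiffOn_pushField (he : e ∈ IsManifold.maximalAtlas 𝓘(𝕜, E) ∞ N) (hU : IsOpen U)
    (hUe : U ⊆ e.source) {X : VField 𝕜 E N} (hX : SmoothVField U X) :
    ContDiffOn 𝕜 ∞ (pushField e X) (e.target ∩ e.symm ⁻¹' U) :=
  contDiffOn_comp_symm he (contMDiffOn_mvfderiv_apply hU (contMDiffOn_chart he hUe) hX)

theorem mlieBracket_pullField (he : e ∈ IsManifold.maximalAtlas 𝓘(𝕜, E) ∞ N) (hq : q ∈ e.source)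
    {Y Z : E → E} (hY : ContDiffAt 𝕜 ∞ Y (e q)) (hZ : ContDiffAt 𝕜 ∞ Z (e q)) :
    VectorField.mlieBracket 𝓘(𝕜, E) (pullField 𝕜 e Y) (pullField 𝕜 e Z) q =
      pullField 𝕜 e (VectorField.lieBracket 𝕜 Y Z) q := by
  have h1 : ∀ {W : E → E}, ContDiffAt 𝕜 ∞ W (e q) →
      MDifferentiableAt 𝓘(𝕜, E) 𝓘(𝕜, E).tangent
        (fun y => (⟨y, W y⟩ : TangentBundle 𝓘(𝕜, E) E)) (e q) := fun h =>
    (contMDiffAt_vectorSpace_iff_contDiffAt.2 h).mdifferentiableAt (by simp)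
  have _ : CompleteSpace E := FiniteDimensional.complete 𝕜 E
  have _ : IsManifold 𝓘(𝕜, E) (minSmoothness 𝕜 2) N :=
    IsManifold.of_le (n := ∞) minSmoothness_two_le_infty
  have h2 := VectorField.mpullback_mlieBracket (h1 hY) (h1 hZ)
    (contMDiffAt_of_mem_maximalAtlas he hq)
    minSmoothness_two_le_infty
  have h3 : ∀ Y Z : ∀ x : E, TangentSpace 𝓘(𝕜, E) x,
      VectorField.mlieBracket 𝓘(𝕜, E) Y Z = VectorField.lieBracket 𝕜 (E := E) Y Z := fun Y Z => by
    rw [← VectorField.mlieBracketWithin_univ, VectorField.mlieBracketWithin_eq_lieBracketWithin]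
    exact VectorField.lieBracketWithin_univ
  rw [pullField, pullField, ← h2, pullField]
  exact congrArg (fun Z => VectorField.mpullback 𝓘(𝕜, E) 𝓘(𝕜, E) e Z q) (h3 Y Z)

theorem mvfderiv_eq_fderiv_comp_symm (he : e ∈ IsManifold.maximalAtlas 𝓘(𝕜, E) ∞ N)
    (hq : q ∈ e.source) {h : N → F} (hh : MDifferentiableAt 𝓘(𝕜, E) 𝓘(𝕜, F) h q)
    (v : TangentSpace 𝓘(𝕜, E) q) :
    mvfderiv 𝓘(𝕜, E) h q v = fderiv 𝕜 (h ∘ e.symm) (e q) (mvfderiv 𝓘(𝕜, E) e q v) := by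
  have hm := mdifferentiable_of_mem_maximalAtlas he
  have h1 : MDifferentiableAt 𝓘(𝕜, E) 𝓘(𝕜, F) (h ∘ e.symm) (e q) :=
    MDifferentiableAt.comp (I' := 𝓘(𝕜, E)) (e q) (by rw [e.left_inv hq]; exact hh)
      (hm.mdifferentiableAt_symm (e.map_source hq))
  have h2 : h =ᶠ[𝓝 q] (h ∘ e.symm) ∘ e := by
    filter_upwards [e.open_source.mem_nhds hq] with x hx
    simp [e.left_inv hx]
  change mfderiv 𝓘(𝕜, E) 𝓘(𝕜, F) h q v = fderiv 𝕜 (h ∘ e.symm) (e q) (mfderiv 𝓘(𝕜, E) 𝓘(𝕜, E) e q v)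
  rw [h2.mfderiv_eq, mfderiv_comp q h1 (hm.mdifferentiableAt hq), mfderiv_eq_fderiv]
  rfl

/-- In a chart the second derivatives of `h` cancel by symmetry. Vector values allow `h` to be a
chart itself, which reduces identities between brackets to iterated derivatives. -/
theorem mvfderiv_mlieBracket (hU : IsOpen U) (hq : q ∈ U) {h : N → F}
    (hh : ContMDiffOn 𝓘(𝕜, E) 𝓘(𝕜, F) ∞ h U) {X Y : VField 𝕜 E N} (hX : SmoothVField U X)
    (hY : SmoothVField U Y) :
    mvfderiv 𝓘(𝕜, E) h q (VectorField.mlieBracket 𝓘(𝕜, E) X Y q) =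
      mvfderiv 𝓘(𝕜, E) (fun x => mvfderiv 𝓘(𝕜, E) h x (Y x)) q (X q) -
        mvfderiv 𝓘(𝕜, E) (fun x => mvfderiv 𝓘(𝕜, E) h x (X x)) q (Y q) := by
  have he := IsManifold.chart_mem_maximalAtlas (I := 𝓘(𝕜, E)) (n := ∞) q
  set e := chartAt E q
  have hqe : q ∈ e.source := mem_chart_source E q
  let W := U ∩ e.source
  have hW : IsOpen W := hU.inter e.open_source
  let T := e.target ∩ e.symm ⁻¹' W
  have hT : IsOpen T := e.isOpen_inter_preimage_symm hW
  have heT : e q ∈ T := ⟨e.map_source hqe, by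
    rw [Set.mem_preimage, e.left_inv hqe]; exact ⟨hq, hqe⟩⟩
  have hXW := contDiffOn_pushField he hW Set.inter_subset_right (hX.mono Set.inter_subset_left)
  have hYW := contDiffOn_pushField he hW Set.inter_subset_right (hY.mono Set.inter_subset_left)
  have hhW := contDiffOn_comp_symm he (hh.mono (Set.inter_subset_left : W ⊆ U))
  have hX1 := hXW.contDiffAt (hT.mem_nhds heT)
  have hY1 := hYW.contDiffAt (hT.mem_nhds heT)
  have hh1 := hhW.contDiffAt (hT.mem_nhds heT)
  have hloc : ∀ Z : VField 𝕜 E N, Z =ᶠ[𝓝 q] pullField 𝕜 e (pushField e Z) := fun Z => by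
    filter_upwards [e.open_source.mem_nhds hqe] with x hx
    rw [pullField_pushField he hx]
  have hbr : VectorField.mlieBracket 𝓘(𝕜, E) X Y q =
      pullField 𝕜 e (VectorField.lieBracket 𝕜 (pushField e X) (pushField e Y)) q := by
    rw [← mlieBracket_pullField he hqe hX1 hY1]
    exact (hloc X).mlieBracket_vectorField_eq (hloc Y)
  have hder : ∀ Z : VField 𝕜 E N, ContDiffAt 𝕜 ∞ (pushField e Z) (e q) → SmoothVField U Z →
      ∀ v, mvfderiv 𝓘(𝕜, E) (fun x => mvfderiv 𝓘(𝕜, E) h x (Z x)) q v =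
        fderiv 𝕜 (fderiv 𝕜 (h ∘ e.symm)) (e q) (mvfderiv 𝓘(𝕜, E) e q v) (pushField e Z (e q)) +
          fderiv 𝕜 (h ∘ e.symm) (e q)
            (fderiv 𝕜 (pushField e Z) (e q) (mvfderiv 𝓘(𝕜, E) e q v)) := by
    intro Z hZ1 hZ v
    have h1 := contMDiffOn_mvfderiv_apply hU hh hZ
    rw [mvfderiv_eq_fderiv_comp_symm he hqe
      ((h1.contMDiffAt (hU.mem_nhds hq)).mdifferentiableAt (by simp))]
    have h2 : ((fun x => mvfderiv 𝓘(𝕜, E) h x (Z x)) ∘ e.symm) =ᶠ[𝓝 (e q)]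
        fun y => fderiv 𝕜 (h ∘ e.symm) y (pushField e Z y) := by
      filter_upwards [hT.mem_nhds heT] with y hy
      simp only [Function.comp_apply]
      rw [mvfderiv_eq_fderiv_comp_symm he hy.2.2
        ((hh.contMDiffAt (hU.mem_nhds hy.2.1)).mdifferentiableAt (by simp)), e.right_inv hy.1]
      rfl
    rw [h2.fderiv_eq]
    have h3 : DifferentiableAt 𝕜 (fderiv 𝕜 (h ∘ e.symm)) (e q) :=
      (hh1.fderiv_right (m := 1) (one_add_one_eq_two.trans_le two_le_infty)).differentiableAt (by simp)
    rw [fderiv_clm_apply h3 (hZ1.differentiableAt (by simp))]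
    simp [add_comm]
  have hpush : ∀ Z : VField 𝕜 E N, pushField e Z (e q) = mvfderiv 𝓘(𝕜, E) e q (Z q) := fun Z => by
    rw [pushField, e.left_inv hqe]
  have hsymm : IsSymmSndFDerivAt 𝕜 (h ∘ e.symm) (e q) :=
    hh1.isSymmSndFDerivAt minSmoothness_two_le_infty
  rw [hder Y hY1 hY, hder X hX1 hX, hbr, mvfderiv_eq_fderiv_comp_symm he hqe
    ((hh.contMDiffAt (hU.mem_nhds hq)).mdifferentiableAt (by simp)), mvfderiv_pullField he hqe,
    VectorField.lieBracket_eq, hpush, hpush, map_sub, hsymm.eq]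
  simp only [hpush]
  abel

end Charts

/-! ### Exterior derivatives of one-forms and Frobenius on manifolds. -/

section Calculus

variable {𝕜 E N : Type*} [RCLike 𝕜] [NormedAddCommGroup E] [NormedSpace 𝕜 E]
  [FiniteDimensional 𝕜 E] [TopologicalSpace N] [ChartedSpace E N] [IsManifold 𝓘(𝕜, E) ∞ N]
  {e : OpenPartialHomeomorph N E} {q : N} {U A : Set N} {r : ℕ}

theorem SmoothVField.add {X Y : VField 𝕜 E N} (hX : SmoothVField U X) (hY : SmoothVField U Y) :
    SmoothVField U fun q => X q + Y q := ContMDiffOn.add_section hX hY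

theorem SmoothVField.smul {f : N → 𝕜} {X : VField 𝕜 E N}
    (hf : ContMDiffOn 𝓘(𝕜, E) 𝓘(𝕜, 𝕜) ∞ f U) (hX : SmoothVField U X) :
    SmoothVField U fun q => f q • X q := ContMDiffOn.smul_section hf hX

theorem SmoothVField.const_smul (c : 𝕜) {X : VField 𝕜 E N} (hX : SmoothVField U X) :
    SmoothVField U fun q => c • X q := SmoothVField.smul contMDiffOn_const hX

theorem SmoothVField.sum {ι : Type*} (s : Finset ι) {X : ι → VField 𝕜 E N}
    (hX : ∀ i, SmoothVField U (X i)) :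
    SmoothVField U fun q => ∑ i ∈ s, X i q := ContMDiffOn.sum_section fun i _ => hX i

theorem exists_smoothVField_eq (v : TangentSpace 𝓘(𝕜, E) q) :
    ∃ (U : Set N) (X : VField 𝕜 E N), IsOpen U ∧ q ∈ U ∧ SmoothVField U X ∧ X q = v := by
  have he := IsManifold.chart_mem_maximalAtlas (I := 𝓘(𝕜, E)) (n := ∞) q
  refine ⟨(chartAt E q).source, pullField 𝕜 (chartAt E q) fun _ => mvfderiv 𝓘(𝕜, E) (chartAt E q) q v,
    (chartAt E q).open_source, mem_chart_source E q, ?_, ?_⟩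
  · refine (smoothVField_pullField he isOpen_univ contDiffOn_const).mono ?_
    simp
  · exact (eq_pullField he (mem_chart_source E q) (v := v)
      (Y := fun _ => mvfderiv 𝓘(𝕜, E) (chartAt E q) q v) rfl).symm

theorem IsFoliation.exists_section {D : Distribution 𝕜 E N} (hD : IsFoliation r D)
    {v : TangentSpace 𝓘(𝕜, E) q} (hv : v ∈ D q) :
    ∃ (U : Set N) (X : VField 𝕜 E N), IsOpen U ∧ q ∈ U ∧ SmoothVField U X ∧
      (∀ x ∈ U, X x ∈ D x) ∧ X q = v := by
  obtain ⟨U, hU, hqU, d, X, hX, hXD⟩ := hD.smooth q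
  rw [← (hXD q hqU).2] at hv
  obtain ⟨c, hc⟩ := (Submodule.mem_span_range_iff_exists_fun 𝕜).1 hv
  refine ⟨U, fun x => ∑ i, c i • X i x, hU, hqU,
    SmoothVField.sum _ fun i => SmoothVField.const_smul _ (hX i), fun x hx => ?_, hc⟩
  rw [← (hXD x hx).2]
  exact Submodule.sum_mem _ fun i _ => Submodule.smul_mem _ _ (Submodule.subset_span ⟨i, rfl⟩)

theorem mvfderiv_sum_mul {ι : Type*} (s : Finset ι) {f g : ι → N → 𝕜}
    (hf : ∀ i, MDifferentiableAt 𝓘(𝕜, E) 𝓘(𝕜, 𝕜) (f i) q)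
    (hg : ∀ i, MDifferentiableAt 𝓘(𝕜, E) 𝓘(𝕜, 𝕜) (g i) q) (v : TangentSpace 𝓘(𝕜, E) q) :
    MDifferentiableAt 𝓘(𝕜, E) 𝓘(𝕜, 𝕜) (fun x => ∑ i ∈ s, f i x * g i x) q ∧
    mvfderiv 𝓘(𝕜, E) (fun x => ∑ i ∈ s, f i x * g i x) q v =
      ∑ i ∈ s, (f i q * mvfderiv 𝓘(𝕜, E) (g i) q v + g i q * mvfderiv 𝓘(𝕜, E) (f i) q v) := by
  classical
  induction s using Finset.induction_on with
  | empty =>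
    simp only [Finset.sum_empty]
    exact ⟨mdifferentiableAt_const, by rw [mvfderiv_const]; rfl⟩
  | insert i s hi ih =>
    have hm : MDifferentiableAt 𝓘(𝕜, E) 𝓘(𝕜, 𝕜) (fun x => f i x * g i x) q := (hf i).mul (hg i)
    simp only [Finset.sum_insert hi]
    refine ⟨hm.add ih.1, ?_⟩
    rw [mvfderiv_fun_add hm ih.1, _root_.add_apply, ih.2,
      mvfderiv_fun_mul (hf i) (hg i)]
    rfl

theorem mvfderiv_congr {F : Type*} [NormedAddCommGroup F] [NormedSpace 𝕜 F] {f g : N → F}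
    (h : f =ᶠ[𝓝 q] g) :
    mvfderiv 𝓘(𝕜, E) f q = mvfderiv 𝓘(𝕜, E) g q := by
  ext v
  change mfderiv 𝓘(𝕜, E) 𝓘(𝕜, F) f q v = mfderiv 𝓘(𝕜, E) 𝓘(𝕜, F) g q v
  rw [h.mfderiv_eq]
  rfl

/-- The differential of a function. -/
noncomputable def dForm (h : N → 𝕜) : OneForm 𝕜 E N := fun q => (mvfderiv 𝓘(𝕜, E) h q).toLinearMap

theorem dForm_apply (h : N → 𝕜) (v : TangentSpace 𝓘(𝕜, E) q) :
    dForm h q v = mvfderiv 𝓘(𝕜, E) h q v := rfl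

theorem SmoothOneForm.mono {α : OneForm 𝕜 E N} (hα : SmoothOneForm A α) {B : Set N} (hB : B ⊆ A) :
    SmoothOneForm B α := fun U hU => hα U (hU.trans hB)

theorem smoothOneForm_dForm {h : N → 𝕜}
    (hh : ContMDiffOn 𝓘(𝕜, E) 𝓘(𝕜, 𝕜) ∞ h A) : SmoothOneForm A (dForm (E := E) h) :=
  fun _ hUA hU _ hX => contMDiffOn_mvfderiv_apply hU (hh.mono hUA) hX

theorem isClosedOneForm_dForm {h : N → 𝕜}
    (hh : ContMDiffOn 𝓘(𝕜, E) 𝓘(𝕜, 𝕜) ∞ h A) : IsClosedOneForm A (dForm (E := E) h) := by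
  refine ⟨smoothOneForm_dForm hh, fun U hUA hU X Y hX hY q hq _ _ => ?_⟩
  rw [dOneForm]
  simp only [dForm_apply]
  rw [mvfderiv_mlieBracket hU hq (hh.mono hUA) hX hY, sub_self]

theorem mvfderiv_coord_comp_chart (he : e ∈ IsManifold.maximalAtlas 𝓘(𝕜, E) ∞ N)
    (hq : q ∈ e.source) (l : E →L[𝕜] 𝕜) (v : TangentSpace 𝓘(𝕜, E) q) :
    mvfderiv 𝓘(𝕜, E) (l ∘ e) q v = l (mvfderiv 𝓘(𝕜, E) e q v) := by
  have h1 := contMDiffOn_comp_chart he (V := Set.univ) (l.contDiff.contDiffOn (n := ∞))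
  rw [mvfderiv_eq_fderiv_comp_symm he hq ((h1.contMDiffAt ((e.open_source.inter
    (by simp)).mem_nhds ⟨hq, trivial⟩)).mdifferentiableAt (by simp))]
  have h2 : (l ∘ e) ∘ e.symm =ᶠ[𝓝 (e q)] l := by
    filter_upwards [e.open_target.mem_nhds (e.map_source hq)] with y hy
    simp [e.right_inv hy]
  rw [h2.fderiv_eq, l.fderiv]

theorem exists_dual_coordinates (q : N) :
    ∃ (d : ℕ) (W : Set N) (x : Fin d → N → 𝕜) (Z : Fin d → VField 𝕜 E N), IsOpen W ∧ q ∈ W ∧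
      (∀ a, ContMDiffOn 𝓘(𝕜, E) 𝓘(𝕜, 𝕜) ∞ (x a) W) ∧ (∀ a, SmoothVField W (Z a)) ∧
      ∀ y ∈ W, ∃ B : Basis (Fin d) 𝕜 (TangentSpace 𝓘(𝕜, E) y), (∀ a, B a = Z a y) ∧
        ∀ a v, B.coord a v = mvfderiv 𝓘(𝕜, E) (x a) y v := by
  have he := IsManifold.chart_mem_maximalAtlas (I := 𝓘(𝕜, E)) (n := ∞) q
  set e := chartAt E q
  let b := finBasis 𝕜 E
  let l : Fin (finrank 𝕜 E) → E →L[𝕜] 𝕜 := fun a => LinearMap.toContinuousLinearMap (b.coord a)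
  refine ⟨finrank 𝕜 E, e.source, fun a => l a ∘ e, fun a => pullField 𝕜 e fun _ => b a,
    e.open_source, mem_chart_source E q, fun a => ?_, fun a => ?_, fun y hy => ?_⟩
  · exact (contMDiffOn_comp_chart he (V := Set.univ) (l a).contDiff.contDiffOn).mono (by simp)
  · exact (smoothVField_pullField he isOpen_univ contDiffOn_const).mono (by simp)
  · let φ := LinearEquiv.ofBijective (mvfderiv 𝓘(𝕜, E) e y).toLinearMap
      ((mdifferentiable_of_mem_maximalAtlas he).mfderiv_bijective hy)
    refine ⟨b.map φ.symm, fun a => ?_, fun a v => ?_⟩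
    · rw [Basis.map_apply, LinearEquiv.symm_apply_eq]
      exact (mvfderiv_pullField he hy fun _ => b a).symm
    · rw [mvfderiv_coord_comp_chart he hy]
      rfl

/-- Write `α = ∑ α(Z a) dx a`; since the `dx a` are closed, `dα = ∑ d(α(Z a)) ∧ dx a`. The right
side depends only on the values of `X` and `Y` at `q`, which gives tensoriality. -/
theorem dOneForm_eq_of_coordinates {α : OneForm 𝕜 E N} (hα : SmoothOneForm U α) (hU : IsOpen U)
    (hq : q ∈ U) {d : ℕ} {x : Fin d → N → 𝕜} {Z : Fin d → VField 𝕜 E N}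
    (hx : ∀ a, ContMDiffOn 𝓘(𝕜, E) 𝓘(𝕜, 𝕜) ∞ (x a) U) (hZ : ∀ a, SmoothVField U (Z a))
    (hxZ : ∀ y ∈ U, ∀ v : TangentSpace 𝓘(𝕜, E) y, v = ∑ a, mvfderiv 𝓘(𝕜, E) (x a) y v • Z a y)
    {X Y : VField 𝕜 E N} (hX : SmoothVField U X) (hY : SmoothVField U Y) :
    dOneForm α X Y q = ∑ a,
      (mvfderiv 𝓘(𝕜, E) (fun y => α y (Z a y)) q (X q) * mvfderiv 𝓘(𝕜, E) (x a) q (Y q) -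
        mvfderiv 𝓘(𝕜, E) (fun y => α y (Z a y)) q (Y q) * mvfderiv 𝓘(𝕜, E) (x a) q (X q)) := by
  have hexp : ∀ y ∈ U, ∀ v : TangentSpace 𝓘(𝕜, E) y,
      α y v = ∑ a, α y (Z a y) * mvfderiv 𝓘(𝕜, E) (x a) y v := by
    intro y hy v
    conv_lhs => rw [hxZ y hy v]
    rw [map_sum]
    exact Finset.sum_congr rfl fun a _ => by rw [map_smul, smul_eq_mul, mul_comm]
  have hmd : ∀ {f : N → 𝕜}, ContMDiffOn 𝓘(𝕜, E) 𝓘(𝕜, 𝕜) ∞ f U →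
      MDifferentiableAt 𝓘(𝕜, E) 𝓘(𝕜, 𝕜) f q := fun h =>
    (h.contMDiffAt (hU.mem_nhds hq)).mdifferentiableAt (by simp)
  have hder : ∀ {Y : VField 𝕜 E N}, SmoothVField U Y → ∀ v : TangentSpace 𝓘(𝕜, E) q,
      mvfderiv 𝓘(𝕜, E) (fun y => α y (Y y)) q v = ∑ a,
        (α q (Z a q) * mvfderiv 𝓘(𝕜, E) (fun y => mvfderiv 𝓘(𝕜, E) (x a) y (Y y)) q v +
          mvfderiv 𝓘(𝕜, E) (x a) q (Y q) * mvfderiv 𝓘(𝕜, E) (fun y => α y (Z a y)) q v) := by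
    intro Y hY v
    have h1 : (fun y => α y (Y y)) =ᶠ[𝓝 q]
        fun y => ∑ a, α y (Z a y) * mvfderiv 𝓘(𝕜, E) (x a) y (Y y) := by
      filter_upwards [hU.mem_nhds hq] with y hy using hexp y hy _
    rw [mvfderiv_congr h1]
    exact (mvfderiv_sum_mul _ (fun a => hmd (hα U subset_rfl hU _ (hZ a)))
      (fun a => hmd (contMDiffOn_mvfderiv_apply hU (hx a) hY)) v).2
  rw [dOneForm, hder hY, hder hX, hexp q hq (VectorField.mlieBracket 𝓘(𝕜, E) X Y q),
    ← Finset.sum_sub_distrib, ← Finset.sum_sub_distrib]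
  refine Finset.sum_congr rfl fun a _ => ?_
  rw [mvfderiv_mlieBracket hU hq (hx a) hX hY]
  ring

/-- The exterior derivative of a smooth `1`-form is tensorial. -/
theorem exists_bilin_dOneForm {α : OneForm 𝕜 E N} (hα : SmoothOneForm A α) (hA : IsOpen A)
    (hq : q ∈ A) :
    ∃ η : TangentSpace 𝓘(𝕜, E) q →ₗ[𝕜] TangentSpace 𝓘(𝕜, E) q →ₗ[𝕜] 𝕜,
      ∀ U : Set N, IsOpen U → q ∈ U → ∀ X Y : VField 𝕜 E N,
        SmoothVField U X → SmoothVField U Y → dOneForm α X Y q = η (X q) (Y q) := by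
  obtain ⟨d, W, x, Z, hW, hqW, hx, hZ, hB⟩ := exists_dual_coordinates (𝕜 := 𝕜) (E := E) q
  refine ⟨∑ a, (((dForm fun y => α y (Z a y)) q).smulRight (dForm (x a) q) -
    (dForm (x a) q).smulRight ((dForm fun y => α y (Z a y)) q)), fun U hU hqU X Y hX hY => ?_⟩
  have hT : IsOpen (A ∩ (W ∩ U)) := hA.inter (hW.inter hU)
  have hl : A ∩ (W ∩ U) ⊆ A := Set.inter_subset_left
  have hm : A ∩ (W ∩ U) ⊆ W := fun y hy => hy.2.1
  have hr : A ∩ (W ∩ U) ⊆ U := fun y hy => hy.2.2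
  rw [dOneForm_eq_of_coordinates (hα.mono hl) hT ⟨hq, hqW, hqU⟩ (fun a => (hx a).mono hm)
    (fun a => (hZ a).mono hm) (fun y hy v => ?_) (hX.mono hr) (hY.mono hr)]
  · simp only [LinearMap.sum_apply, LinearMap.sub_apply, LinearMap.smulRight_apply,
      LinearMap.smul_apply, smul_eq_mul, dForm_apply]
    exact Finset.sum_congr rfl fun a _ => by ring
  · obtain ⟨B, hBZ, hBx⟩ := hB y hy.2.1
    simp only [← hBZ, ← hBx, Basis.coord_apply]
    exact (B.sum_repr v).symm

theorem exists_smoothVField_eq_pair (v w : TangentSpace 𝓘(𝕜, E) q) :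
    ∃ (U : Set N) (X Y : VField 𝕜 E N), IsOpen U ∧ q ∈ U ∧ SmoothVField U X ∧ SmoothVField U Y ∧
      X q = v ∧ Y q = w := by
  obtain ⟨U, X, hU, hqU, hX, hXv⟩ := exists_smoothVField_eq v
  obtain ⟨V, Y, hV, hqV, hY, hYw⟩ := exists_smoothVField_eq w
  exact ⟨U ∩ V, X, Y, hU.inter hV, ⟨hqU, hqV⟩, hX.mono Set.inter_subset_left,
    hY.mono Set.inter_subset_right, hXv, hYw⟩

theorem dVanishesOn_iff {D : Distribution 𝕜 E N} {α : OneForm 𝕜 E N} (hA : IsOpen A) 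
    {η : ∀ q, TangentSpace 𝓘(𝕜, E) q →ₗ[𝕜] TangentSpace 𝓘(𝕜, E) q →ₗ[𝕜] 𝕜}
    (hη : ∀ q ∈ A, ∀ U : Set N, IsOpen U → q ∈ U → ∀ X Y : VField 𝕜 E N,
        SmoothVField U X → SmoothVField U Y → dOneForm α X Y q = η q (X q) (Y q)) :
    DVanishesOn A D α ↔ ∀ q ∈ A, ∀ v ∈ D q, ∀ w ∈ D q, η q v w = 0 := by
  constructor
  · intro h q hq v hv w hw
    obtain ⟨U, X, Y, hU, hqU, hX, hY, rfl, rfl⟩ := exists_smoothVField_eq_pair v w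
    rw [← hη q hq U hU hqU X Y hX hY]
    exact h (A ∩ U) Set.inter_subset_left (hA.inter hU) X Y (hX.mono Set.inter_subset_right)
      (hY.mono Set.inter_subset_right) q ⟨hq, hqU⟩ hv hw
  · intro h U hUA hU X Y hX hY q hq hv hw
    rw [hη q (hUA hq) U hU hq X Y hX hY]
    exact h q (hUA hq) _ hv _ hw

/-- Every vector of `D` over `A` extends to a smooth local section of `D`. -/
def HasSections (A : Set N) (D : Distribution 𝕜 E N) : Prop :=
  ∀ q ∈ A, ∀ v ∈ D q, ∃ (U : Set N) (X : VField 𝕜 E N), IsOpen U ∧ q ∈ U ∧ SmoothVField U X ∧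
    (∀ x ∈ U, X x ∈ D x) ∧ X q = v

theorem IsFoliation.hasSections {D : Distribution 𝕜 E N} (hD : IsFoliation r D) :
    HasSections A D := fun _ _ _ hv => hD.exists_section hv

/-- The vanishing of the exterior derivative can be tested on sections. -/
theorem dVanishesOn_of_sections {D : Distribution 𝕜 E N} (hD : HasSections A D)
    {α : OneForm 𝕜 E N} (hα : SmoothOneForm A α) (hA : IsOpen A)
    (h : ∀ U ⊆ A, IsOpen U → ∀ X Y : VField 𝕜 E N, SmoothVField U X → SmoothVField U Y →
      (∀ x ∈ U, X x ∈ D x) → (∀ x ∈ U, Y x ∈ D x) → ∀ q ∈ U, dOneForm α X Y q = 0) :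
    DVanishesOn A D α := by
  intro U hUA hU X Y hX hY q hq hXq hYq
  obtain ⟨V, X', hV, hqV, hX', hX'D, hX'q⟩ := hD q (hUA hq) _ hXq
  obtain ⟨W, Y', hW, hqW, hY', hY'D, hY'q⟩ := hD q (hUA hq) _ hYq
  obtain ⟨η, hη⟩ := exists_bilin_dOneForm hα hA (hUA hq)
  have hT : IsOpen (U ∩ (V ∩ W)) := hU.inter (hV.inter hW)
  have hTU : U ∩ (V ∩ W) ⊆ U := Set.inter_subset_left
  have hTV : U ∩ (V ∩ W) ⊆ V := fun x hx => hx.2.1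
  have hTW : U ∩ (V ∩ W) ⊆ W := fun x hx => hx.2.2
  rw [hη U hU hq X Y hX hY, ← hX'q, ← hY'q, ← hη _ hT ⟨hq, hqV, hqW⟩ X' Y' (hX'.mono hTV)
    (hY'.mono hTW)]
  exact h _ (hTU.trans hUA) hT X' Y' (hX'.mono hTV) (hY'.mono hTW) (fun x hx => hX'D x (hTV hx))
    (fun x hx => hY'D x (hTW hx)) q ⟨hq, hqV, hqW⟩

/-- Frobenius' theorem. -/
theorem IsFoliation.exists_firstIntegrals {D : Distribution 𝕜 E N} (hD : IsFoliation r D) (p : N) :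
    ∃ (V : Set N) (h : Fin r → N → 𝕜), IsOpen V ∧ p ∈ V ∧
      (∀ i, ContMDiffOn 𝓘(𝕜, E) 𝓘(𝕜, 𝕜) ∞ (h i) V) ∧
      ∀ q ∈ V, ∀ v, v ∈ D q ↔ ∀ i, mvfderiv 𝓘(𝕜, E) (h i) q v = 0 := by
  obtain ⟨U, hU, hpU, d, X, hX, hXD⟩ := hD.smooth p
  have he := IsManifold.chart_mem_maximalAtlas (I := 𝓘(𝕜, E)) (n := ∞) p
  set e := chartAt E p
  have hpe : p ∈ e.source := mem_chart_source E p
  let W := U ∩ e.source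
  have hW : IsOpen W := hU.inter e.open_source
  let T := e.target ∩ e.symm ⁻¹' W
  have hT : IsOpen T := e.isOpen_inter_preimage_symm hW
  have heT : e p ∈ T := ⟨e.map_source hpe, by
    rw [Set.mem_preimage, e.left_inv hpe]; exact ⟨hpU, hpe⟩⟩
  -- The distribution is transported into the fixed space `E`, so that the base point `e.symm (e q)`
  -- can be replaced by `q` without changing types.
  let D₀ : N → Submodule 𝕜 E := fun q => (D q).map (mvfderiv 𝓘(𝕜, E) e q).toLinearMap
  let D₁ : E → Submodule 𝕜 E := fun y => D₀ (e.symm y)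
  have hmem : ∀ q ∈ e.source, ∀ v : TangentSpace 𝓘(𝕜, E) q,
      v ∈ D q ↔ mvfderiv 𝓘(𝕜, E) e q v ∈ D₀ q := by
    intro q hq v
    refine ⟨fun hv => Submodule.mem_map_of_mem hv, ?_⟩
    rintro ⟨u, hu, huv⟩
    rwa [← mvfderiv_chart_injective he hq huv]
  have hD₁ : ∀ q ∈ e.source, D₁ (e q) = D₀ q := fun q hq => congrArg D₀ (e.left_inv hq)
  have hpull : ∀ (Y : E → E) (q : N), q ∈ e.source →
      (pullField 𝕜 e Y q ∈ D q ↔ Y (e q) ∈ D₁ (e q)) := by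
    intro Y q hq
    rw [hmem q hq, mvfderiv_pullField he hq, hD₁ q hq]
  obtain ⟨V, h, hV, hpV, hVT, hh, hhD⟩ := VeroneseWeb.exists_firstIntegrals hT heT
    (D := D₁) (d := d) (r := r) (X := fun i => pushField e (X i))
    (fun i => contDiffOn_pushField he hW Set.inter_subset_right
      ((hX i).mono Set.inter_subset_left))
    (by
      intro y hy
      obtain ⟨h1, h2⟩ := hXD (e.symm y) hy.2.1
      refine ⟨h1.map' (mvfderiv 𝓘(𝕜, E) e (e.symm y)).toLinearMap
        (LinearMap.ker_eq_bot.2 (mvfderiv_chart_injective he hy.2.2)), ?_⟩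
      simp only [D₁, D₀]
      rw [← h2, Submodule.map_span, ← Set.range_comp]
      rfl)
    (by
      have h1 := hD.codim p
      have h2 := (D p).finrank_quotient_add_finrank
      have h3 := (D₀ p).finrank_quotient_add_finrank
      have h4 : finrank 𝕜 (D₀ p) = finrank 𝕜 (D p) :=
        (Submodule.equivMapOfInjective _ (mvfderiv_chart_injective he hpe) (D p)).finrank_eq.symm
      rw [hD₁ p hpe]
      change _ = finrank 𝕜 E at h2
      omega)
    (by
      intro V hVT hV Y Z hY hZ hYD hZD y hy
      have hyt : y ∈ e.target := (hVT hy).1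
      have hye : e.symm y ∈ e.source := e.map_target hyt
      have h1 := hD.involutive (e.source ∩ e ⁻¹' V) (e.isOpen_inter_preimage hV) _ _
        (smoothVField_pullField he hV hY) (smoothVField_pullField he hV hZ)
        (fun q hq => (hpull Y q hq.1).2 (hYD _ hq.2))
        (fun q hq => (hpull Z q hq.1).2 (hZD _ hq.2)) (e.symm y)
        ⟨hye, by rwa [Set.mem_preimage, e.right_inv hyt]⟩
      have h2 : e (e.symm y) = y := e.right_inv hyt
      rw [mlieBracket_pullField he hye (by rw [h2]; exact hY.contDiffAt (hV.mem_nhds hy))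
        (by rw [h2]; exact hZ.contDiffAt (hV.mem_nhds hy)), hpull _ _ hye, h2] at h1
      exact h1)
  refine ⟨e.source ∩ e ⁻¹' V, fun i => h i ∘ e, e.isOpen_inter_preimage hV, ⟨hpe, hpV⟩,
    fun i => contMDiffOn_comp_chart he (hh i), fun q hq v => ?_⟩
  rw [hmem q hq.1, ← hD₁ q hq.1, hhD _ hq.2]
  refine forall_congr' fun i => ?_
  rw [mvfderiv_eq_fderiv_comp_symm he hq.1 (((contMDiffOn_comp_chart he (hh i)).contMDiffAt
    ((e.isOpen_inter_preimage hV).mem_nhds hq)).mdifferentiableAt (by simp))]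
  have h2 : (h i ∘ e) ∘ e.symm =ᶠ[𝓝 (e q)] h i := by
    filter_upwards [e.open_target.mem_nhds (e.map_source hq.1)] with y hy
    simp [e.right_inv hy]
  rw [h2.fderiv_eq]

end Calculus

/-! ### Tensor fields: inverses, and fields diagonal in a chart. -/

section Tensors

variable {𝕜 E N : Type*} [RCLike 𝕜] [NormedAddCommGroup E] [NormedSpace 𝕜 E]
  [FiniteDimensional 𝕜 E] [TopologicalSpace N] [ChartedSpace E N] [IsManifold 𝓘(𝕜, E) ∞ N]
  {e : OpenPartialHomeomorph N E} {p q : N} {U A : Set N} {r : ℕ}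

theorem linearIndependent_of_codim {V : Type*} [AddCommGroup V] [Module 𝕜 V]
    [FiniteDimensional 𝕜 V] {D : Submodule 𝕜 V} {l : Fin r → Dual 𝕜 V}
    (hD : finrank 𝕜 (V ⧸ D) = r) (hl : ∀ v, v ∈ D ↔ ∀ i, l i v = 0) : LinearIndependent 𝕜 l := by
  have hker : LinearMap.ker (LinearMap.pi l) = D := by
    ext v
    rw [LinearMap.mem_ker, hl, funext_iff]
    rfl
  have hrange : LinearMap.range (LinearMap.pi l) = ⊤ := by
    apply Submodule.eq_top_of_finrank_eq
    rw [← (LinearMap.quotKerEquivRange (LinearMap.pi l)).finrank_eq, hker, hD]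
    simp
  rw [Fintype.linearIndependent_iff]
  intro g hg i
  obtain ⟨v, hv⟩ := LinearMap.range_eq_top.1 hrange (Pi.single i 1)
  have h1 := LinearMap.congr_fun hg v
  have h2 : ∀ j, l j v = (Pi.single i 1 : Fin r → 𝕜) j := fun j => congrFun hv j
  simpa [LinearMap.sum_apply, h2, Pi.single_apply] using h1

theorem contMDiffOn_matrix_det {d : ℕ} {M : N → Matrix (Fin d) (Fin d) 𝕜}
    (h : ∀ i j, ContMDiffOn 𝓘(𝕜, E) 𝓘(𝕜, 𝕜) ∞ (fun q => M q i j) U) :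
    ContMDiffOn 𝓘(𝕜, E) 𝓘(𝕜, 𝕜) ∞ (fun q => (M q).det) U := by
  simp only [Matrix.det_apply']
  exact contMDiffOn_finsetSum fun σ _ => contMDiffOn_const.mul
    (contMDiffOn_finsetProd fun i _ => h _ _)

theorem SmoothTensor11.mono {J : Tensor11 𝕜 E N} (hJ : SmoothTensor11 A J) {B : Set N}
    (hB : B ⊆ A) : SmoothTensor11 B J := fun U hU => hJ U (hU.trans hB)

/-- The tensor field `J + t I`. -/
noncomputable abbrev shiftTensor (J : Tensor11 𝕜 E N) (t : 𝕜) : Tensor11 𝕜 E N :=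
  fun q => J q + t • (1 : End 𝕜 (TangentSpace 𝓘(𝕜, E) q))

theorem SmoothTensor11.shiftTensor {J : Tensor11 𝕜 E N} (hJ : SmoothTensor11 A J) (t : 𝕜) :
    SmoothTensor11 A (shiftTensor J t) :=
  fun U hUA hU X hX => (hJ U hUA hU X hX).add (hX.const_smul t)

theorem contMDiffOn_of_locally {f : N → 𝕜}
    (h : ∀ q ∈ U, ∃ V, IsOpen V ∧ q ∈ V ∧ ContMDiffOn 𝓘(𝕜, E) 𝓘(𝕜, 𝕜) ∞ f V) :
    ContMDiffOn 𝓘(𝕜, E) 𝓘(𝕜, 𝕜) ∞ f U := by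
  intro q hq
  obtain ⟨V, hV, hqV, hf⟩ := h q hq
  exact (hf.contMDiffAt (hV.mem_nhds hqV)).contMDiffWithinAt

theorem SmoothTensor11.contMDiffOn_det {J : Tensor11 𝕜 E N} (hJ : SmoothTensor11 A J)
    (hA : IsOpen A) :
    ContMDiffOn 𝓘(𝕜, E) 𝓘(𝕜, 𝕜) ∞ (fun q => LinearMap.det (J q)) A := by
  refine contMDiffOn_of_locally fun q hq => ?_
  obtain ⟨d, W, x, Z, hW, hqW, hx, hZ, hB⟩ := exists_dual_coordinates (𝕜 := 𝕜) (E := E) q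
  refine ⟨A ∩ W, hA.inter hW, ⟨hq, hqW⟩, ?_⟩
  have h1 : ContMDiffOn 𝓘(𝕜, E) 𝓘(𝕜, 𝕜) ∞ (fun y => (Matrix.of fun a c =>
      mvfderiv 𝓘(𝕜, E) (x a) y (J y (Z c y))).det) (A ∩ W) :=
    contMDiffOn_matrix_det fun a c => contMDiffOn_mvfderiv_apply (hA.inter hW)
      ((hx a).mono Set.inter_subset_right) (hJ _ Set.inter_subset_left (hA.inter hW) _
        ((hZ c).mono Set.inter_subset_right))
  refine h1.congr fun y hy => ?_
  obtain ⟨B, hBZ, hBx⟩ := hB y hy.2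
  rw [← LinearMap.det_toMatrix B]
  congr 1
  ext a c
  rw [LinearMap.toMatrix_apply, Matrix.of_apply, hBZ, ← hBx]
  rfl

/-- In dual coordinates the inverse matrix is the adjugate divided by the determinant, by Cramer's
rule, so its entries are smooth. -/
theorem SmoothTensor11.inverse {J : Tensor11 𝕜 E N} (hJ : SmoothTensor11 A J)
    (hunit : ∀ q ∈ A, IsUnit (J q)) : SmoothTensor11 A fun q => Ring.inverse (J q) := by
  intro U hUA hU X hX
  refine smoothVField_of_locally fun q hq => ?_
  obtain ⟨d, W, x, Z, hW, hqW, hx, hZ, hB⟩ := exists_dual_coordinates (𝕜 := 𝕜) (E := E) q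
  have hUW := hU.inter hW
  refine ⟨U ∩ W, hUW, ⟨hq, hqW⟩, ?_⟩
  let M : N → Matrix (Fin d) (Fin d) 𝕜 := fun y =>
    Matrix.of fun a c => mvfderiv 𝓘(𝕜, E) (x a) y (J y (Z c y))
  have hMs : ∀ a c, ContMDiffOn 𝓘(𝕜, E) 𝓘(𝕜, 𝕜) ∞ (fun y => M y a c) (U ∩ W) := fun a c =>
    contMDiffOn_mvfderiv_apply hUW ((hx a).mono Set.inter_subset_right)
      (hJ _ (Set.inter_subset_left.trans hUA) hUW _ ((hZ c).mono Set.inter_subset_right))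
  have hMJ : ∀ y ∈ U ∩ W, ∀ B : Basis (Fin d) 𝕜 (TangentSpace 𝓘(𝕜, E) y), (∀ a, B a = Z a y) →
      (∀ a v, B.coord a v = mvfderiv 𝓘(𝕜, E) (x a) y v) → M y = LinearMap.toMatrix B B (J y) := by
    intro y hy B hBZ hBx
    ext a c
    rw [LinearMap.toMatrix_apply, hBZ]
    exact (hBx a _).symm
  have hdet : ∀ y ∈ U ∩ W, (M y).det ≠ 0 := by
    intro y hy
    obtain ⟨B, hBZ, hBx⟩ := hB y hy.2
    rw [hMJ y hy B hBZ hBx, LinearMap.det_toMatrix]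
    exact ((hunit y (hUA hy.1)).map LinearMap.det).ne_zero
  have hadj : ∀ a c, ContMDiffOn 𝓘(𝕜, E) 𝓘(𝕜, 𝕜) ∞ (fun y => (M y).adjugate a c) (U ∩ W) := by
    intro a c
    simp only [Matrix.adjugate_apply]
    refine contMDiffOn_matrix_det fun i j => ?_
    by_cases hi : i = c
    · subst hi
      simp only [Matrix.updateRow_self]
      exact contMDiffOn_const
    · simp only [Matrix.updateRow_ne hi]
      exact hMs i j
  have hsm : SmoothVField (U ∩ W) fun y => ∑ a, (∑ c, (M y).det⁻¹ * (M y).adjugate a c *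
      mvfderiv 𝓘(𝕜, E) (x c) y (X y)) • Z a y := by
    refine SmoothVField.sum _ fun a => SmoothVField.smul ?_ ((hZ a).mono Set.inter_subset_right)
    refine contMDiffOn_finsetSum fun c _ => ContMDiffOn.mul (ContMDiffOn.mul ?_ (hadj a c)) ?_
    · exact (contMDiffOn_matrix_det hMs).inv₀ hdet
    · exact contMDiffOn_mvfderiv_apply hUW ((hx c).mono Set.inter_subset_right)
        (hX.mono Set.inter_subset_left)
  refine hsm.congr fun y hy => ?_
  obtain ⟨B, hBZ, hBx⟩ := hB y hy.2
  have hu := hunit y (hUA hy.1)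
  set Y := Ring.inverse (J y) (X y) with hY
  have hJY : J y Y = X y := by
    rw [hY, ← Module.End.mul_apply, Ring.mul_inverse_cancel _ hu]
    rfl
  have h1 : (M y).mulVec (B.repr Y) = B.repr (X y) := by
    rw [hMJ y hy B hBZ hBx, LinearMap.toMatrix_mulVec_repr, hJY]
  have h2 : (B.repr Y : Fin d → 𝕜) = (M y)⁻¹.mulVec (B.repr (X y)) := by
    rw [← h1, Matrix.mulVec_mulVec, Matrix.nonsing_inv_mul _ (isUnit_iff_ne_zero.2 (hdet y hy)),
      Matrix.one_mulVec]
  rw [← B.sum_repr Y]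
  refine Finset.sum_congr rfl fun a _ => ?_
  rw [hBZ, h2, Matrix.inv_def, Matrix.mulVec, dotProduct]
  congr 1
  refine Finset.sum_congr rfl fun c _ => ?_
  rw [← hBx, Ring.inverse_eq_inv', Matrix.smul_apply, smul_eq_mul]
  rfl

/-- Functions with independent differentials are the coordinates of a chart. -/
theorem exists_chart_of_linearIndependent {ι : Type*} [Fintype ι] (b : Basis ι 𝕜 E)
    {V : Set N} (hV : IsOpen V) (hp : p ∈ V) {h : ι → N → 𝕜}
    (hh : ∀ a, ContMDiffOn 𝓘(𝕜, E) 𝓘(𝕜, 𝕜) ∞ (h a) V)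
    (hli : ∀ v : TangentSpace 𝓘(𝕜, E) p, (∀ a, mvfderiv 𝓘(𝕜, E) (h a) p v = 0) → v = 0) :
    ∃ e ∈ IsManifold.maximalAtlas 𝓘(𝕜, E) ∞ N, p ∈ e.source ∧ e.source ⊆ V ∧
      ∀ q ∈ e.source, ∀ a, ∀ v : TangentSpace 𝓘(𝕜, E) q,
        b.coord a (mvfderiv 𝓘(𝕜, E) e q v) = mvfderiv 𝓘(𝕜, E) (h a) q v := by
  have hκ := IsManifold.chart_mem_maximalAtlas (I := 𝓘(𝕜, E)) (n := ∞) p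
  set κ := chartAt E p
  have hpκ : p ∈ κ.source := mem_chart_source E p
  have _ : CompleteSpace E := FiniteDimensional.complete 𝕜 E
  let Φ : (ι → 𝕜) ≃L[𝕜] E := b.equivFun.symm.toContinuousLinearEquiv
  let T := κ.target ∩ κ.symm ⁻¹' V
  have hT : IsOpen T := κ.isOpen_inter_preimage_symm hV
  have hpT : κ p ∈ T := ⟨κ.map_source hpκ, by rwa [Set.mem_preimage, κ.left_inv hpκ]⟩
  let G : E → E := fun y => Φ fun a => (h a ∘ κ.symm) y
  have hhT : ∀ a, ContDiffOn 𝕜 ∞ (h a ∘ κ.symm) T := fun a => contDiffOn_comp_symm hκ (hh a)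
  have hG : ContDiffOn 𝕜 ∞ G T := Φ.contDiff.comp_contDiffOn (contDiffOn_pi.2 hhT)
  let G' : E →L[𝕜] E := (Φ : (ι → 𝕜) →L[𝕜] E).comp
    (ContinuousLinearMap.pi fun a => fderiv 𝕜 (h a ∘ κ.symm) (κ p))
  have hG' : HasFDerivAt G G' (κ p) :=
    (Φ : (ι → 𝕜) →L[𝕜] E).hasFDerivAt.comp (κ p) (hasFDerivAt_pi.2 fun a =>
      (((hhT a).contDiffAt (hT.mem_nhds hpT)).differentiableAt (by simp)).hasFDerivAt)
  have hinj : Function.Injective G' := by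
    rw [injective_iff_map_eq_zero]
    intro w hw
    obtain ⟨v, rfl⟩ := (mdifferentiable_of_mem_maximalAtlas hκ).mfderiv_surjective hpκ w
    have h0 : v = 0 := by
      refine hli v fun a => ?_
      rw [mvfderiv_eq_fderiv_comp_symm hκ hpκ (((hh a).contMDiffAt
        (hV.mem_nhds hp)).mdifferentiableAt (by simp))]
      exact congrFun (Φ.map_eq_zero_iff.1 hw) a
    rw [h0, map_zero]
    rfl
  let G₁ : E ≃L[𝕜] E := (LinearEquiv.ofInjectiveEndo G'.toLinearMap hinj).toContinuousLinearEquiv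
  obtain ⟨φ, hpφ, hφT, hφG, hφs⟩ := exists_smooth_localInverse hT hG hpT (f' := G₁)
    (by convert! hG')
  let e := κ.trans φ
  have hes : e.source ⊆ κ.source ∩ κ ⁻¹' φ.source := (κ.trans_source φ).subset
  have hsV : e.source ⊆ V := fun q hq => by
    have := (hφT (hes hq).2).2
    rwa [Set.mem_preimage, κ.left_inv (hes hq).1] at this
  have heG : ∀ q ∈ e.source, e q = Φ fun a => h a q := by
    intro q hq
    change φ (κ q) = _
    rw [hφG]
    simp only [G, Function.comp_apply, κ.left_inv (hes hq).1]
  have he : e ∈ IsManifold.maximalAtlas 𝓘(𝕜, E) ∞ N := by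
    apply OpenPartialHomeomorph.mem_maximalAtlas_of_contMDiffOn
    · have h1 : ContMDiffOn 𝓘(𝕜, E) 𝓘(𝕜, E) ∞ (G ∘ κ) (κ.source ∩ κ ⁻¹' T) :=
        contMDiffOn_comp_chart hκ hG
      refine (h1.mono fun q hq => ⟨(hes hq).1, hφT (hes hq).2⟩).congr fun q hq => ?_
      exact hφG _
    · have h1 : ContMDiffOn 𝓘(𝕜, E) 𝓘(𝕜, E) ∞ (κ.symm ∘ φ.symm) e.target := by
        refine (contMDiffOn_symm_of_mem_maximalAtlas hκ).comp
          (hφs.contMDiffOn.mono ?_) ?_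
        · rw [κ.trans_target φ]
          exact Set.inter_subset_left
        · intro y hy
          rw [κ.trans_target φ] at hy
          exact hy.2
      exact h1
  refine ⟨e, he, ?_, hsV, fun q hq a v => ?_⟩
  · rw [κ.trans_source φ]
    exact ⟨hpκ, hpφ⟩
  · have h1 := mvfderiv_coord_comp_chart he hq (LinearMap.toContinuousLinearMap (b.coord a)) v
    rw [LinearMap.coe_toContinuousLinearMap'] at h1
    rw [← h1]
    refine DFunLike.congr_fun (mvfderiv_congr ?_) v
    filter_upwards [e.open_source.mem_nhds hq] with y hy
    rw [Function.comp_apply, heG y hy]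
    exact congrFun (b.equivFun.apply_symm_apply fun a => h a y) a

/-- The tensor field which is diagonal in a chart. -/
noncomputable def chartTensor (e : OpenPartialHomeomorph N E) (L : End 𝕜 E) : Tensor11 𝕜 E N :=
  fun q => (mfderiv 𝓘(𝕜, E) 𝓘(𝕜, E) e q).inverse.toLinearMap ∘ₗ L ∘ₗ
    (mvfderiv 𝓘(𝕜, E) e q).toLinearMap

theorem mvfderiv_chartTensor (he : e ∈ IsManifold.maximalAtlas 𝓘(𝕜, E) ∞ N) (hq : q ∈ e.source)
    (L : End 𝕜 E) (v : TangentSpace 𝓘(𝕜, E) q) :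
    mvfderiv 𝓘(𝕜, E) e q (chartTensor e L q v) = L (mvfderiv 𝓘(𝕜, E) e q v) :=
  (isInvertible_mfderiv_chart he hq).self_apply_inverse (L (mvfderiv 𝓘(𝕜, E) e q v))

theorem smoothTensor11_chartTensor (he : e ∈ IsManifold.maximalAtlas 𝓘(𝕜, E) ∞ N) (L : End 𝕜 E) :
    SmoothTensor11 e.source (chartTensor e L) := by
  intro U hUe hU X hX
  have h1 := contDiffOn_pushField he hU hUe hX
  have h2 : ContDiffOn 𝕜 ∞ (fun y => L (pushField e X y)) (e.target ∩ e.symm ⁻¹' U) :=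
    (LinearMap.toContinuousLinearMap L).contDiff.comp_contDiffOn h1
  have h3 := smoothVField_pullField he (e.isOpen_inter_preimage_symm hU) h2
  refine (h3.mono fun q hq => ⟨hUe hq, e.map_source (hUe hq), by
    rwa [Set.mem_preimage, e.left_inv (hUe hq)]⟩).congr fun q hq => ?_
  apply eq_pullField he (hUe hq)
  rw [mvfderiv_chartTensor he (hUe hq), pushField, e.left_inv (hUe hq)]

theorem chartTensor_eq_conj (he : e ∈ IsManifold.maximalAtlas 𝓘(𝕜, E) ∞ N) (hq : q ∈ e.source)
    (L : End 𝕜 E) : ∃ φ : TangentSpace 𝓘(𝕜, E) q ≃ₗ[𝕜] E,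
      (∀ v, φ v = mvfderiv 𝓘(𝕜, E) e q v) ∧ chartTensor e L q = φ.symm.conj L := by
  let φ := LinearEquiv.ofBijective (mvfderiv 𝓘(𝕜, E) e q).toLinearMap
      ((mdifferentiable_of_mem_maximalAtlas he).mfderiv_bijective hq)
  refine ⟨φ, fun v => rfl, LinearMap.ext fun v => φ.injective ?_⟩
  rw [LinearEquiv.conj_apply_apply, LinearEquiv.symm_symm, φ.apply_symm_apply]
  exact mvfderiv_chartTensor he hq L v

theorem isFlatOn_chartTensor (he : e ∈ IsManifold.maximalAtlas 𝓘(𝕜, E) ∞ N) (L : End 𝕜 E) :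
    IsFlatOn e.source (chartTensor e L) := fun _ hp =>
  ⟨e, he, hp, subset_rfl, L, fun _ hq v => mvfderiv_chartTensor he hq L v⟩

theorem charpoly_of_eigenbasis {ι V : Type*} [Fintype ι] [AddCommGroup V] [Module 𝕜 V]
    [FiniteDimensional 𝕜 V] (b : Basis ι 𝕜 V) {L : End 𝕜 V} {c : ι → 𝕜}
    (hL : ∀ a, L (b a) = c a • b a) :
    L.charpoly = ∏ a, (Polynomial.X - Polynomial.C (c a)) := by
  classical
  have h : LinearMap.toMatrix b b L = Matrix.diagonal c := by
    ext i j
    rw [LinearMap.toMatrix_apply, hL, map_smul, Finsupp.smul_apply, Basis.repr_self,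
      Finsupp.single_apply, Matrix.diagonal_apply, smul_eq_mul]
    by_cases hij : i = j
    · simp [hij]
    · simp [hij, Ne.symm hij]
  rw [← LinearMap.charpoly_toMatrix L b, h, Matrix.charpoly_diagonal]

theorem iSup_eigenspace_of_eigenbasis {ι V : Type*} [AddCommGroup V] [Module 𝕜 V]
    (b : Basis ι 𝕜 V) {L : End 𝕜 V} {c : ι → 𝕜} (hL : ∀ a, L (b a) = c a • b a) :
    ⨆ μ : 𝕜, L.eigenspace μ = ⊤ := by
  rw [eq_top_iff, ← b.span_eq, Submodule.span_le]
  rintro _ ⟨a, rfl⟩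
  exact Submodule.mem_iSup_of_mem (c a) (Module.End.mem_eigenspace_iff.2 (hL a))

end Tensors

/-! ### Torsion, brackets and closedness. -/

section Brackets

variable {𝕜 E N : Type*} [RCLike 𝕜] [NormedAddCommGroup E] [NormedSpace 𝕜 E]
  [FiniteDimensional 𝕜 E] [TopologicalSpace N] [ChartedSpace E N] [IsManifold 𝓘(𝕜, E) ∞ N]
  {p q : N} {U A : Set N} {r : ℕ} {J : Tensor11 𝕜 E N}

theorem SmoothOneForm.compTensor {α : OneForm 𝕜 E N} (hα : SmoothOneForm A α)
    (hJ : SmoothTensor11 A J) : SmoothOneForm A (compTensor α J) :=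
  fun U hUA hU X hX => hα U hUA hU _ (hJ U hUA hU X hX)

/-- The failure of `J` to be compatible with the bracket of two vector fields. -/
noncomputable def bracketDefect (J : Tensor11 𝕜 E N) (X Y : VField 𝕜 E N) : VField 𝕜 E N :=
  fun q => VectorField.mlieBracket 𝓘(𝕜, E) X (fun x => J x (Y x)) q +
    VectorField.mlieBracket 𝓘(𝕜, E) (fun x => J x (X x)) Y q -
    J q (VectorField.mlieBracket 𝓘(𝕜, E) X Y q)

theorem mvfderiv_apply_eq_zero (hU : IsOpen U) (hq : q ∈ U) {f : N → 𝕜} (hf : ∀ x ∈ U, f x = 0)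
    (v : TangentSpace 𝓘(𝕜, E) q) : mvfderiv 𝓘(𝕜, E) f q v = 0 := by
  have h : f =ᶠ[𝓝 q] fun _ => 0 := by
    filter_upwards [hU.mem_nhds hq] with x hx using hf x hx
  rw [mvfderiv_congr h, mvfderiv_const]
  rfl

theorem dOneForm_eq_neg_of_eq_zero (hU : IsOpen U) (hq : q ∈ U) {α : OneForm 𝕜 E N}
    {X Y : VField 𝕜 E N} (hX : ∀ x ∈ U, α x (X x) = 0) (hY : ∀ x ∈ U, α x (Y x) = 0) :
    dOneForm α X Y q = -α q (VectorField.mlieBracket 𝓘(𝕜, E) X Y q) := by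
  rw [dOneForm, mvfderiv_apply_eq_zero hU hq hX, mvfderiv_apply_eq_zero hU hq hY, sub_zero,
    zero_sub]

/-- Add the two identities `dα(X, JY) = 0` and `dα(JX, Y) = 0`, in which the terms differentiating
`α(X)` and `α(Y)` drop out. -/
theorem dOneForm_compTensor (hU : IsOpen U) (hq : q ∈ U) (hJ : SmoothTensor11 U J)
    {α : OneForm 𝕜 E N} (hα : IsClosedOneForm U α) {X Y : VField 𝕜 E N} (hX : SmoothVField U X)
    (hY : SmoothVField U Y) (hαX : ∀ x ∈ U, α x (X x) = 0) (hαY : ∀ x ∈ U, α x (Y x) = 0) :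
    dOneForm (compTensor α J) X Y q = α q (bracketDefect J X Y q) := by
  have h1 := hα.2 U subset_rfl hU X _ hX (hJ U subset_rfl hU Y hY) q hq trivial trivial
  have h2 := hα.2 U subset_rfl hU _ Y (hJ U subset_rfl hU X hX) hY q hq trivial trivial
  rw [dOneForm, mvfderiv_apply_eq_zero hU hq hαX] at h1
  rw [dOneForm, mvfderiv_apply_eq_zero hU hq hαY] at h2
  rw [dOneForm, bracketDefect, map_sub, map_add]
  simp only [LinearMap.comp_apply] at h1 h2 ⊢
  linear_combination h1 + h2

/-- With `B` the defect, vanishing torsion says `[JX, JY] = J B`, and `[X, JY] + [JX, Y] = B + J[X,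
Y]` by definition. Expanding in powers of `t`, the bracket is `J B + t (B + J[X, Y]) + t² [X, Y]`,
which factors through `J + t`. Torsion is needed only on this pair at `q`, so the identity also
serves when it vanishes merely along a foliation. -/
theorem mlieBracket_add_smul (hU : IsOpen U) (hq : q ∈ U) (hJ : SmoothTensor11 U J)
    {X Y : VField 𝕜 E N} (hX : SmoothVField U X) (hY : SmoothVField U Y)
    (hJXY : nijenhuis J X Y q = 0) (t : 𝕜) :
    VectorField.mlieBracket 𝓘(𝕜, E) (fun x => shiftTensor J t x (X x))
        (fun x => shiftTensor J t x (Y x)) q =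
      shiftTensor J t q
        (bracketDefect J X Y q + t • VectorField.mlieBracket 𝓘(𝕜, E) X Y q) := by
  have _ : CompleteSpace E := FiniteDimensional.complete 𝕜 E
  have _ : IsManifold 𝓘(𝕜, E) (minSmoothness 𝕜 2) N :=
    IsManifold.of_le (n := ∞) minSmoothness_two_le_infty
  have hJX := hJ U subset_rfl hU X hX
  have hJY := hJ U subset_rfl hU Y hY
  have d := fun {Z : VField 𝕜 E N} (hZ : SmoothVField U Z) => hZ.mdifferentiableAt hU hq
  have e1 : (fun x => shiftTensor J t x (X x)) = (fun x => J x (X x)) + t • X := rfl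
  have e2 : (fun x => shiftTensor J t x (Y x)) = (fun x => J x (Y x)) + t • Y := rfl
  have dX : MDifferentiableAt 𝓘(𝕜, E) 𝓘(𝕜, E).tangent
      (fun q => (⟨q, (t • X) q⟩ : TangentBundle 𝓘(𝕜, E) N)) q := d (hX.const_smul t)
  have dY : MDifferentiableAt 𝓘(𝕜, E) 𝓘(𝕜, E).tangent
      (fun q => (⟨q, (t • Y) q⟩ : TangentBundle 𝓘(𝕜, E) N)) q := d (hY.const_smul t)
  have dsum : MDifferentiableAt 𝓘(𝕜, E) 𝓘(𝕜, E).tangent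
      (fun q => (⟨q, ((fun x => J x (Y x)) + t • Y) q⟩ : TangentBundle 𝓘(𝕜, E) N)) q :=
    d (hJY.add (hY.const_smul t))
  rw [e1, e2, VectorField.mlieBracket_add_left (d hJX) dX,
    VectorField.mlieBracket_add_right (d hJY) dY, VectorField.mlieBracket_add_right (d hJY) dY,
    VectorField.mlieBracket_const_smul_left (d hX), VectorField.mlieBracket_const_smul_right (d hY),
    VectorField.mlieBracket_const_smul_left (d hX), VectorField.mlieBracket_const_smul_right (d hY)]
  have h0 := hJXY
  rw [nijenhuis, sub_eq_zero, sub_eq_iff_eq_add, ← eq_sub_iff_add_eq] at h0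
  rw [h0, bracketDefect]
  simp only [LinearMap.add_apply, LinearMap.smul_apply, Module.End.one_apply, map_add, map_sub,
    map_smul, smul_add]
  abel

theorem mvfderiv_clm_comp {F G : Type*} [NormedAddCommGroup F] [NormedSpace 𝕜 F]
    [NormedAddCommGroup G] [NormedSpace 𝕜 G] (L : F →L[𝕜] G) {g : N → F}
    (hg : MDifferentiableAt 𝓘(𝕜, E) 𝓘(𝕜, F) g q) (v : TangentSpace 𝓘(𝕜, E) q) :
    mvfderiv 𝓘(𝕜, E) (fun x => L (g x)) q v = L (mvfderiv 𝓘(𝕜, E) g q v) := by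
  have h := mfderiv_comp (I' := 𝓘(𝕜, F)) q (L.mdifferentiableAt (x := g q)) hg
  change mfderiv 𝓘(𝕜, E) 𝓘(𝕜, G) (L ∘ g) q v = L (mfderiv 𝓘(𝕜, E) 𝓘(𝕜, F) g q v)
  rw [h, mfderiv_eq_fderiv, L.fderiv]
  rfl

/-- In a flat chart `J` is a constant matrix, which commutes with differentiating coordinates; the
four brackets then cancel. -/
theorem nijenhuis_eq_zero_of_isFlatOn (hJ : SmoothTensor11 A J) (hf : IsFlatOn A J)
    (hUA : U ⊆ A) (hU : IsOpen U) {X Y : VField 𝕜 E N} (hX : SmoothVField U X)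
    (hY : SmoothVField U Y) (hq : q ∈ U) : nijenhuis J X Y q = 0 := by
  obtain ⟨e, he, hqe, heA, L, hL⟩ := hf q (hUA hq)
  let L' := LinearMap.toContinuousLinearMap L
  have hL' : ∀ x ∈ e.source, ∀ v : TangentSpace 𝓘(𝕜, E) x,
    mvfderiv 𝓘(𝕜, E) e x (J x v) = L' (mvfderiv 𝓘(𝕜, E) e x v) := hL
  have hW : IsOpen (U ∩ e.source) := hU.inter e.open_source
  have hqW : q ∈ U ∩ e.source := ⟨hq, hqe⟩
  replace hX := hX.mono (Set.inter_subset_left : U ∩ e.source ⊆ U)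
  replace hY := hY.mono (Set.inter_subset_left : U ∩ e.source ⊆ U)
  have hWA : U ∩ e.source ⊆ A := Set.inter_subset_left.trans hUA
  have hJX := hJ _ hWA hW X hX
  have hJY := hJ _ hWA hW Y hY
  have hes := contMDiffOn_chart he (Set.inter_subset_right : U ∩ e.source ⊆ e.source)
  have hder : ∀ {Z : VField 𝕜 E N}, SmoothVField (U ∩ e.source) Z →
      ∀ v : TangentSpace 𝓘(𝕜, E) q,
        mvfderiv 𝓘(𝕜, E) (fun x => mvfderiv 𝓘(𝕜, E) e x (J x (Z x))) q v =
          L' (mvfderiv 𝓘(𝕜, E) (fun x => mvfderiv 𝓘(𝕜, E) e x (Z x)) q v) := by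
    intro Z hZ v
    rw [← mvfderiv_clm_comp L' (((contMDiffOn_mvfderiv_apply hW hes hZ).contMDiffAt
      (hW.mem_nhds hqW)).mdifferentiableAt (by simp))]
    refine DFunLike.congr_fun (mvfderiv_congr ?_) v
    filter_upwards [hW.mem_nhds hqW] with x hx using hL' x hx.2 _
  apply mvfderiv_chart_injective he hqe
  rw [nijenhuis, map_sub, map_sub, map_add, hL' q hqe, hL' q hqe, hL' q hqe, hL' q hqe,
    mvfderiv_mlieBracket hW hqW hes hJX hJY, mvfderiv_mlieBracket hW hqW hes hX hY,
    mvfderiv_mlieBracket hW hqW hes hJX hY, mvfderiv_mlieBracket hW hqW hes hX hJY,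
    hder hX, hder hY, hder hX, hder hY, map_zero]
  simp only [map_sub]
  abel

/-- The closedness condition follows from the compatibility of `J` with brackets of sections. -/
theorem closedCondition_of_bracketDefect_mem {D : Distribution 𝕜 E N} (hD : HasSections A D)
    (hJ : SmoothTensor11 A J)
    (h : ∀ U ⊆ A, IsOpen U → ∀ X Y : VField 𝕜 E N, SmoothVField U X → SmoothVField U Y →
      (∀ x ∈ U, X x ∈ D x) → (∀ x ∈ U, Y x ∈ D x) → ∀ q ∈ U, bracketDefect J X Y q ∈ D q) :
    ClosedCondition A D J := by
  intro B hBA hB l hl hlD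
  refine dVanishesOn_of_sections (fun q hq => hD q (hBA hq))
    (hl.1.compTensor (hJ.mono hBA)) hB fun U hUB hU X Y hX hY hXD hYD q hq => ?_
  have hlU : IsClosedOneForm U l :=
    ⟨hl.1.mono hUB, fun V hV => hl.2 V (hV.trans hUB)⟩
  rw [dOneForm_compTensor hU hq (hJ.mono (hUB.trans hBA)) hlU hX hY
    (fun x hx => hlD x (hUB hx) (hXD x hx)) (fun x hx => hlD x (hUB hx) (hYD x hx))]
  exact hlD q (hUB hq) (h U (hUB.trans hBA) hU X Y hX hY hXD hYD q hq)

/-- The differentials of local first integrals are closed forms whose common kernel is `D`, so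
testing the closedness condition on them suffices. -/
theorem IsFoliation.bracketDefect_mem {D : Distribution 𝕜 E N} (hD : IsFoliation r D)
    (hJ : SmoothTensor11 A J) (h : ClosedCondition A D J) (hUA : U ⊆ A) (hU : IsOpen U)
    {X Y : VField 𝕜 E N} (hX : SmoothVField U X) (hY : SmoothVField U Y)
    (hXD : ∀ x ∈ U, X x ∈ D x) (hYD : ∀ x ∈ U, Y x ∈ D x) (hq : q ∈ U) :
    bracketDefect J X Y q ∈ D q := by
  obtain ⟨V, f, hV, hqV, hf, hfD⟩ := hD.exists_firstIntegrals q
  rw [hfD q hqV]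
  intro i
  have hUV := hU.inter hV
  have hl : U ∩ V ⊆ U := Set.inter_subset_left
  have hr : U ∩ V ⊆ V := Set.inter_subset_right
  have hc : IsClosedOneForm (U ∩ V) (dForm (𝕜 := 𝕜) (E := E) (f i)) :=
    isClosedOneForm_dForm ((hf i).mono hr)
  have h1 := h (U ∩ V) (hl.trans hUA) hUV _ hc
    (fun x hx v hv => (hfD x hx.2 v).1 hv i) (U ∩ V) subset_rfl hUV X Y
    (hX.mono hl) (hY.mono hl) q ⟨hq, hqV⟩ (hXD q hq) (hYD q hq)
  rwa [dOneForm_compTensor hUV ⟨hq, hqV⟩ (hJ.mono (hl.trans hUA)) hc (hX.mono hl) (hY.mono hl)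
    (fun x hx => (hfD x hx.2 _).1 (hXD x hx.1) i)
    (fun x hx => (hfD x hx.2 _).1 (hYD x hx.1) i)] at h1

theorem exists_smoothVField_eq_family {k : ℕ} (x : Fin k → TangentSpace 𝓘(𝕜, E) q) :
    ∃ (U : Set N) (Z : Fin k → VField 𝕜 E N), IsOpen U ∧ q ∈ U ∧
      (∀ i, SmoothVField U (Z i)) ∧ ∀ i, Z i q = x i := by
  choose U Z hU hqU hZ hZx using fun i => exists_smoothVField_eq (x i)
  exact ⟨⋂ i, U i, Z, isOpen_iInter_of_finite hU, Set.mem_iInter.2 hqU,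
    fun i => (hZ i).mono (Set.iInter_subset _ i), hZx⟩

/-- The kernel of a smooth form is involutive as soon as any two of its vectors extend to
sections whose bracket is in the kernel. -/
theorem mlieBracket_mem_of_formKer {D : Distribution 𝕜 E N} {β : RForm 𝕜 E N r} (hA : IsOpen A)
    (hβ : DefinesOn A β D)
    (h : ∀ q ∈ A, ∀ v ∈ D q, ∀ w ∈ D q, ∃ (V : Set N) (X Y : VField 𝕜 E N), IsOpen V ∧ q ∈ V ∧
      SmoothVField V X ∧ SmoothVField V Y ∧ (∀ x ∈ V, X x ∈ D x) ∧ (∀ x ∈ V, Y x ∈ D x) ∧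
      X q = v ∧ Y q = w ∧ VectorField.mlieBracket 𝓘(𝕜, E) X Y q ∈ D q)
    (hU : IsOpen U) {X Y : VField 𝕜 E N} (hX : SmoothVField U X) (hY : SmoothVField U Y)
    (hXD : ∀ x ∈ U, X x ∈ D x) (hYD : ∀ x ∈ U, Y x ∈ D x) (hq : q ∈ U) (hqA : q ∈ A) :
    VectorField.mlieBracket 𝓘(𝕜, E) X Y q ∈ D q := by
  rw [← hβ.2 q hqA]
  intro x i
  obtain ⟨W, Z, hW, hqW, hZ, hZx⟩ := exists_smoothVField_eq_family x
  obtain ⟨V, X', Y', hV, hqV, hX', hY', hX'D, hY'D, hX'q, hY'q, hbr⟩ :=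
    h q hqA _ (hXD q hq) _ (hYD q hq)
  -- Freezing all entries of `β` but one gives a `1`-form vanishing on `D`. On sections `dθ(X, Y) =
  -- -θ([X, Y])`, and `dθ` is tensorial, so the given sections may be traded for the convenient
  -- ones.
  let θ : OneForm 𝕜 E N := fun y => (β y).toMultilinearMap.toLinearMap (fun j => Z j y) i
  have hθ_apply : ∀ y v, θ y v = β y (Function.update (fun j => Z j y) i v) := fun y v => rfl
  have hT : IsOpen (A ∩ W) := hA.inter hW
  have hθ : SmoothOneForm (A ∩ W) θ := by
    intro S hS hSo K hK
    have := hβ.1 S (hS.trans Set.inter_subset_left) hSo (Function.update Z i K) (by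
      intro j
      by_cases hj : j = i
      · subst hj
        rwa [Function.update_self]
      · rw [Function.update_of_ne hj]
        exact (hZ j).mono (hS.trans Set.inter_subset_right))
    refine this.congr fun y _ => ?_
    rw [hθ_apply]
    congr 1
    ext j
    by_cases hj : j = i
    · subst hj
      simp
    · simp [Function.update_of_ne hj]
  have hzero : ∀ y ∈ A ∩ W, ∀ v ∈ D y, θ y v = 0 := by
    intro y hy v hv
    rw [← hβ.2 y hy.1] at hv
    exact hv _ i
  obtain ⟨η, hη⟩ := exists_bilin_dOneForm hθ hT ⟨hqA, hqW⟩
  have h1 := hη U hU hq X Y hX hY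
  rw [← hX'q, ← hY'q, ← hη V hV hqV X' Y' hX' hY',
    dOneForm_eq_neg_of_eq_zero (hU.inter hT) ⟨hq, hqA, hqW⟩
      (fun y hy => hzero y hy.2 _ (hXD y hy.1)) (fun y hy => hzero y hy.2 _ (hYD y hy.1)),
    dOneForm_eq_neg_of_eq_zero (hV.inter hT) ⟨hqV, hqA, hqW⟩
      (fun y hy => hzero y hy.2 _ (hX'D y hy.1)) (fun y hy => hzero y hy.2 _ (hY'D y hy.1)),
    hzero q ⟨hqA, hqW⟩ _ hbr, neg_zero, neg_eq_zero, hθ_apply] at h1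
  convert h1 using 3
  ext j
  exact (hZx j).symm

end Brackets

/-! ### Wedging a two-form with independent covectors. -/

section Antisymmetrization

variable {𝕜 V : Type*} [RCLike 𝕜] [AddCommGroup V] [Module 𝕜 V] [FiniteDimensional 𝕜 V] {r : ℕ}
  {l : Fin r → Dual 𝕜 V}

/-- The sum is a determinant whose columns are the values of `l`, `φ`, `ψ`, and two columns
coincide. -/
theorem sum_sign_mul_prod_eq_zero (l : Fin r → Dual 𝕜 V) (φ ψ : Dual 𝕜 V)
    (h : (∃ k, φ = l k) ∨ ∃ k, ψ = l k) (z : Fin (r + 2) → V) :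
    ∑ σ : Equiv.Perm (Fin (r + 2)), ((Equiv.Perm.sign σ : ℤ) : 𝕜) *
      ((∏ i : Fin r, l i (z (σ (Fin.castAdd 2 i)))) *
        (φ (z (σ (Fin.natAdd r 0))) * ψ (z (σ (Fin.natAdd r 1))))) = 0 := by
  let c : Fin (r + 2) → Dual 𝕜 V := Fin.append l ![φ, ψ]
  let M : Matrix (Fin (r + 2)) (Fin (r + 2)) 𝕜 := Matrix.of fun a i => c i (z a)
  have h1 : M.det = ∑ σ : Equiv.Perm (Fin (r + 2)), ((Equiv.Perm.sign σ : ℤ) : 𝕜) *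
      ((∏ i : Fin r, l i (z (σ (Fin.castAdd 2 i)))) *
        (φ (z (σ (Fin.natAdd r 0))) * ψ (z (σ (Fin.natAdd r 1))))) := by
    rw [Matrix.det_apply']
    refine Finset.sum_congr rfl fun σ _ => ?_
    rw [Fin.prod_univ_add, Fin.prod_univ_two]
    simp [M, c]
  rw [← h1]
  rcases h with ⟨k, hk⟩ | ⟨k, hk⟩
  · refine Matrix.det_zero_of_column_eq (i := Fin.castAdd 2 k) (j := Fin.natAdd r 0) ?_ fun a => ?_
    · intro h
      have := congrArg Fin.val h
      simp at this
      omega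
    · simp [M, c, hk]
  · refine Matrix.det_zero_of_column_eq (i := Fin.castAdd 2 k) (j := Fin.natAdd r 1) ?_ fun a => ?_
    · intro h
      have := congrArg Fin.val h
      simp at this
      omega
    · simp [M, c, hk]

/-- Project along a dual system onto the common kernel of `l`. As `η` vanishes there, it is a sum of
products of two covectors one of which is some `l k`, and each product contributes zero. -/
theorem sum_sign_mul_bilin_eq_zero (hl : LinearIndependent 𝕜 l) {η : V →ₗ[𝕜] V →ₗ[𝕜] 𝕜}
    (hη : ∀ v w, (∀ j, l j v = 0) → (∀ j, l j w = 0) → η v w = 0) (z : Fin (r + 2) → V) :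
    ∑ σ : Equiv.Perm (Fin (r + 2)), ((Equiv.Perm.sign σ : ℤ) : 𝕜) *
      ((∏ i : Fin r, l i (z (σ (Fin.castAdd 2 i)))) *
        η (z (σ (Fin.natAdd r 0))) (z (σ (Fin.natAdd r 1)))) = 0 := by
  classical
  obtain ⟨e, he⟩ := exists_dual_vectors hl
  let P : End 𝕜 V := LinearMap.id - ∑ k, (l k).smulRight (e k)
  have hP : ∀ v, P v = v - ∑ k, l k v • e k := fun v => by
    simp [P, LinearMap.sum_apply]
  have hlP : ∀ v j, l j (P v) = 0 := by
    intro v j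
    rw [hP, map_sub, map_sum, sub_eq_zero, Finset.sum_eq_single j]
    · simp [he]
    · intro k _ hk
      simp [he, hk]
    · simp
  have hdec : ∀ v w, η v w =
      ∑ k, (l k v * η (e k) w + (η.flip (e k) ∘ₗ P) v * l k w) := by
    intro v w
    have h0 := hη (P v) (P w) (hlP v) (hlP w)
    rw [hP w, map_sub, map_sum, sub_eq_zero] at h0
    have h1 : η v w = η (P v) w + ∑ k, l k v * η (e k) w := by
      rw [hP, map_sub, LinearMap.sub_apply, map_sum, LinearMap.sum_apply]
      simp
    rw [h1, h0, Finset.sum_add_distrib, add_comm]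
    congr 1
    refine Finset.sum_congr rfl fun k _ => ?_
    rw [map_smul, smul_eq_mul, mul_comm]
    rfl
  have h4 : ∀ σ : Equiv.Perm (Fin (r + 2)), ((Equiv.Perm.sign σ : ℤ) : 𝕜) *
      ((∏ i : Fin r, l i (z (σ (Fin.castAdd 2 i)))) *
        η (z (σ (Fin.natAdd r 0))) (z (σ (Fin.natAdd r 1)))) =
      ∑ k, (((Equiv.Perm.sign σ : ℤ) : 𝕜) * ((∏ i : Fin r, l i (z (σ (Fin.castAdd 2 i)))) *
          (l k (z (σ (Fin.natAdd r 0))) * η (e k) (z (σ (Fin.natAdd r 1))))) +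
        ((Equiv.Perm.sign σ : ℤ) : 𝕜) * ((∏ i : Fin r, l i (z (σ (Fin.castAdd 2 i)))) *
          ((η.flip (e k) ∘ₗ P) (z (σ (Fin.natAdd r 0))) * l k (z (σ (Fin.natAdd r 1)))))) := by
    intro σ
    rw [hdec, Finset.mul_sum, Finset.mul_sum]
    exact Finset.sum_congr rfl fun k _ => by ring
  rw [Finset.sum_congr rfl fun σ _ => h4 σ, Finset.sum_comm]
  refine Finset.sum_eq_zero fun k _ => ?_
  rw [Finset.sum_add_distrib, sum_sign_mul_prod_eq_zero l (l k) (η (e k)) (Or.inl ⟨k, rfl⟩) z,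
    sum_sign_mul_prod_eq_zero l (η.flip (e k) ∘ₗ P) (l k) (Or.inr ⟨k, rfl⟩) z, add_zero]

/-- Evaluate on a dual system followed by `v`, `w`. Only permutations fixing the first `r` places
survive, namely the identity and the last transposition, and together they give `2 η v w`. -/
theorem bilin_eq_zero_of_sum_sign_mul (hl : LinearIndependent 𝕜 l) {η : V →ₗ[𝕜] V →ₗ[𝕜] 𝕜}
    (hanti : ∀ v w, η w v = -η v w)
    (hη : ∀ z : Fin (r + 2) → V,
      ∑ σ : Equiv.Perm (Fin (r + 2)), ((Equiv.Perm.sign σ : ℤ) : 𝕜) *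
      ((∏ i : Fin r, l i (z (σ (Fin.castAdd 2 i)))) *
        η (z (σ (Fin.natAdd r 0))) (z (σ (Fin.natAdd r 1)))) = 0)
    {v w : V} (hv : ∀ j, l j v = 0) (hw : ∀ j, l j w = 0) : η v w = 0 := by
  classical
  obtain ⟨e, he⟩ := exists_dual_vectors hl
  let z : Fin (r + 2) → V := Fin.append e ![v, w]
  have hzl : ∀ (i : Fin r) (a : Fin (r + 2)), l i (z a) = if a = Fin.castAdd 2 i then 1 else 0 := by
    intro i a
    induction a using Fin.addCases with
    | left a =>
      simp only [z, Fin.append_left, he, Fin.castAdd_inj]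
    | right a =>
      have hne : Fin.natAdd r a ≠ Fin.castAdd 2 i := by
        intro h
        have := congrArg Fin.val h
        simp at this
        omega
      rw [if_neg hne]
      simp only [z, Fin.append_right]
      fin_cases a
      · exact hv i
      · exact hw i
  let s : Equiv.Perm (Fin (r + 2)) := Equiv.swap (Fin.natAdd r 0) (Fin.natAdd r 1)
  have h01 : (Fin.natAdd r 0 : Fin (r + 2)) ≠ Fin.natAdd r 1 := by simp
  have hs1 : (1 : Equiv.Perm (Fin (r + 2))) ≠ s := by
    intro h
    have := congrArg (fun σ : Equiv.Perm (Fin (r + 2)) => σ (Fin.natAdd r 0)) h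
    simp only [s, Equiv.swap_apply_left, Equiv.Perm.one_apply] at this
    exact h01 this
  have h := hη z
  have hsub : ∀ σ ∈ Finset.univ, σ ∉ ({1, s} : Finset (Equiv.Perm (Fin (r + 2)))) →
      ((Equiv.Perm.sign σ : ℤ) : 𝕜) * ((∏ i : Fin r, l i (z (σ (Fin.castAdd 2 i)))) *
        η (z (σ (Fin.natAdd r 0))) (z (σ (Fin.natAdd r 1)))) = 0 := by
    intro σ _ hσ
    by_cases hfix : ∀ i : Fin r, σ (Fin.castAdd 2 i) = Fin.castAdd 2 i
    · exfalso
      apply hσ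
      have hright : ∀ a : Fin 2, ∃ c : Fin 2, σ (Fin.natAdd r a) = Fin.natAdd r c := by
        intro a
        generalize hy : σ (Fin.natAdd r a) = y
        induction y using Fin.addCases with
        | left i =>
          rw [← hfix i] at hy
          have := congrArg Fin.val (σ.injective hy)
          simp at this
          omega
        | right c => exact ⟨c, rfl⟩
      obtain ⟨c, hc⟩ := hright 0
      obtain ⟨d, hd⟩ := hright 1
      have hcd : c ≠ d := by
        rintro rfl
        exact h01 (σ.injective (hc.trans hd.symm))
      rw [Finset.mem_insert, Finset.mem_singleton]
      have hsfix : ∀ i : Fin r, s (Fin.castAdd 2 i) = Fin.castAdd 2 i := fun i =>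
        Equiv.swap_apply_of_ne_of_ne
          (fun h => by have := congrArg Fin.val h; simp at this; omega)
          (fun h => by have := congrArg Fin.val h; simp at this; omega)
      fin_cases c <;> fin_cases d
      · exact absurd rfl hcd
      · left
        ext1 a
        induction a using Fin.addCases with
        | left i => exact hfix i
        | right a => fin_cases a <;> assumption
      · right
        ext1 a
        induction a using Fin.addCases with
        | left i => rw [hfix, hsfix]
        | right a =>
          fin_cases a
          · exact hc.trans (Equiv.swap_apply_left _ _).symm
          · exact hd.trans (Equiv.swap_apply_right _ _).symm
      · exact absurd rfl hcd
    · push Not at hfix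
      obtain ⟨i, hi⟩ := hfix
      rw [Finset.prod_eq_zero (Finset.mem_univ i) (by rw [hzl, if_neg hi]), zero_mul, mul_zero]
  rw [← Finset.sum_subset (Finset.subset_univ {1, s}) hsub, Finset.sum_pair hs1] at h
  have hprod1 : ∏ i : Fin r, l i (z ((1 : Equiv.Perm (Fin (r + 2))) (Fin.castAdd 2 i))) = 1 :=
    Finset.prod_eq_one fun i _ => by rw [Equiv.Perm.one_apply, hzl, if_pos rfl]
  have hprods : ∏ i : Fin r, l i (z (s (Fin.castAdd 2 i))) = 1 :=
    Finset.prod_eq_one fun i _ => by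
      rw [show s (Fin.castAdd 2 i) = Fin.castAdd 2 i from Equiv.swap_apply_of_ne_of_ne
          (fun h => by have := congrArg Fin.val h; simp at this; omega)
          (fun h => by have := congrArg Fin.val h; simp at this; omega), hzl, if_pos rfl]
  rw [hprod1, hprods, Equiv.Perm.sign_swap h01, Equiv.Perm.sign_one, Equiv.Perm.one_apply,
    Equiv.Perm.one_apply, show s (Fin.natAdd r 0) = Fin.natAdd r 1 from Equiv.swap_apply_left _ _,
    show s (Fin.natAdd r 1) = Fin.natAdd r 0 from Equiv.swap_apply_right _ _] at h
  have hz0 : z (Fin.natAdd r 0) = v := by simp [z]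
  have hz1 : z (Fin.natAdd r 1) = w := by simp [z]
  rw [hz0, hz1, hanti v w] at h
  have h2 : (2 : 𝕜) * η v w = 0 := by
    push_cast at h
    linear_combination h
  exact (mul_eq_zero.1 h2).resolve_left two_ne_zero

end Antisymmetrization

/-! ### The wedge form of the closedness condition. -/

section WedgeD

variable {𝕜 E N : Type*} [RCLike 𝕜] [NormedAddCommGroup E] [NormedSpace 𝕜 E]
  [FiniteDimensional 𝕜 E] [TopologicalSpace N] [ChartedSpace E N] [IsManifold 𝓘(𝕜, E) ∞ N]
  {p q : N} {U A : Set N} {r : ℕ} {J : Tensor11 𝕜 E N}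

theorem dOneForm_swap (α : OneForm 𝕜 E N) (X Y : VField 𝕜 E N) :
    dOneForm α Y X q = -dOneForm α X Y q := by
  rw [dOneForm, dOneForm, VectorField.mlieBracket_swap_apply (V := Y), map_neg]
  ring

theorem dVanishesOn_iff_wedgeDVanishesOn (hA : IsOpen A) {D : Distribution 𝕜 E N}
    {l : Fin r → OneForm 𝕜 E N} (hl : ∀ q ∈ A, LinearIndependent 𝕜 fun j => l j q)
    (hD : ∀ q ∈ A, ∀ v, v ∈ D q ↔ ∀ j, l j q v = 0) {α : OneForm 𝕜 E N}
    (hα : SmoothOneForm A α) : DVanishesOn A D α ↔ WedgeDVanishesOn A l α := by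
  have hex : ∀ q, ∃ η : TangentSpace 𝓘(𝕜, E) q →ₗ[𝕜] TangentSpace 𝓘(𝕜, E) q →ₗ[𝕜] 𝕜, q ∈ A →
      ∀ U : Set N, IsOpen U → q ∈ U → ∀ X Y : VField 𝕜 E N,
        SmoothVField U X → SmoothVField U Y → dOneForm α X Y q = η (X q) (Y q) := by
    intro q
    by_cases hq : q ∈ A
    · obtain ⟨η, hη⟩ := exists_bilin_dOneForm hα hA hq
      exact ⟨η, fun _ => hη⟩
    · exact ⟨0, fun h => absurd h hq⟩
  choose η hη using hex
  rw [dVanishesOn_iff hA hη]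
  constructor
  · intro h U hUA hU Z hZ q hq
    simp only [fun i j => hη q (hUA hq) U hU hq (Z i) (Z j) (hZ i) (hZ j)]
    exact sum_sign_mul_bilin_eq_zero (hl q (hUA hq))
      (fun v w hv hw => h q (hUA hq) v ((hD q (hUA hq) v).2 hv) w ((hD q (hUA hq) w).2 hw))
      fun i => Z i q
  · intro h q hq v hv w hw
    refine bilin_eq_zero_of_sum_sign_mul (hl q hq) ?_ ?_ ((hD q hq v).1 hv) ((hD q hq w).1 hw)
    · intro v w
      obtain ⟨U, X, Y, hU, hqU, hX, hY, rfl, rfl⟩ := exists_smoothVField_eq_pair v w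
      rw [← hη q hq U hU hqU X Y hX hY, ← hη q hq U hU hqU Y X hY hX, dOneForm_swap]
    · intro z
      obtain ⟨U, Z, hU, hqU, hZ, hZz⟩ := exists_smoothVField_eq_family z
      have h1 := h (A ∩ U) Set.inter_subset_left (hA.inter hU) Z
        (fun i => (hZ i).mono Set.inter_subset_right) q ⟨hq, hqU⟩
      simp only [fun i j => hη q hq U hU hqU (Z i) (Z j) (hZ i) (hZ j), hZz] at h1
      exact h1

/-- The common kernel of the `l j` has codimension at most `r` and lies in the kernel of the wedge,
which has codimension `r`; so the two agree and the `l j` must be independent. -/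
theorem linearIndependent_of_formKer_wedge {V : Type*} [AddCommGroup V] [Module 𝕜 V]
    [FiniteDimensional 𝕜 V] {l : Fin r → Dual 𝕜 V} {D : Submodule 𝕜 V}
    (hD : finrank 𝕜 (V ⧸ D) = r) (h : formKer (wedge l) = D) : LinearIndependent 𝕜 l := by
  refine linearIndependent_of_codim hD fun v => ?_
  have hle : ∀ v, (∀ j, l j v = 0) → v ∈ D := by
    intro v hv
    rw [← h]
    intro x i
    rw [wedge_apply]
    refine Matrix.det_eq_zero_of_row_eq_zero i fun j => ?_
    simp [hv]
  refine ⟨fun hv => ?_, hle v⟩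
  have hker : LinearMap.ker (LinearMap.pi l) = D := by
    apply Submodule.eq_of_le_of_finrank_le
    · intro v hv
      exact hle v fun j => congrFun (LinearMap.mem_ker.1 hv) j
    · have h1 := (LinearMap.pi l).finrank_range_add_finrank_ker
      have h2 := D.finrank_quotient_add_finrank
      have h3 : finrank 𝕜 (LinearMap.range (LinearMap.pi l)) ≤ r := by
        simpa using (LinearMap.range (LinearMap.pi l)).finrank_le
      omega
  rw [← hker] at hv
  exact fun j => congrFun (LinearMap.mem_ker.1 hv) j

/-- The closedness condition in terms of closed forms defining the foliation. -/
theorem closedCondition_iff_wedgeDVanishesOn {F : Distribution 𝕜 E N}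
    (hF : IsFoliation r F) (hA : IsOpen A) (hJ : SmoothTensor11 A J) {l : Fin r → OneForm 𝕜 E N}
    (hl : ∀ j, IsClosedOneForm A (l j)) (hlF : ∀ q ∈ A, formKer (wedge fun j => l j q) = F q) :
    ClosedCondition A F J ↔ ∀ j, WedgeDVanishesOn A l (compTensor (l j) J) := by
  have hli : ∀ q ∈ A, LinearIndependent 𝕜 fun j => l j q := fun q hq =>
    linearIndependent_of_formKer_wedge (hF.codim q) (hlF q hq)
  have hmem : ∀ q ∈ A, ∀ v, v ∈ F q ↔ ∀ j, l j q v = 0 := by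
    intro q hq v
    rw [← hlF q hq]
    exact mem_formKer_wedge (hli q hq)
  have hiff := fun j => dVanishesOn_iff_wedgeDVanishesOn hA hli hmem ((hl j).1.compTensor hJ)
  simp only [← hiff]
  constructor
  · intro h j
    exact h A subset_rfl hA (l j) (hl j) fun q hq v hv => (hmem q hq v).1 hv j
  · intro h
    -- Only the forms `l j` are tested, but their common kernel is `F`; hence the bracket defect
    -- lies in `F`, and the condition follows for every closed form vanishing on `F`.
    refine closedCondition_of_bracketDefect_mem hF.hasSections hJ ?_
    intro U hUA hU X Y hX hY hXF hYF q hq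
    rw [hmem q (hUA hq)]
    intro j
    rw [← dOneForm_compTensor hU hq (hJ.mono hUA)
      ⟨(hl j).1.mono hUA, fun V hV => (hl j).2 V (hV.trans hUA)⟩ hX hY
      (fun x hx => (hmem x (hUA hx) _).1 (hXF x hx) j)
      (fun x hx => (hmem x (hUA hx) _).1 (hYF x hx) j)]
    exact h j U hUA hU X Y hX hY q hq (hXF q hq) (hYF q hq)

end WedgeD

/-! ### The shift condition in terms of the web. -/

section Pointwise

variable {𝕜 V : Type*} [RCLike 𝕜] [AddCommGroup V] [Module 𝕜 V] [FiniteDimensional 𝕜 V] {r : ℕ}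

variable (r) in
/-- `J` shifts the chains of a basis defining the algebraic Veronese web `u`, with `u(∞) = F`. -/
def IsShiftOf (u : 𝕜 → Submodule 𝕜 V) (F : Submodule 𝕜 V) (J : End 𝕜 V) : Prop :=
  ∃ m : Fin r → ℕ, (∀ j, 1 ≤ m j) ∧ ∃ b : Basis (Σ j : Fin r, Fin (m j)) 𝕜 (Dual 𝕜 V),
    F = ⨅ j, LinearMap.ker (lastCovector b j) ∧ ShiftsChains b J ∧
      ∀ t, u t = ⨅ j, LinearMap.ker (factor b t j)

variable {u : 𝕜 → Submodule 𝕜 V} {F : Submodule 𝕜 V} {J : End 𝕜 V}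

theorem mem_iInf_ker {l : Fin r → Dual 𝕜 V} {v : V} :
    v ∈ (⨅ j, LinearMap.ker (l j) : Submodule 𝕜 V) ↔ ∀ j, l j v = 0 := by
  simp [Submodule.mem_iInf]

theorem IsShiftOf.atInfinity_eq (hr : 1 ≤ r) (h : IsShiftOf r u F J) : atInfinity r u = F := by
  obtain ⟨m, hm, b, rfl, -, hu⟩ := h
  exact VeroneseWeb.atInfinity_eq hr hm hu

theorem IsShiftOf.eq_map (h : IsShiftOf r u F J) (t : 𝕜) :
    u t = F.map (J + t • (1 : End 𝕜 V)) := by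
  obtain ⟨m, hm, b, rfl, hJ, hu⟩ := h
  rw [hu, hJ.map_eq hm]

theorem IsShiftOf.eq_bot (h : IsShiftOf r u F J) {S : Submodule 𝕜 V} (hS : S ≤ F)
    (hJS : S.map J ≤ S) : S = ⊥ := by
  obtain ⟨m, hm, b, rfl, hJ, hu⟩ := h
  exact hJ.eq_bot (fun v hv => mem_iInf_ker.1 (hS hv)) hJS

theorem IsShiftOf.spans (h : IsShiftOf r u F J) : Spans F.dualAnnihilator J.dualMap :=
  spans_dualAnnihilator_of_forall_eq_bot fun _ hS hJS => h.eq_bot hS hJS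

theorem IsShiftOf.injOn (h : IsShiftOf r u F J) (t : 𝕜) :
    Set.InjOn (J + t • (1 : End 𝕜 V)) F := by
  obtain ⟨m, hm, b, rfl, hJ, hu⟩ := h
  intro v hv w hw hvw
  rw [← sub_eq_zero]
  refine hJ.injective (t := t) (fun j => ?_) ?_
  · rw [map_sub, mem_iInf_ker.1 hv j, mem_iInf_ker.1 hw j, sub_zero]
  · rw [← sub_eq_zero, ← map_sub] at hvw
    exact hvw

theorem isShiftOf_of_spans (hF : finrank 𝕜 (V ⧸ F) = r)
    (h : Spans F.dualAnnihilator J.dualMap) :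
    IsShiftOf r (fun t => F.map (J + t • (1 : End 𝕜 V))) F J := by
  obtain ⟨m, hm, b, hb, hJ⟩ := exists_basis_shiftsChains hF h
  refine ⟨m, hm, b, hb, hJ, fun t => ?_⟩
  change F.map (J + t • (1 : End 𝕜 V)) = _
  rw [hb, hJ.map_eq hm]

theorem exists_basis_of_isVeroneseCurve {γ : 𝕜 → V [⋀^Fin r]→ₗ[𝕜] 𝕜} {m : Fin r → ℕ}
    (h : IsSplitting γ m) (hu : ∀ t, formKer (γ t) = u t) :
    (∀ j, 1 ≤ m j) ∧ ∃ b : Basis (Σ j : Fin r, Fin (m j)) 𝕜 (Dual 𝕜 V),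
      ∀ t, u t = ⨅ j, LinearMap.ker (factor b t j) := by
  obtain ⟨hm, b, hb⟩ := h
  refine ⟨hm, b, fun t => ?_⟩
  rw [← hu, hb]
  exact formKer_wedge (linearIndependent_factor hm t)

theorem isShiftOf_of_eigencovectors (hr : 1 ≤ r) {γ : 𝕜 → V [⋀^Fin r]→ₗ[𝕜] 𝕜}
    (hγ : IsVeroneseCurve γ) (hu : ∀ t, formKer (γ t) = u t)
    (hJ : ⨆ μ : 𝕜, J.eigenspace μ = ⊤)
    (h : ∀ c, J.charpoly.IsRoot c → ∀ l : Dual 𝕜 V, l ∘ₗ J = c • l → ∀ v ∈ u (-c), l v = 0) :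
    IsShiftOf r u (atInfinity r u) J := by
  obtain ⟨m, hm⟩ := hγ
  obtain ⟨hm, b, hb⟩ := exists_basis_of_isVeroneseCurve hm hu
  refine ⟨m, hm, b, VeroneseWeb.atInfinity_eq hr hm hb,
    shiftsChains_of_eigencovectors hm hJ fun c hc l hl v hv => h c hc l hl v ?_, hb⟩
  rw [hb]
  exact mem_iInf_ker.2 hv

/-- The resolvent curve of a form defining `u(∞)`. -/
theorem IsShiftOf.exists_resolventCurve (hr : 1 ≤ r) (h : IsShiftOf r u F J)
    {β : V [⋀^Fin r]→ₗ[𝕜] 𝕜} (hβ : formKer β = F) :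
    ∃ γ : 𝕜 → V [⋀^Fin r]→ₗ[𝕜] 𝕜,
      IsResolventCurve (fun t => LinearMap.det (J + t • (1 : End 𝕜 V))) J β γ ∧
      IsVeroneseCurve γ ∧ (∀ t, formKer (γ t) = u t) ∧
      ∀ ν : Fin (finrank 𝕜 V + 1) → 𝕜, Function.Injective ν → ∀ t,
        γ t = ∑ s, (Lagrange.basis Finset.univ ν s).eval t • γ (ν s) := by
  obtain ⟨m, hm, b, rfl, hJ, hu⟩ := h
  obtain ⟨c, hc, rfl⟩ := exists_eq_smul_wedge_of_formKer_eq (linearIndependent_lastCovector hm) hr hβ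
  refine ⟨fun t => c • wedge (factor b t), hJ.isResolventCurve hm c,
    isVeroneseCurve_smul_wedge_factor hr hm hc b, fun t => ?_, fun ν hν t => ?_⟩
  · rw [mem_formKer_smul hc, formKer_wedge (linearIndependent_factor hm t), hu]
  · change c • wedge (factor b t) = ∑ s, (Lagrange.basis Finset.univ ν s).eval t •
      c • wedge (factor b (ν s))
    rw [wedge_factor_eq_sum_lagrange b hν t, Finset.smul_sum]
    exact Finset.sum_congr rfl fun s _ => smul_comm _ _ _

theorem finite_setOf_det_eq_zero (J : End 𝕜 V) :
    {t : 𝕜 | LinearMap.det (J + t • (1 : End 𝕜 V)) = 0}.Finite := by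
  have h1 : {t : 𝕜 | LinearMap.det (J + t • (1 : End 𝕜 V)) = 0} ⊆
      (fun s => -s) '' (J.charpoly.rootSet 𝕜) := by
    intro t ht
    refine ⟨-t, ?_, neg_neg t⟩
    rw [Polynomial.mem_rootSet_of_ne J.charpoly_monic.ne_zero, Polynomial.coe_aeval_eq_eval]
    rw [Set.mem_ofPred_eq, det_add_smul_one] at ht
    exact (mul_eq_zero.1 ht).resolve_left (pow_ne_zero _ (neg_ne_zero.2 one_ne_zero))
  exact ((Polynomial.rootSet_finite _ _).image _).subset h1

theorem exists_injective_det_ne_zero (J : End 𝕜 V) (k : ℕ) :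
    ∃ ν : Fin k → 𝕜, Function.Injective ν ∧
      ∀ s, LinearMap.det (J + ν s • (1 : End 𝕜 V)) ≠ 0 := by
  have h : ({t : 𝕜 | LinearMap.det (J + t • (1 : End 𝕜 V)) = 0}ᶜ).Infinite :=
    (finite_setOf_det_eq_zero J).infinite_compl
  let f := h.natEmbedding
  exact ⟨fun s => f s, fun s t hst => Fin.ext (f.injective (Subtype.ext hst)), fun s => (f s).2⟩

theorem isUnit_of_det_ne_zero {K : End 𝕜 V} (h : LinearMap.det K ≠ 0) : IsUnit K :=
  (LinearMap.isUnit_iff_isUnit_det K).2 (isUnit_iff_ne_zero.2 h)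

end Pointwise

/-! ### Smooth representatives and involutivity. -/

section Representatives

variable {𝕜 E N : Type*} [RCLike 𝕜] [NormedAddCommGroup E] [NormedSpace 𝕜 E]
  [FiniteDimensional 𝕜 E] [TopologicalSpace N] [ChartedSpace E N] [IsManifold 𝓘(𝕜, E) ∞ N]
  {p q : N} {U A B : Set N} {r : ℕ} {J : Tensor11 𝕜 E N} {w : 𝕜 → Distribution 𝕜 E N}
  {F : Distribution 𝕜 E N} {β : RForm 𝕜 E N r}

theorem isOpen_det_ne_zero (hA : IsOpen A) (hJ : SmoothTensor11 A J) (t : 𝕜) :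
    IsOpen (A ∩ {q | LinearMap.det (shiftTensor J t q) ≠ 0}) :=
  ((hJ.shiftTensor t).contMDiffOn_det hA).continuousOn.isOpen_inter_preimage hA isOpen_ne

theorem SmoothRForm.mono (h : SmoothRForm A β) (hB : B ⊆ A) : SmoothRForm B β :=
  fun U hU => h U (hU.trans hB)

theorem smoothRForm_of_locally
    (h : ∀ q ∈ A, ∃ V, IsOpen V ∧ q ∈ V ∧ SmoothRForm V β) : SmoothRForm A β := by
  intro U hUA hU X hX
  refine contMDiffOn_of_locally fun q hq => ?_
  obtain ⟨V, hV, hqV, hβ⟩ := h q (hUA hq)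
  exact ⟨U ∩ V, hU.inter hV, ⟨hq, hqV⟩, hβ _ Set.inter_subset_right (hU.inter hV) X
    fun i => (hX i).mono Set.inter_subset_left⟩

theorem SmoothRForm.comp (hβ : SmoothRForm A β) (hJ : SmoothTensor11 A J) :
    SmoothRForm A fun q => (β q).compLinearMap (J q) :=
  fun U hUA hU X hX => hβ U hUA hU (fun i q => J q (X i q)) fun i => hJ U hUA hU (X i) (hX i)

theorem SmoothRForm.smul (hβ : SmoothRForm A β) {f : N → 𝕜}
    (hf : ContMDiffOn 𝓘(𝕜, E) 𝓘(𝕜, 𝕜) ∞ f A) : SmoothRForm A fun q => f q • β q :=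
  fun U hUA hU X hX => (hf.mono hUA).mul (hβ U hUA hU X hX)

theorem SmoothRForm.sum {ι : Type*} [Fintype ι] {β : ι → RForm 𝕜 E N r}
    (hβ : ∀ i, SmoothRForm A (β i)) : SmoothRForm A fun q => ∑ i, β i q := by
  intro U hUA hU X hX
  simp only [alternatingMap_sum_apply]
  exact contMDiffOn_finsetSum fun i _ => hβ i U hUA hU X hX

theorem SmoothRForm.congr {β' : RForm 𝕜 E N r} (hβ : SmoothRForm A β)
    (h : ∀ q ∈ A, β' q = β q) : SmoothRForm A β' :=
  fun U hUA hU X hX => (hβ U hUA hU X hX).congr fun q hq => by rw [h q (hUA hq)]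

theorem smoothRForm_wedge {l : Fin r → OneForm 𝕜 E N} (hl : ∀ j, SmoothOneForm A (l j)) :
    SmoothRForm A fun q => wedge fun j => l j q := by
  intro U hUA hU X hX
  simp only [wedge_apply]
  exact contMDiffOn_matrix_det fun i j => hl j U hUA hU (X i) (hX i)

theorem IsFoliation.exists_definesOn (hF : IsFoliation r F) (p : N) :
    ∃ (V : Set N) (β : RForm 𝕜 E N r), IsOpen V ∧ p ∈ V ∧ DefinesOn V β F := by
  obtain ⟨V, h, hV, hpV, hh, hhF⟩ := hF.exists_firstIntegrals p
  refine ⟨V, fun q => wedge fun j => dForm (h j) q, hV, hpV,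
    smoothRForm_wedge fun j => smoothOneForm_dForm (hh j), fun q hq => ?_⟩
  ext v
  rw [hhF q hq]
  exact mem_formKer_wedge (linearIndependent_of_codim (hF.codim q) (hhF q hq))

/-- The resolvent curve of a form defining `w(∞)` represents `w`. -/
theorem exists_representative (hr : 1 ≤ r) (hA : IsOpen A) (hJ : SmoothTensor11 A J)
    (h : ∀ q ∈ A, IsShiftOf r (fun t => w t q) (F q) (J q)) (hβ : DefinesOn A β F) :
    ∃ γ : 𝕜 → RForm 𝕜 E N r,
      IsResolventCurveOn A (fun q t => LinearMap.det (shiftTensor J t q)) J β γ ∧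
      IsRepresentative w A γ := by
  have hex : ∀ q, ∃ γ : 𝕜 → TangentSpace 𝓘(𝕜, E) q [⋀^Fin r]→ₗ[𝕜] 𝕜, q ∈ A →
      IsResolventCurve (fun t => LinearMap.det (shiftTensor J t q)) (J q) (β q) γ ∧
      IsVeroneseCurve γ ∧ (∀ t, formKer (γ t) = w t q) ∧
      ∀ ν : Fin (finrank 𝕜 (TangentSpace 𝓘(𝕜, E) q) + 1) → 𝕜, Function.Injective ν → ∀ t,
        γ t = ∑ s, (Lagrange.basis Finset.univ ν s).eval t • γ (ν s) := by
    intro q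
    by_cases hq : q ∈ A
    · obtain ⟨γ, hγ⟩ := (h q hq).exists_resolventCurve hr (hβ.2 q hq)
      exact ⟨γ, fun _ => hγ⟩
    · exact ⟨0, fun hq' => absurd hq' hq⟩
  choose γ hγ using hex
  -- The curves were chosen pointwise, but where `J + s` is invertible the explicit formula forces
  -- smoothness.
  have hinv : ∀ s : 𝕜, SmoothRForm (A ∩ {q | LinearMap.det (shiftTensor J s q) ≠ 0})
      fun q => γ q s := by
    intro s
    have hJs : SmoothTensor11 (A ∩ {q | LinearMap.det (shiftTensor J s q) ≠ 0}) (shiftTensor J s) :=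
      (hJ.shiftTensor s).mono Set.inter_subset_left
    have h1 := ((hβ.1.mono Set.inter_subset_left).comp
      (hJs.inverse fun q hq => isUnit_of_det_ne_zero hq.2)).smul
      (hJs.contMDiffOn_det (isOpen_det_ne_zero hA hJ s))
    exact h1.congr fun q hq => (hγ q hq.1).1.2 s (isUnit_of_det_ne_zero hq.2)
  refine ⟨fun t q => γ q t, fun q hq => (hγ q hq).1, ⟨fun t => ?_, fun t q hq => (hγ q hq).2.2.1 t,
    fun q hq => (hγ q hq).2.1⟩⟩
  refine smoothRForm_of_locally fun q₀ hq₀ => ?_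
  -- Nodes which are regular at `q₀` stay regular nearby; interpolating from them gives smoothness
  -- for every `t`, singular ones included.
  obtain ⟨ν, hν, hν0⟩ := exists_injective_det_ne_zero (J q₀) (finrank 𝕜 E + 1)
  let V := ⋂ s, (A ∩ {q | LinearMap.det (shiftTensor J (ν s) q) ≠ 0})
  have hV : IsOpen V := isOpen_iInter_of_finite fun s => isOpen_det_ne_zero hA hJ (ν s)
  have hVs : ∀ s, V ⊆ A ∩ {q | LinearMap.det (shiftTensor J (ν s) q) ≠ 0} :=
    fun s => Set.iInter_subset _ s
  refine ⟨V, hV, Set.mem_iInter.2 fun s => ⟨hq₀, hν0 s⟩, ?_⟩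
  have h1 : SmoothRForm V fun q => ∑ s, (Lagrange.basis Finset.univ ν s).eval t • γ q (ν s) :=
    SmoothRForm.sum fun s => ((hinv (ν s)).mono (hVs s)).smul contMDiffOn_const
  exact h1.congr fun q hq => (hγ q (hVs 0 hq).1).2.2.2 ν hν t

/-- `F` is not assumed to be a foliation here, so its sections are obtained from those of `w(t) = (J
+ t) F` by inverting `J + t` at a regular parameter. -/
theorem hasSections_of_isShiftOf (hA : IsOpen A) (hJ : SmoothTensor11 A J)
    (h : ∀ q ∈ A, IsShiftOf r (fun t => w t q) (F q) (J q)) (hw : ∀ t, IsFoliation r (w t)) :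
    HasSections A F := by
  intro q hq v hv
  obtain ⟨ν, -, hν⟩ := exists_injective_det_ne_zero (J q) 1
  set t := ν 0
  have hwt : ∀ x ∈ A, w t x = (F x).map (shiftTensor J t x) := fun x hx => (h x hx).eq_map t
  have hv' : shiftTensor J t q v ∈ w t q := by
    rw [hwt q hq]
    exact Submodule.mem_map_of_mem hv
  obtain ⟨U, X, hU, hqU, hX, hXw, hXq⟩ := (hw t).exists_section hv'
  let B := A ∩ {q | LinearMap.det (shiftTensor J t q) ≠ 0}
  have hB : IsOpen B := isOpen_det_ne_zero hA hJ t
  have hunit : ∀ x ∈ B, IsUnit (shiftTensor J t x) := fun x hx => isUnit_of_det_ne_zero hx.2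
  have hinv : ∀ x ∈ B, ∀ y, Ring.inverse (shiftTensor J t x) (shiftTensor J t x y) = y := by
    intro x hx y
    rw [← Module.End.mul_apply, Ring.inverse_mul_cancel _ (hunit x hx)]
    rfl
  refine ⟨U ∩ B, fun x => Ring.inverse (shiftTensor J t x) (X x), hU.inter hB, ⟨hqU, hq, hν 0⟩, ?_,
    fun x hx => ?_, ?_⟩
  · exact (((hJ.shiftTensor t).mono (Set.inter_subset_left : B ⊆ A)).inverse hunit) _
      Set.inter_subset_right (hU.inter hB) X (hX.mono Set.inter_subset_left)
  · have h1 := hXw x hx.1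
    rw [hwt x hx.2.1] at h1
    obtain ⟨y, hy, hyx⟩ := h1
    simp only [← hyx, hinv x hx.2]
    exact hy
  · simp only [hXq]
    exact hinv q ⟨hq, hν 0⟩ v

/-- Let `B` be the bracket defect. Involutivity of `w(t)` and injectivity of `J + t` put `B + t [X,
Y]` in `F` for each regular `t`. Two such parameters separate `B` from `[X, Y]`. -/
theorem closedCondition_of_isShiftOf (hA : IsOpen A) (hJ : SmoothTensor11 A J)
    (hN : ∀ U ⊆ A, IsOpen U → ∀ X Y : VField 𝕜 E N, SmoothVField U X → SmoothVField U Y →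
      ∀ q ∈ U, nijenhuis J X Y q = 0)
    (h : ∀ q ∈ A, IsShiftOf r (fun t => w t q) (F q) (J q)) (hw : ∀ t, IsFoliation r (w t)) :
    ClosedCondition A F J := by
  refine closedCondition_of_bracketDefect_mem (hasSections_of_isShiftOf hA hJ h hw) hJ
    fun U hUA hU X Y hX hY hXF hYF q hq => ?_
  have hmem : ∀ t, LinearMap.det (shiftTensor J t q) ≠ 0 →
      bracketDefect J X Y q + t • VectorField.mlieBracket 𝓘(𝕜, E) X Y q ∈ F q := by
    intro t ht
    have hwt : ∀ x ∈ A, w t x = (F x).map (shiftTensor J t x) := fun x hx => (h x hx).eq_map t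
    have h1 := (hw t).involutive U hU (fun x => shiftTensor J t x (X x))
      (fun x => shiftTensor J t x (Y x)) ((hJ.shiftTensor t) U hUA hU X hX)
      ((hJ.shiftTensor t) U hUA hU Y hY)
      (fun x hx => by rw [hwt x (hUA hx)]; exact Submodule.mem_map_of_mem (hXF x hx))
      (fun x hx => by rw [hwt x (hUA hx)]; exact Submodule.mem_map_of_mem (hYF x hx)) q hq
    rw [mlieBracket_add_smul hU hq (hJ.mono hUA) hX hY (hN U hUA hU X Y hX hY q hq),
      hwt q (hUA hq)] at h1
    obtain ⟨y, hy, hyx⟩ := h1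
    have hinj : Function.Injective (shiftTensor J t q) :=
      ((Module.End.isUnit_iff _).1 (isUnit_of_det_ne_zero ht)).injective
    rwa [← hinj hyx]
  obtain ⟨ν, hν, hν0⟩ := exists_injective_det_ne_zero (J q) 2
  have h0 := hmem (ν 0) (hν0 0)
  have h1 := hmem (ν 1) (hν0 1)
  have hne : ν 1 - ν 0 ≠ 0 := sub_ne_zero.2 fun h => absurd (hν h) (by decide)
  have h2 : (ν 1 - ν 0) • VectorField.mlieBracket 𝓘(𝕜, E) X Y q ∈ F q := by
    have := (F q).sub_mem h1 h0
    rwa [add_sub_add_left_eq_sub, ← sub_smul] at this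
  have h3 := (F q).smul_mem (ν 0) (((F q).smul_mem_iff hne).1 h2)
  have h4 := (F q).sub_mem h0 h3
  rwa [add_sub_cancel_right] at h4

/-- The Veronese web defined by a foliation and a compatible tensor field. -/
theorem isVeroneseWeb_map (hr : 1 ≤ r) (hF : IsFoliation r F) (hJ : SmoothTensor11 Set.univ J)
    (hspan : ∀ q, SpansCotangent F J q) (hN : NijenhuisVanishesOn F J)
    (hc : ClosedCondition Set.univ F J) :
    IsVeroneseWeb r fun t q => (F q).map (shiftTensor J t q) := by
  have hshift : ∀ q, IsShiftOf r (fun t => (F q).map (shiftTensor J t q)) (F q) (J q) := fun q =>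
    isShiftOf_of_spans (hF.codim q) (hspan q)
  have hrep : ∀ p : N, ∃ A : Set N, IsOpen A ∧ p ∈ A ∧ ∃ γ : 𝕜 → RForm 𝕜 E N r,
      IsRepresentative (fun t q => (F q).map (shiftTensor J t q)) A γ := by
    intro p
    obtain ⟨V, β, hV, hpV, hβ⟩ := hF.exists_definesOn p
    obtain ⟨γ, -, hγ⟩ := exists_representative hr hV (hJ.mono (Set.subset_univ V))
      (w := fun t q => (F q).map (shiftTensor J t q)) (fun q _ => hshift q) hβ
    exact ⟨V, hV, hpV, γ, hγ⟩
  refine ⟨hr, fun t => ⟨fun q => ?_, fun p => ?_, fun U hU X Y hX hY hXF hYF q hq => ?_⟩, hrep⟩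
  · have h1 := (F q).finrank_quotient_add_finrank
    have h2 := ((F q).map (shiftTensor J t q)).finrank_quotient_add_finrank
    have h3 := hF.codim q
    have h4 : finrank 𝕜 ((F q).map (shiftTensor J t q)) = finrank 𝕜 (F q) := by
      rw [← LinearMap.range_domRestrict]
      exact LinearMap.finrank_range_of_inj fun v w hvw =>
        Subtype.ext ((hshift q).injOn t v.2 w.2 hvw)
    omega
  · obtain ⟨U, hU, hpU, d, X, hX, hXF⟩ := hF.smooth p
    refine ⟨U, hU, hpU, d, fun i q => shiftTensor J t q (X i q),
      fun i => (hJ.shiftTensor t) U (Set.subset_univ U) hU _ (hX i), fun q hq => ⟨?_, ?_⟩⟩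
    · have h1 := (hXF q hq).1.map_injOn (shiftTensor J t q) (by
        rw [(hXF q hq).2]
        exact (hshift q).injOn t)
      exact h1
    · rw [← (hXF q hq).2, Submodule.map_span, ← Set.range_comp]
      rfl
  -- Being locally the kernel of a smooth form, `w(t)` may be tested on the special sections `(J +
  -- t) X` with `X` in `F`, whose brackets are known.
  · obtain ⟨A, hA, hqA, γ, hγ⟩ := hrep q
    refine mlieBracket_mem_of_formKer hA ⟨hγ.smooth t, hγ.ker t⟩ ?_ hU hX hY hXF hYF hq hqA
    rintro x hx _ ⟨v, hv, rfl⟩ _ ⟨u, hu, rfl⟩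
    obtain ⟨V₁, X₁, hV₁, hxV₁, hX₁, hX₁F, rfl⟩ := hF.exists_section hv
    obtain ⟨V₂, X₂, hV₂, hxV₂, hX₂, hX₂F, rfl⟩ := hF.exists_section hu
    have hV := hV₁.inter hV₂
    have hX₁' := hX₁.mono (Set.inter_subset_left : V₁ ∩ V₂ ⊆ V₁)
    have hX₂' := hX₂.mono (Set.inter_subset_right : V₁ ∩ V₂ ⊆ V₂)
    refine ⟨V₁ ∩ V₂, fun y => shiftTensor J t y (X₁ y), fun y => shiftTensor J t y (X₂ y), hV,
      ⟨hxV₁, hxV₂⟩, (hJ.shiftTensor t) _ (Set.subset_univ _) hV _ hX₁',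
      (hJ.shiftTensor t) _ (Set.subset_univ _) hV _ hX₂',
      fun y hy => Submodule.mem_map_of_mem (hX₁F y hy.1),
      fun y hy => Submodule.mem_map_of_mem (hX₂F y hy.2), rfl, rfl, ?_⟩
    rw [mlieBracket_add_smul hV ⟨hxV₁, hxV₂⟩ (hJ.mono (Set.subset_univ _)) hX₁' hX₂'
      (hN _ hV _ _ hX₁' hX₂' x ⟨hxV₁, hxV₂⟩ hv hu)]
    refine Submodule.mem_map_of_mem ((F x).add_mem ?_ ((F x).smul_mem t ?_))
    · exact hF.bracketDefect_mem hJ hc (Set.subset_univ _) hV hX₁' hX₂'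
        (fun y hy => hX₁F y hy.1) (fun y hy => hX₂F y hy.2) ⟨hxV₁, hxV₂⟩
    · exact hF.involutive _ hV _ _ hX₁' hX₂' (fun y hy => hX₁F y hy.1)
        (fun y hy => hX₂F y hy.2) x ⟨hxV₁, hxV₂⟩

end Representatives

/-! ### Distributing eigenvalues over the basis. -/

section IndexAssignments

variable {r k n : ℕ} {m : Fin r → ℕ}

/-- The repeated eigenvalue, labelled `none`, goes to the first position of `k` of the `r` blocks;
the other `n - k` positions get distinct labels. So no label repeats within a block. -/
theorem exists_assignment_option (hm : ∀ j, 1 ≤ m j) (hn : ∑ j, m j = n) (hk : k ≤ r) :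
    ∃ σ : (Σ j : Fin r, Fin (m j)) → Option (Fin (n - k)),
      (∀ j, Function.Injective fun i : Fin (m j) => σ ⟨j, i⟩) ∧
      ∀ o : Option (Fin (n - k)),
        o.elim k (fun _ => 1) = (Finset.univ.filter fun a => σ a = o).card := by
  classical
  let f : Fin k ↪ Σ j : Fin r, Fin (m j) :=
    ⟨fun l => ⟨Fin.castLE hk l, ⟨0, hm _⟩⟩, fun l l' h => by
      simpa using congrArg (fun a => (a.1 : ℕ)) h |> Fin.ext⟩
  let S := Finset.univ.map f
  have hS : S.card = k := by simp [S]
  have hcard : Fintype.card {a // a ∉ S} = n - k := by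
    rw [Fintype.card_subtype_compl, Fintype.card_coe, hS, Fintype.card_sigma]
    simp [hn]
  let e := Fintype.equivFinOfCardEq hcard
  have hzero : ∀ a ∈ S, (a.2 : ℕ) = 0 := by
    intro a ha
    obtain ⟨l, -, rfl⟩ := Finset.mem_map.1 ha
    rfl
  refine ⟨fun a => if h : a ∈ S then none else some (e ⟨a, h⟩), fun j i i' h => ?_, fun o => ?_⟩
  · simp only at h
    split_ifs at h with h1 h2 h2
    · exact Fin.ext ((hzero _ h1).trans (hzero _ h2).symm)
    · simpa using e.injective (Option.some_injective _ h)
  · cases o with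
    | none =>
      refine hS.symm.trans (congrArg Finset.card (Finset.ext fun a => ?_))
      simp
    | some l =>
      rw [Option.elim_some, eq_comm, Finset.card_eq_one]
      refine ⟨(e.symm l).1, Finset.ext fun a => ?_⟩
      rw [Finset.mem_filter, Finset.mem_singleton]
      constructor
      · rintro ⟨-, h⟩
        dsimp only at h
        split_ifs at h with h1
        rw [← Option.some_injective _ h, e.symm_apply_apply]
      · rintro rfl
        refine ⟨Finset.mem_univ _, ?_⟩
        dsimp only
        rw [dif_neg (e.symm l).2, Subtype.coe_eta, e.apply_symm_apply]

/-- The position of a basis vector in its block. -/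
def blockPosition (a : Σ j : Fin r, Fin (m j)) : Fin (height m) :=
  ⟨a.2, a.2.2.trans_le (Finset.le_sup (Finset.mem_univ a.1))⟩

/-- Positions start at `0`, so block `j` contains position `l` exactly when `l + 1 ≤ m j`. -/
theorem countGE_eq_card (l : Fin (height m)) :
    countGE m (l + 1) = (Finset.univ.filter fun a => blockPosition (m := m) a = l).card := by
  refine Finset.card_bij' (fun j hj => ⟨j, ⟨l, (Finset.mem_filter.1 hj).2⟩⟩) (fun a _ => a.1)
    (fun j hj => ?_) (fun a ha => ?_) (fun j hj => rfl) (fun a ha => ?_)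
  · exact Finset.mem_filter.2 ⟨Finset.mem_univ _, rfl⟩
  · refine Finset.mem_filter.2 ⟨Finset.mem_univ _, ?_⟩
    rw [← (Finset.mem_filter.1 ha).2]
    exact a.2.2
  · obtain ⟨j, i⟩ := a
    have := congrArg Fin.val (Finset.mem_filter.1 ha).2
    exact Sigma.ext rfl (heq_of_eq (Fin.ext this.symm))

end IndexAssignments

/-! ### Resolvent curves of diagonalizable endomorphisms. -/

section Pointwise

variable {𝕜 V : Type*} [RCLike 𝕜] [AddCommGroup V] [Module 𝕜 V] [FiniteDimensional 𝕜 V]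
  {ι : Type*} [Fintype ι] {J : End 𝕜 V} {c : ι → 𝕜} {κ : ι → ℕ}

theorem det_add_smul_one_of_charpoly
    (h : J.charpoly = ∏ i, (Polynomial.X - Polynomial.C (c i)) ^ κ i) (t : 𝕜) :
    LinearMap.det (J + t • (1 : End 𝕜 V)) = ∏ i, (t + c i) ^ κ i := by
  have hdeg : finrank 𝕜 V = ∑ i, κ i := by
    rw [← J.charpoly_natDegree, h,
      Polynomial.natDegree_prod_of_monic _ _ fun i _ => (Polynomial.monic_X_sub_C _).pow _]
    simp
  rw [det_add_smul_one, h, Polynomial.eval_prod, hdeg, ← Finset.prod_pow_eq_pow_sum,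
    ← Finset.prod_mul_distrib]
  refine Finset.prod_congr rfl fun i _ => ?_
  rw [Polynomial.eval_pow, Polynomial.eval_sub, Polynomial.eval_X, Polynomial.eval_C, ← mul_pow]
  congr 1
  ring

theorem exists_eq_of_isRoot_charpoly
    (h : J.charpoly = ∏ i, (Polynomial.X - Polynomial.C (c i)) ^ κ i) {μ : 𝕜}
    (hμ : J.charpoly.IsRoot μ) : ∃ i, μ = c i := by
  rw [h, Polynomial.IsRoot.def, Polynomial.eval_prod, Finset.prod_eq_zero_iff] at hμ
  obtain ⟨i, -, hi⟩ := hμ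
  rw [Polynomial.eval_pow, Polynomial.eval_sub, Polynomial.eval_X, Polynomial.eval_C] at hi
  exact ⟨i, sub_eq_zero.1 (eq_zero_of_pow_eq_zero hi)⟩

/-- The resolvent curves of two tensors adapted to the same web agree. -/
theorem resolventCurve_eq {r : ℕ} (hr : 1 ≤ r) {u : 𝕜 → Submodule 𝕜 V} {J' : End 𝕜 V}
    {γ₀ : 𝕜 → V [⋀^Fin r]→ₗ[𝕜] 𝕜} (hγ₀ : IsVeroneseCurve γ₀) (hu : ∀ t, formKer (γ₀ t) = u t)
    (hJ : ⨆ μ : 𝕜, J.eigenspace μ = ⊤)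
    (h : ∀ c, J.charpoly.IsRoot c → ∀ l : Dual 𝕜 V, l ∘ₗ J = c • l → ∀ v ∈ u (-c), l v = 0)
    (hJ' : ⨆ μ : 𝕜, J'.eigenspace μ = ⊤)
    (h' : ∀ c, J'.charpoly.IsRoot c → ∀ l : Dual 𝕜 V, l ∘ₗ J' = c • l → ∀ v ∈ u (-c), l v = 0)
    {β : V [⋀^Fin r]→ₗ[𝕜] 𝕜} (hβ : formKer β = atInfinity r u) {γ γ' : 𝕜 → V [⋀^Fin r]→ₗ[𝕜] 𝕜}
    (hγ : IsResolventCurve (fun t => LinearMap.det (J + t • (1 : End 𝕜 V))) J β γ)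
    (hγ' : IsResolventCurve (fun t => LinearMap.det (J' + t • (1 : End 𝕜 V))) J' β γ') :
    γ = γ' := by
  obtain ⟨m, hm⟩ := hγ₀
  obtain ⟨hm, b, hb⟩ := exists_basis_of_isVeroneseCurve hm hu
  rw [atInfinity_eq hr hm hb] at hβ
  obtain ⟨c, -, rfl⟩ := exists_eq_smul_wedge_of_formKer_eq (linearIndependent_lastCovector hm) hr hβ
  -- With `β = c γ(∞)` for one fixed splitting basis, the resolvent curve of any adapted tensor is
  -- `c γ(t)`, an expression free of the tensor.
  have key : ∀ {K : End 𝕜 V}, ⨆ μ : 𝕜, K.eigenspace μ = ⊤ →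
      (∀ c, K.charpoly.IsRoot c → ∀ l : Dual 𝕜 V, l ∘ₗ K = c • l → ∀ v ∈ u (-c), l v = 0) →
      IsResolventCurve (fun t => LinearMap.det (K + t • (1 : End 𝕜 V))) K
        (c • wedge (lastCovector b)) (fun t => c • wedge (factor b t)) := fun hK hKu =>
    (shiftsChains_of_eigencovectors hm hK fun c hc l hl v hv => hKu c hc l hl v (by
      rw [hb]
      exact mem_iInf_ker.2 hv)).isResolventCurve hm c
  rw [hγ.unique (key hJ h), hγ'.unique (key hJ' h')]

end Pointwise

/-! ### Adapted tensor fields. -/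

section Adapted

variable {𝕜 E N : Type*} [RCLike 𝕜] [NormedAddCommGroup E] [NormedSpace 𝕜 E]
  [FiniteDimensional 𝕜 E] [TopologicalSpace N] [ChartedSpace E N] [IsManifold 𝓘(𝕜, E) ∞ N]
  {p q : N} {A B : Set N} {r : ℕ} {J : Tensor11 𝕜 E N} {w : 𝕜 → Distribution 𝕜 E N}
  {β : RForm 𝕜 E N r} {ι : Type} [Fintype ι] {c : ι → 𝕜} {κ : ι → ℕ}

theorem IsVeroneseWeb.exists_isVeroneseCurve (hw : IsVeroneseWeb r w) (q : N) :
    ∃ γ : 𝕜 → TangentSpace 𝓘(𝕜, E) q [⋀^Fin r]→ₗ[𝕜] 𝕜,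
      IsVeroneseCurve γ ∧ ∀ t, formKer (γ t) = w t q := by
  obtain ⟨A, -, hqA, γ, hγ⟩ := hw.local_repr q
  exact ⟨fun t => γ t q, hγ.veronese q hqA, fun t => hγ.ker t q hqA⟩

theorem annihilates_of_isRoot {K : End 𝕜 (TangentSpace 𝓘(𝕜, E) q)}
    (h : K.charpoly = ∏ i, (Polynomial.X - Polynomial.C (c i)) ^ κ i)
    (hann : ∀ i, ∀ l : Dual 𝕜 (TangentSpace 𝓘(𝕜, E) q), l ∘ₗ K = c i • l →
      ∀ v ∈ w (-c i) q, l v = 0) :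
    ∀ c, K.charpoly.IsRoot c → ∀ l : Dual 𝕜 (TangentSpace 𝓘(𝕜, E) q), l ∘ₗ K = c • l →
      ∀ v ∈ w (-c) q, l v = 0 := by
  intro μ hμ
  obtain ⟨i, rfl⟩ := exists_eq_of_isRoot_charpoly h hμ
  exact hann i

theorem IsVeroneseWeb.isShiftOf (hw : IsVeroneseWeb r w) {K : End 𝕜 (TangentSpace 𝓘(𝕜, E) q)}
    (h : K.charpoly = ∏ i, (Polynomial.X - Polynomial.C (c i)) ^ κ i)
    (hK : ⨆ μ : 𝕜, K.eigenspace μ = ⊤)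
    (hann : ∀ i, ∀ l : Dual 𝕜 (TangentSpace 𝓘(𝕜, E) q), l ∘ₗ K = c i • l →
      ∀ v ∈ w (-c i) q, l v = 0) :
    IsShiftOf r (fun t => w t q) (infinity r w q) K := by
  obtain ⟨γ, hγ, hγw⟩ := hw.exists_isVeroneseCurve q
  exact isShiftOf_of_eigencovectors hw.pos hγ hγw hK (annihilates_of_isRoot h hann)

theorem IsAdaptedTensor.isShiftOf (hJ : IsAdaptedTensor r w A J c κ) (hw : IsVeroneseWeb r w)
    (hq : q ∈ A) : IsShiftOf r (fun t => w t q) (infinity r w q) (J q) :=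
  hw.isShiftOf (hJ.charpoly q hq) (hJ.diagonalizable q hq) (hJ.annihilates q hq)

theorem IsAdaptedTensor.closedCondition (hJ : IsAdaptedTensor r w A J c κ)
    (hw : IsVeroneseWeb r w) (hA : IsOpen A) : ClosedCondition A (infinity r w) J :=
  closedCondition_of_isShiftOf hA hJ.smooth
    (fun _ hUA hU _ _ hX hY _ hq =>
      nijenhuis_eq_zero_of_isFlatOn hJ.smooth hJ.flat hUA hU hX hY hq)
    (fun _ hq => hJ.isShiftOf hw hq) hw.foliation

theorem IsAdaptedTensor.exists_representative (hJ : IsAdaptedTensor r w A J c κ)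
    (hw : IsVeroneseWeb r w) (hBA : B ⊆ A) (hB : IsOpen B) (hβ : DefinesOn B β (infinity r w)) :
    ∃ γ : 𝕜 → RForm 𝕜 E N r,
      IsResolventCurveOn B (fun _ t => ∏ i, (t + c i) ^ κ i) J β γ ∧ IsRepresentative w B γ := by
  obtain ⟨γ, hγ, hγw⟩ := VeroneseWeb.exists_representative hw.pos hB (hJ.smooth.mono hBA)
    (fun q hq => hJ.isShiftOf hw (hBA hq)) hβ
  refine ⟨γ, fun q hq => ?_, hγw⟩
  have := hγ q hq
  simp only [shiftTensor, det_add_smul_one_of_charpoly (hJ.charpoly q (hBA hq))] at this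
  exact this

theorem IsAdaptedTensor.resolventCurve_eq (hw : IsVeroneseWeb r w)
    (hJ : IsAdaptedTensor r w A J c κ) {ι' : Type} [Fintype ι'] {c' : ι' → 𝕜} {κ' : ι' → ℕ}
    {A' : Set N} {J' : Tensor11 𝕜 E N} (hJ' : IsAdaptedTensor r w A' J' c' κ') (hq : q ∈ A)
    (hq' : q ∈ A') (hβ : formKer (β q) = infinity r w q)
    {γ γ' : 𝕜 → TangentSpace 𝓘(𝕜, E) q [⋀^Fin r]→ₗ[𝕜] 𝕜}
    (hγ : IsResolventCurve (fun t => ∏ i, (t + c i) ^ κ i) (J q) (β q) γ)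
    (hγ' : IsResolventCurve (fun t => ∏ i, (t + c' i) ^ κ' i) (J' q) (β q) γ') : γ = γ' := by
  obtain ⟨γ₀, hγ₀, hγ₀w⟩ := hw.exists_isVeroneseCurve q
  simp only [← det_add_smul_one_of_charpoly (hJ.charpoly q hq)] at hγ
  simp only [← det_add_smul_one_of_charpoly (hJ'.charpoly q hq')] at hγ'
  exact VeroneseWeb.resolventCurve_eq hw.pos hγ₀ hγ₀w (hJ.diagonalizable q hq)
    (annihilates_of_isRoot (hJ.charpoly q hq) (hJ.annihilates q hq)) (hJ'.diagonalizable q hq')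
    (annihilates_of_isRoot (hJ'.charpoly q hq') (hJ'.annihilates q hq')) hβ hγ hγ'

theorem mvfderiv_sum_const_mul (g : Fin r → 𝕜) {h : Fin r → N → 𝕜}
    (hh : ∀ i, MDifferentiableAt 𝓘(𝕜, E) 𝓘(𝕜, 𝕜) (h i) q) (v : TangentSpace 𝓘(𝕜, E) q) :
    mvfderiv 𝓘(𝕜, E) (fun x => ∑ i, g i * h i x) q v =
      ∑ i, g i * mvfderiv 𝓘(𝕜, E) (h i) q v := by
  rw [(mvfderiv_sum_mul Finset.univ (fun i => mdifferentiableAt_const (c := g i)) hh v).2]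
  refine Finset.sum_congr rfl fun i _ => ?_
  rw [mvfderiv_const]
  simp

/-- Covectors annihilating leaves of the web at one point extend to coordinates made of first
integrals; the tensor field that is diagonal in these coordinates is adapted to the web. -/
theorem IsVeroneseWeb.exists_isAdaptedTensor (hw : IsVeroneseWeb r w) {m : Fin r → ℕ}
    (hm : IsCharacteristicNumbers (fun t => w t p) m) [DecidableEq ι] (hc : Function.Injective c)
    {σ : (Σ j : Fin r, Fin (m j)) → ι} (hσ : ∀ j, Function.Injective fun i : Fin (m j) => σ ⟨j, i⟩)
    (hκ : ∀ i, κ i = (Finset.univ.filter fun a => σ a = i).card) :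
    ∃ (A : Set N) (J : Tensor11 𝕜 E N), IsOpen A ∧ p ∈ A ∧ IsAdaptedTensor r w A J c κ := by
  obtain ⟨γ, hγ, hγw⟩ := hm
  obtain ⟨hm, b, hb⟩ := exists_basis_of_isVeroneseCurve hγ hγw
  choose V h hV hpV hh hhw using fun i => (hw.foliation (-c i)).exists_firstIntegrals p
  let W := ⋂ i, V i
  have hW : IsOpen W := isOpen_iInter_of_finite hV
  have hpW : p ∈ W := Set.mem_iInter.2 hpV
  have hWV : ∀ i, W ⊆ V i := fun i => Set.iInter_subset _ i
  -- At `p` the covector `γⱼ(-c)` vanishes on `w(-c)`, so it is a combination of the differentials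
  -- of the first integrals of that leaf family. The same constants define the function `x a`, which
  -- remains a first integral at nearby points.
  have hspan : ∀ a, ∃ g : Fin r → 𝕜, ∀ v : TangentSpace 𝓘(𝕜, E) p,
      factor b (-c (σ a)) a.1 v = ∑ i, g i * mvfderiv 𝓘(𝕜, E) (h (σ a) i) p v := by
    intro a
    have h1 : factor b (-c (σ a)) a.1 ∈ Submodule.span 𝕜 (Set.range fun i =>
        (dForm (h (σ a) i) p : Dual 𝕜 (TangentSpace 𝓘(𝕜, E) p))) := by
      refine mem_span_of_iInf_ker_le_ker fun v hv => ?_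
      have h2 : v ∈ w (-c (σ a)) p := (hhw (σ a) p (hpV _) v).2 fun i => mem_iInf_ker.1 hv i
      rw [hb] at h2
      exact mem_iInf_ker.1 h2 a.1
    obtain ⟨g, hg⟩ := (Submodule.mem_span_range_iff_exists_fun 𝕜).1 h1
    refine ⟨g, fun v => ?_⟩
    rw [← hg, LinearMap.sum_apply]
    rfl
  choose g hg using hspan
  let x : (Σ j : Fin r, Fin (m j)) → N → 𝕜 := fun a y => ∑ i, g a i * h (σ a) i y
  have hx : ∀ a, ContMDiffOn 𝓘(𝕜, E) 𝓘(𝕜, 𝕜) ∞ (x a) W := fun a =>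
    contMDiffOn_finsetSum fun i _ => contMDiffOn_const.mul ((hh (σ a) i).mono (hWV _))
  have hdx : ∀ a, ∀ y ∈ W, ∀ v : TangentSpace 𝓘(𝕜, E) y, mvfderiv 𝓘(𝕜, E) (x a) y v =
      ∑ i, g a i * mvfderiv 𝓘(𝕜, E) (h (σ a) i) y v := fun a y hy v =>
    mvfderiv_sum_const_mul (g a) (fun i => ((hh (σ a) i).contMDiffAt
      ((hV _).mem_nhds (hWV _ hy))).mdifferentiableAt (by simp)) v
  have hcard : Fintype.card (Σ j : Fin r, Fin (m j)) = finrank 𝕜 (TangentSpace 𝓘(𝕜, E) p) := by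
    rw [← sum_eq_finrank b, Fintype.card_sigma]
    simp
  have hcardE : Fintype.card (Σ j : Fin r, Fin (m j)) = finrank 𝕜 E := hcard
  let bE : Basis (Σ j : Fin r, Fin (m j)) 𝕜 E :=
    (finBasisOfFinrankEq 𝕜 E hcardE.symm).reindex (Fintype.equivFin _).symm
  have hli := linearIndependent_factor_points (pts := fun a => -c (σ a))
    (fun j i i' hii => hσ j (hc (neg_injective hii))) b
  obtain ⟨e, he, hpe, heW, hex⟩ := exists_chart_of_linearIndependent bE hW hpW hx
    (fun v hv => by
      have h1 : ⊤ ≤ Submodule.span 𝕜 (Set.range fun a => factor b (-c (σ a)) a.1) := by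
        rw [hli.span_eq_top_of_card_eq_finrank' (hcard.trans Subspace.dual_finrank_eq.symm)]
      refine (Module.forall_dual_apply_eq_zero_iff 𝕜 v).1 fun l => ?_
      have h2 := h1 (Submodule.mem_top (x := l))
      induction h2 using Submodule.span_induction with
      | mem l hl =>
        obtain ⟨a, rfl⟩ := hl
        change factor b (-c (σ a)) a.1 v = 0
        rw [hg, ← hdx a p hpW, hv]
      | zero => rfl
      | add l l' _ _ hl hl' => rw [LinearMap.add_apply, hl, hl', add_zero]
      | smul s l _ hl => rw [LinearMap.smul_apply, hl, smul_zero])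
  -- In the new coordinates `x a` the tensor multiplies the direction of `x a` by `c (σ a)`.
  let L : End 𝕜 E := bE.constr 𝕜 fun a => c (σ a) • bE a
  have hL : ∀ a, L (bE a) = c (σ a) • bE a := fun a => bE.constr_basis 𝕜 _ a
  have hcp : ∀ q ∈ e.source, (chartTensor e L q).charpoly =
      ∏ i, (Polynomial.X - Polynomial.C (c i)) ^ κ i := by
    intro q hq
    obtain ⟨φ, -, hφ⟩ := chartTensor_eq_conj he hq L
    rw [hφ, LinearEquiv.charpoly_conj, charpoly_of_eigenbasis bE hL,
      ← Finset.prod_fiberwise Finset.univ σ]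
    refine Finset.prod_congr rfl fun i _ => ?_
    rw [hκ, ← Finset.prod_const]
    exact Finset.prod_congr rfl fun a ha => by rw [(Finset.mem_filter.1 ha).2]
  have hdiag : IsDiagonalizableOn e.source (chartTensor e L) := by
    intro q hq
    obtain ⟨φ, -, hφ⟩ := chartTensor_eq_conj he hq L
    refine iSup_eigenspace_of_eigenbasis (bE.map φ.symm) (c := fun a => c (σ a)) fun a => ?_
    rw [hφ, Basis.map_apply, LinearEquiv.conj_apply_apply, LinearEquiv.symm_symm,
      φ.apply_symm_apply, hL, map_smul]
  have hann : ∀ q ∈ e.source, ∀ i, ∀ l : Dual 𝕜 (TangentSpace 𝓘(𝕜, E) q),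
      l ∘ₗ chartTensor e L q = c i • l → ∀ v ∈ w (-c i) q, l v = 0 := by
    intro q hq i l hl v hv
    obtain ⟨φ, hφe, hφ⟩ := chartTensor_eq_conj he hq L
    -- An eigencovector for `c i` is a combination of the `dx a` with `σ a = i`, and each of these
    -- vanishes on `w(-c i)`.
    have h1 : ∀ a, σ a ≠ i → l (φ.symm (bE a)) = 0 := by
      intro a ha
      have h2 := LinearMap.congr_fun hl (φ.symm (bE a))
      rw [hφ, LinearMap.comp_apply, LinearEquiv.conj_apply_apply, LinearEquiv.symm_symm,
        φ.apply_symm_apply, hL, map_smul, map_smul, LinearMap.smul_apply] at h2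
      have h3 : (c (σ a) - c i) • l (φ.symm (bE a)) = 0 := by rw [sub_smul, h2, sub_self]
      exact (smul_eq_zero.1 h3).resolve_left (sub_ne_zero.2 fun h => ha (hc h))
    have h4 : l v = ∑ a, bE.repr (φ v) a • l (φ.symm (bE a)) := by
      conv_lhs => rw [← φ.symm_apply_apply v, ← bE.sum_repr (φ v)]
      simp only [map_sum, map_smul]
    rw [h4]
    refine Finset.sum_eq_zero fun a _ => ?_
    by_cases ha : σ a = i
    · have h5 : bE.repr (φ v) a = 0 := by
        rw [← Basis.coord_apply, hφe, hex q hq a v, hdx a q (heW hq)]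
        refine Finset.sum_eq_zero fun s _ => ?_
        rw [(hhw (σ a) q (hWV _ (heW hq)) v).1 (by rwa [ha]) s, mul_zero]
      rw [h5, zero_smul]
    · rw [h1 a ha, smul_zero]
  exact ⟨e.source, chartTensor e L, e.open_source, hpe, smoothTensor11_chartTensor he L, hcp,
    isFlatOn_chartTensor he L, hdiag, hann,
    fun q hq => (hw.isShiftOf (hcp q hq) (hdiag q hq) (hann q hq)).spans⟩

end Adapted

end VeroneseWeb

/-! ### The theorem. -/

open VeroneseWeb in
theorem theorem2p1 {𝕜 : Type*} [RCLike 𝕜]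
    {E : Type*} [NormedAddCommGroup E] [NormedSpace 𝕜 E] [FiniteDimensional 𝕜 E]
    {N : Type*} [TopologicalSpace N] [ChartedSpace E N] [IsManifold 𝓘(𝕜, E) ∞ N]
    (n : ℕ) (hn : finrank 𝕜 E = n) (r : ℕ) (hr : 1 ≤ r) :
    -- (1)
    (∀ w : 𝕜 → Distribution 𝕜 E N, IsVeroneseWeb r w →
      ∀ k : ℕ, 1 ≤ k → k ≤ r → ∀ (a : Fin (n - k) → 𝕜) (a₀ : 𝕜),
      Function.Injective a → (∀ j, a j ≠ a₀) → ∀ p : N,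
      ∃ (A : Set N) (J : Tensor11 𝕜 E N), IsOpen A ∧ p ∈ A ∧
        IsAdaptedTensor r w A J (fun o : Option (Fin (n - k)) => o.elim a₀ a)
          (fun o => o.elim k fun _ => 1) ∧
        (∀ q ∈ A, ∀ S : Submodule 𝕜 (TangentSpace 𝓘(𝕜, E) q),
          S ≤ infinity r w q → S.map (J q) ≤ S → S = ⊥) ∧
        (∀ B ⊆ A, IsOpen B → ∀ β : RForm 𝕜 E N r, DefinesOn B β (infinity r w) →
          ∃ γ : 𝕜 → RForm 𝕜 E N r,
            IsResolventCurveOn B (fun _ t => (∏ j, (t + a j)) * (t + a₀) ^ k) J β γ ∧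
            IsRepresentative w B γ) ∧
        ClosedCondition A (infinity r w) J) ∧
    -- (2)
    (∀ w : 𝕜 → Distribution 𝕜 E N, IsVeroneseWeb r w →
      ∀ (p : N) (m : Fin r → ℕ), IsCharacteristicNumbers (fun t => w t p) m →
      ∀ a' : Fin (height m) → 𝕜, Function.Injective a' →
      ∃ (A' : Set N) (J' : Tensor11 𝕜 E N), IsOpen A' ∧ p ∈ A' ∧
        IsAdaptedTensor r w A' J' a' (fun j => countGE m (j + 1)) ∧
        (∀ B ⊆ A', IsOpen B → ∀ β : RForm 𝕜 E N r, DefinesOn B β (infinity r w) →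
          ∃ γ' : 𝕜 → RForm 𝕜 E N r,
            IsResolventCurveOn B (fun _ t => ∏ j, (t + a' j) ^ countGE m (j + 1)) J' β γ' ∧
            IsRepresentative w B γ') ∧
        ClosedCondition A' (infinity r w) J' ∧
        -- `γ = γ'` on `A ∩ A'`, for the tensor fields `J` of (1)
        (∀ k : ℕ, 1 ≤ k → k ≤ r → ∀ (a : Fin (n - k) → 𝕜) (a₀ : 𝕜),
          Function.Injective a → (∀ j, a j ≠ a₀) →
          ∀ (A : Set N) (J : Tensor11 𝕜 E N), IsOpen A →
          IsAdaptedTensor r w A J (fun o : Option (Fin (n - k)) => o.elim a₀ a)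
            (fun o => o.elim k fun _ => 1) →
          ∀ B ⊆ A ∩ A', IsOpen B → ∀ β : RForm 𝕜 E N r, DefinesOn B β (infinity r w) →
          ∀ γ γ' : 𝕜 → RForm 𝕜 E N r,
            IsResolventCurveOn B (fun _ t => (∏ j, (t + a j)) * (t + a₀) ^ k) J β γ →
            IsResolventCurveOn B (fun _ t => ∏ j, (t + a' j) ^ countGE m (j + 1)) J' β γ' →
            ∀ t, ∀ q ∈ B, γ t q = γ' t q)) ∧
    -- (3)
    (∀ (F : Distribution 𝕜 E N) (J : Tensor11 𝕜 E N), IsFoliation r F →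
      SmoothTensor11 Set.univ J →
      -- the web defined by `F` and `J`; it does not depend on `β`
      ((∀ q, SpansCotangent F J q) → NijenhuisVanishesOn F J → ClosedCondition Set.univ F J →
        ∃ w : 𝕜 → Distribution 𝕜 E N, IsVeroneseWeb r w ∧ infinity r w = F ∧
          ∀ B : Set N, IsOpen B → ∀ β : RForm 𝕜 E N r, DefinesOn B β F →
            ∃ γ : 𝕜 → RForm 𝕜 E N r,
              IsResolventCurveOn B
                (fun q t => (-1) ^ n * (J q).charpoly.eval (-t)) J β γ ∧
              IsRepresentative w B γ) ∧
      -- the closedness condition in terms of closed `1`-forms defining `F`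
      (∀ B : Set N, IsOpen B → ∀ l : Fin r → OneForm 𝕜 E N, (∀ j, IsClosedOneForm B (l j)) →
        (∀ q ∈ B, formKer (wedge fun j => l j q) = F q) →
        (ClosedCondition B F J ↔ ∀ j, WedgeDVanishesOn B l (compTensor (l j) J)))) := by
  have hprod : ∀ (k : ℕ) (a : Fin (n - k) → 𝕜) (a₀ t : 𝕜),
      ∏ o : Option (Fin (n - k)), (t + o.elim a₀ a) ^ (o.elim k fun _ => 1) =
        (∏ j, (t + a j)) * (t + a₀) ^ k := by
    intro k a a₀ t
    rw [Fintype.prod_option, mul_comm]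
    simp only [Option.elim_none, Option.elim_some, pow_one]
  refine ⟨fun w hw k _ hk a a₀ ha haa p => ?_, fun w hw p m hm a' ha' => ?_,
    fun F J hF hJ => ⟨fun hspan hN hc => ?_, fun B hB l hl hlF =>
      closedCondition_iff_wedgeDVanishesOn hF hB (hJ.mono (Set.subset_univ B)) hl hlF⟩⟩
  · obtain ⟨γ, ⟨m, hm⟩, hγw⟩ := hw.exists_isVeroneseCurve p
    obtain ⟨hm1, b, -⟩ := exists_basis_of_isVeroneseCurve hm hγw
    obtain ⟨σ, hσ, hκ⟩ := exists_assignment_option hm1 ((sum_eq_finrank b).trans hn) hk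
    have hc : Function.Injective fun o : Option (Fin (n - k)) => o.elim a₀ a := by
      rintro (_ | j) (_ | j') h
      · rfl
      · exact absurd h.symm (haa j')
      · exact absurd h (haa j)
      · exact congrArg some (ha h)
    obtain ⟨A, J, hA, hpA, hJ⟩ := hw.exists_isAdaptedTensor ⟨γ, hm, hγw⟩ hc hσ hκ
    refine ⟨A, J, hA, hpA, hJ, fun q hq S hS hSJ => (hJ.isShiftOf hw hq).eq_bot hS hSJ,
      fun B hBA hB β hβ => ?_, hJ.closedCondition hw hA⟩
    have h := hJ.exists_representative hw hBA hB hβ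
    simpa only [hprod] using h
  · obtain ⟨A', J', hA', hpA', hJ'⟩ := hw.exists_isAdaptedTensor hm ha'
      (σ := blockPosition) (κ := fun j : Fin (height m) => countGE m (j + 1))
      (fun j i i' h => Fin.ext (Fin.mk.inj h)) countGE_eq_card
    refine ⟨A', J', hA', hpA', hJ', fun B hBA hB β hβ => hJ'.exists_representative hw hBA hB hβ,
      hJ'.closedCondition hw hA', fun k _ _ a a₀ _ _ A J _ hJ B hBA _ β hβ γ γ' hγ hγ' t q hq => ?_⟩
    have h := hγ q hq
    simp only [← hprod] at h
    exact congrFun (hJ.resolventCurve_eq hw hJ' (hBA hq).1 (hBA hq).2 (hβ.2 q hq) h (hγ' q hq)) t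
  · have hshift : ∀ q, IsShiftOf r (fun t => (F q).map (shiftTensor J t q)) (F q) (J q) := fun q =>
      isShiftOf_of_spans (hF.codim q) (hspan q)
    refine ⟨_, isVeroneseWeb_map hr hF hJ hspan hN hc, funext fun q => (hshift q).atInfinity_eq hr,
      fun B hB β hβ => ?_⟩
    obtain ⟨γ, hγ, hγw⟩ := exists_representative hr hB (hJ.mono (Set.subset_univ B))
      (w := fun t q => (F q).map (shiftTensor J t q)) (fun q _ => hshift q) hβ
    refine ⟨γ, fun q hq => ?_, hγw⟩
    have h := hγ q hq
    -- The sign `(-1) ^ n` turns the characteristic polynomial at `-t` into `det (J + t)`, the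
    -- factor of the resolvent curve.
    have hd : ∀ t, LinearMap.det (shiftTensor J t q) = (-1) ^ n * (J q).charpoly.eval (-t) := by
      intro t
      rw [det_add_smul_one, ← hn]
      rfl
    simpa only [hd] using h
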